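/- Let $R$ be a commutative ring, $A$ a commutative $R$-algebra, and $(A,L',L'')$ a twilled Lie-Rinehart algebra over $R$: $(A,L')$ and $(A,L'')$ are Lie-Rinehart algebras over $R$, $L''$ is a left $(A,L')$-module, $L'$ is a left $(A,L'')$-module, and the bracket $[(\xi,x),(\eta,y)]=([\xi,\eta]+x\cdot\eta-y\cdot\xi,\;[x,y]+\xi\cdot y-\eta\cdot x)$ together with the action $(\xi,x)(a)=\xi(a)+x(a)$ turns $(A,L''\oplus L')$ into a Lie-Rinehart algebra. Write $d''$ for the Lie-Rinehart differentials on $\mathrm{Alt}_A^*(L'',A)$, $\mathrm{Alt}_A^*(L'',\Lambda_A^*L')$ and $\mathrm{Alt}_A^*(L'',\mathrm{Alt}_A^*(L',A))$ determined by the induced left $(A,L'')$-module structures on $A$, $\Lambda_A^*L'$, $\mathrm{Alt}_A^*(L',A)$. For an $A$-linear map $\alpha\colon L'\to A$ let $d'_\alpha$ be the Lie-Rinehart operator on $\mathrm{Alt}_A^*(L'',\mathrm{Alt}_A^*(L',A))$, of bidegree $(0,1)$, determined by the $L'$-action on $L''$ and the $(A,L')$-connection $\nabla_\alpha$ on $A$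 with $(d'_\alpha 1)(x)=\alpha(x)$ for $x\in L'$; put $d'=d'_0$. The $1$-form $\alpha$ is closed if $x(\alpha(y))-y(\alpha(x))-\alpha([x,y])=0$ for all $x,y\in L'$, and $L''$-invariant if $\xi(\alpha(x))=\alpha(\xi\cdot x)$ for all $\xi\in L''$, $x\in L'$. Signs are those of the Eilenberg-Koszul convention. The crossed product Gerstenhaber bracket is the bigraded Gerstenhaber bracket $[\cdot,\cdot]'$, of bidegree $(0,-1)$, on the bigraded commutative algebra $\mathcal A=\mathrm{Alt}_A^*(L'',\Lambda_A^*L')$ which restricts to the Lie bracket on $L'$ and satisfies $[x,b]'=x\cdot b$ for $x\in L'$ and $b\in\mathrm{Alt}_A^*(L'',A)$. A generator for it is an $R$-linear operator $\Delta$ on $\mathcal A$ of bidegree $(0,-1)$ with $[a,b]'=(-1)^{|a|}\bigl(\Delta(ab)-(\Delta a)b-(-1)^{|a|}a(\Delta b)\bigr)$ for homogeneous $a,b$ ($|a|$ the total degree); it is exact if $\Delta\Delta=0$. Suppose that $L'$ is a finitely generated projective $A$-module of constant rank $n$ and that $\Omega\colon\Lambda_A^nL'\to A$ is an isomorphism of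 $A$-modules which is $L''$-invariant, i.e. an isomorphism of left $(A,L'')$-modules. Then: 1. The assignment to $u\in\Lambda_A^pL'$ of the form $(y_1,\dots,y_{n-p})\mapsto\Omega(y_1\wedge\dots\wedge y_{n-p}\wedge u)$ induces an isomorphism $$\Omega_\flat\colon(\mathrm{Alt}_A^*(L'',\Lambda_A^*L'),d'')\longrightarrow(\mathrm{Alt}_A^*(L'',\mathrm{Alt}_A^{n-*}(L',A)),d'')$$ of chain complexes over $R$, in fact of differential graded $(\mathrm{Alt}_A^*(L'',A),d'')$-modules. 2. The crossed product Gerstenhaber bracket $[\cdot,\cdot]'$ exists and is unique. There is a unique operator $\partial_\Omega$ on $\mathcal A$ with $\Omega_\flat\partial_\Omega=d'\,\Omega_\flat$; it is an exact generator for $[\cdot,\cdot]'$, and $d''\partial_\Omega+\partial_\Omega d''=0$. 3. For every closed $L''$-invariant $1$-form $\alpha\colon L'\to A$ there is a unique operator $\partial_{(\Omega,\alpha)}$ on $\mathcal A$ with $\Omega_\flat\partial_{(\Omega,\alpha)}=d'_\alpha\,\Omega_\flat$; it is an exact generator for $[\cdot,\cdot]'$, and $d''\partial_{(\Omega,\alpha)}+\partial_{(\Omega,\alpha)}d''=0$.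 4. For every exact generator $\Delta$ for $[\cdot,\cdot]'$ there is a unique closed $1$-form $\alpha\colon L'\to A$ with $\Omega_\flat\Delta=d'_\alpha\,\Omega_\flat$, and this $\alpha$ is $L''$-invariant if and only if $d''\Delta+\Delta d''=0$. In particular, the exact generators that are compatible with $d''$ in this sense are exactly the operators $\partial_{(\Omega,\alpha)}$ with $\alpha$ closed and $L''$-invariant. -/

import Mathlib

open Function

section Core

variable {R A L M N : Type*} [CommRing R] [CommRing A] [Algebra R A]
  [AddCommGroup M] [Module A M] [AddCommGroup N] [Module A N]

lemma derivSum_add {k : ℕ} (T : N →+ N) (f : N [⋀^Fin k]→ₗ[A] M) (v : Fin k → N) (j : Fin k)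
    (x y : N) :
    ∑ i, f (update (update v j (x + y)) i (T (update v j (x + y) i))) =
      ∑ i, f (update (update v j x) i (T (update v j x i))) +
      ∑ i, f (update (update v j y) i (T (update v j y i))) := by
  have h : ∀ z : N, ∑ i, f (update (update v j z) i (T (update v j z i))) =
      f (update v j (T z)) + ∑ i ∈ Finset.univ.erase j, f (update (update v i (T (v i))) j z) := by
    intro z
    rw [← Finset.add_sum_erase _ _ (Finset.mem_univ j)]
    congr 1
    · simp
    · refine Finset.sum_congr rfl fun i hi => ?_
      have hij : i ≠ j := Finset.ne_of_mem_erase hi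
      rw [update_of_ne hij, update_comm hij]
  simp only [h, f.map_update_add, map_add, Finset.sum_add_distrib]
  abel

lemma derivSum_smul {k : ℕ} (δ : A → A) (T : N →+ N)
    (hT : ∀ (a : A) (n : N), T (a • n) = a • T n + δ a • n)
    (f : N [⋀^Fin k]→ₗ[A] M) (v : Fin k → N) (j : Fin k) (a : A) (x : N) :
    ∑ i, f (update (update v j (a • x)) i (T (update v j (a • x) i))) =
      a • ∑ i, f (update (update v j x) i (T (update v j x i))) + δ a • f (update v j x) := by
  have h : ∀ z : N, ∑ i, f (update (update v j z) i (T (update v j z i))) =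
      f (update v j (T z)) + ∑ i ∈ Finset.univ.erase j, f (update (update v i (T (v i))) j z) := by
    intro z
    rw [← Finset.add_sum_erase _ _ (Finset.mem_univ j)]
    congr 1
    · simp
    · refine Finset.sum_congr rfl fun i hi => ?_
      have hij : i ≠ j := Finset.ne_of_mem_erase hi
      rw [update_of_ne hij, update_comm hij]
  simp only [h, f.map_update_smul, hT, f.map_update_add, smul_add, ← Finset.smul_sum]
  abel

lemma derivSum_eq_zero {k : ℕ} (T : N →+ N) (f : N [⋀^Fin k]→ₗ[A] M) (v : Fin k → N)
    (i j : Fin k) (hv : v i = v j) (hij : i ≠ j) : ∑ l, f (update v l (T (v l))) = 0 := by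
  rw [Finset.sum_eq_add i j hij]
  · have : update v j (T (v j)) = update v i (T (v i)) ∘ Equiv.swap i j := by
      ext l
      rcases eq_or_ne l i with rfl | hl
      · simp [hij, hv, hij.symm]
      · rcases eq_or_ne l j with rfl | hl'
        · simp [hv]
        · simp [hl, hl', Equiv.swap_apply_of_ne_of_ne]
    rw [this, f.map_swap _ hij, add_neg_cancel]
  · intro l _ hl
    exact f.map_eq_zero_of_eq _ (by simp [update_of_ne hl.1.symm, update_of_ne hl.2.symm, hv]) hij
  · simp
  · simp

/-- Given additive operators `D` on `M` and `T` on `N` which both satisfy a Leibniz rule over the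
same operator `δ` on `A`, the induced operator
`f ↦ D ∘ f - ∑ i, f (…, T vᵢ, …)` on `A`-multilinear alternating maps. -/
def altDerivation {k : ℕ} (δ : A → A) (D : M →+ M) (T : N →+ N)
    (hD : ∀ (a : A) (m : M), D (a • m) = a • D m + δ a • m)
    (hT : ∀ (a : A) (n : N), T (a • n) = a • T n + δ a • n)
    (f : N [⋀^Fin k]→ₗ[A] M) : N [⋀^Fin k]→ₗ[A] M where
  toFun v := D (f v) - ∑ i, f (update v i (T (v i)))
  map_update_add' := by
    intro inst v j x y
    obtain rfl : inst = instDecidableEqFin k := Subsingleton.elim _ _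
    rw [derivSum_add, f.map_update_add, map_add]
    abel
  map_update_smul' := by
    intro inst v j a x
    obtain rfl : inst = instDecidableEqFin k := Subsingleton.elim _ _
    rw [derivSum_smul δ T hT, f.map_update_smul, hD, smul_sub]
    abel
  map_eq_zero_of_eq' := by
    intro v i j hv hij
    rw [f.map_eq_zero_of_eq v hv hij, map_zero, zero_sub, neg_eq_zero,
      derivSum_eq_zero T f v i j hv hij]

/-- `M × M` with the `A`-module structure `a (m, m') = (a m, a m' + δ(a) m)`. -/
def JetModule {R A : Type*} [CommRing R] [CommRing A] [Algebra R A] (_δ : Derivation R A A)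
    (M : Type*) : Type _ := M × M

instance (δ : Derivation R A A) : AddCommGroup (JetModule δ M) :=
  inferInstanceAs (AddCommGroup (M × M))

instance (δ : Derivation R A A) : Module A (JetModule δ M) where
  smul a m := (a • m.1, a • m.2 + δ a • m.1)
  one_smul m := Prod.ext (one_smul A m.1) (by
    change (1 : A) • m.2 + δ 1 • m.1 = m.2
    simp)
  mul_smul a b m := Prod.ext (mul_smul a b m.1) (by
    change (a * b) • m.2 + δ (a * b) • m.1 = a • (b • m.2 + δ b • m.1) + δ a • b • m.1
    rw [δ.leibniz, add_smul, smul_add, smul_eq_mul, smul_eq_mul, mul_comm b (δ a)]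
    simp only [mul_smul]
    abel)
  smul_zero a := Prod.ext (smul_zero a) (by
    change a • (0 : M) + δ a • (0 : M) = 0
    simp)
  smul_add a m n := Prod.ext (smul_add a m.1 n.1) (by
    change a • (m.2 + n.2) + δ a • (m.1 + n.1) = a • m.2 + δ a • m.1 + (a • n.2 + δ a • n.1)
    simp only [smul_add]
    abel)
  add_smul a b m := Prod.ext (add_smul a b m.1) (by
    change (a + b) • m.2 + δ (a + b) • m.1 = a • m.2 + δ a • m.1 + (b • m.2 + δ b • m.1)
    rw [map_add, add_smul, add_smul]
    abel)
  zero_smul m := Prod.ext (zero_smul A m.1) (by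
    change (0 : A) • m.2 + δ 0 • m.1 = 0
    simp)

/-- The `A`-linear map `u ↦ (u, T u)` on an exterior power, where `T` is extended as a
derivation, `T (v₁ ∧ … ∧ vₚ) = ∑ i, v₁ ∧ … ∧ T vᵢ ∧ … ∧ vₚ`. -/
noncomputable def exteriorJet (δ : Derivation R A A) (T : N →+ N)
    (hT : ∀ (a : A) (n : N), T (a • n) = a • T n + δ a • n) (p : ℕ) :
    ⋀[A]^p N →ₗ[A] JetModule δ (⋀[A]^p N) :=
  exteriorPower.alternatingMapLinearEquiv
    { toFun := fun v => ((exteriorPower.ιMulti A p v,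
        ∑ i, exteriorPower.ιMulti A p (update v i (T (v i)))) : (⋀[A]^p N) × (⋀[A]^p N))
      map_update_add' := by
        intro inst v j x y
        obtain rfl : inst = instDecidableEqFin p := Subsingleton.elim _ _
        exact Prod.ext ((exteriorPower.ιMulti A p).map_update_add v j x y)
          (derivSum_add T (exteriorPower.ιMulti A p) v j x y)
      map_update_smul' := by
        intro inst v j a x
        obtain rfl : inst = instDecidableEqFin p := Subsingleton.elim _ _
        exact Prod.ext ((exteriorPower.ιMulti A p).map_update_smul v j a x)
          (derivSum_smul δ T hT (exteriorPower.ιMulti A p) v j a x)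
      map_eq_zero_of_eq' := by
        intro v i j hv hij
        exact Prod.ext ((exteriorPower.ιMulti A p).map_eq_zero_of_eq v hv hij)
          (derivSum_eq_zero T (exteriorPower.ιMulti A p) v i j hv hij) }

lemma exteriorJet_ιMulti (δ : Derivation R A A) (T : N →+ N)
    (hT : ∀ (a : A) (n : N), T (a • n) = a • T n + δ a • n) (p : ℕ) (v : Fin p → N) :
    exteriorJet δ T hT p (exteriorPower.ιMulti A p v) =
      ((exteriorPower.ιMulti A p v,
        ∑ i, exteriorPower.ιMulti A p (update v i (T (v i)))) : (⋀[A]^p N) × (⋀[A]^p N)) := by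
  rw [exteriorJet, exteriorPower.alternatingMapLinearEquiv_apply_ιMulti]
  rfl

lemma exteriorJet_fst (δ : Derivation R A A) (T : N →+ N)
    (hT : ∀ (a : A) (n : N), T (a • n) = a • T n + δ a • n) (p : ℕ) (u : ⋀[A]^p N) :
    (exteriorJet δ T hT p u).1 = u := by
  let l : ⋀[A]^p N →ₗ[A] ⋀[A]^p N :=
    { toFun := fun u => (exteriorJet δ T hT p u).1
      map_add' := fun u v => by rw [map_add]; rfl
      map_smul' := fun a u => by rw [map_smul]; rfl }
  have h : l = LinearMap.id := by
    apply exteriorPower.linearMap_ext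
    ext v : 1
    change (exteriorJet δ T hT p (exteriorPower.ιMulti A p v)).1 = _
    rw [exteriorJet_ιMulti]
    rfl
  exact LinearMap.congr_fun h u

/-- The extension of `T` to a derivation of the exterior powers. -/
noncomputable def exteriorDerivation (δ : Derivation R A A) (T : N →+ N)
    (hT : ∀ (a : A) (n : N), T (a • n) = a • T n + δ a • n) (p : ℕ) (u : ⋀[A]^p N) : ⋀[A]^p N :=
  (exteriorJet δ T hT p u).2

lemma exteriorDerivation_ιMulti (δ : Derivation R A A) (T : N →+ N)
    (hT : ∀ (a : A) (n : N), T (a • n) = a • T n + δ a • n) (p : ℕ) (v : Fin p → N) :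
    exteriorDerivation δ T hT p (exteriorPower.ιMulti A p v) =
      ∑ i, exteriorPower.ιMulti A p (update v i (T (v i))) := by
  rw [exteriorDerivation, exteriorJet_ιMulti]

lemma exteriorDerivation_add (δ : Derivation R A A) (T : N →+ N)
    (hT : ∀ (a : A) (n : N), T (a • n) = a • T n + δ a • n) (p : ℕ) (u v : ⋀[A]^p N) :
    exteriorDerivation δ T hT p (u + v) =
      exteriorDerivation δ T hT p u + exteriorDerivation δ T hT p v := by
  rw [exteriorDerivation, map_add]
  rfl

lemma exteriorDerivation_smul (δ : Derivation R A A) (T : N →+ N)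
    (hT : ∀ (a : A) (n : N), T (a • n) = a • T n + δ a • n) (p : ℕ) (a : A) (u : ⋀[A]^p N) :
    exteriorDerivation δ T hT p (a • u) = a • exteriorDerivation δ T hT p u + δ a • u := by
  rw [exteriorDerivation, map_smul]
  change a • (exteriorJet δ T hT p u).2 + δ a • (exteriorJet δ T hT p u).1 = _
  rw [exteriorJet_fst]
  rfl

end Core


instance alternatingMapIsScalarTower {R A M N ι : Type*} [CommRing R] [CommRing A] [Algebra R A]
    [AddCommGroup M] [Module A M] [Module R M] [IsScalarTower R A M]
    [AddCommGroup N] [Module A N] : IsScalarTower R A (N [⋀^ι]→ₗ[A] M) :=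
  ⟨fun r a f => by ext v; simp⟩

/-- A (left) `(A, L)`-connection on an `A`-module `M`. -/
structure LRConnection (R A L M : Type*) [CommRing R] [CommRing A] [Algebra R A]
    [LieRing L] [LieAlgebra R L] [Module A L] [LieRingModule L A]
    [AddCommGroup M] [Module R M] [Module A M] [IsScalarTower R A M] where
  toEnd : L →ₗ[A] Module.End R M
  leibniz : ∀ (x : L) (a : A) (m : M), toEnd x (a • m) = a • toEnd x m + ⁅x, a⁆ • m

namespace LRConnection

variable {R A L M N : Type*} [CommRing R] [CommRing A] [Algebra R A]
  [LieRing L] [LieAlgebra R L] [Module A L] [LieRingModule L A]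
  [AddCommGroup M] [Module R M] [Module A M] [IsScalarTower R A M]
  [AddCommGroup N] [Module R N] [Module A N] [IsScalarTower R A N]

/-- A flat connection, that is, a left `(A, L)`-module structure. -/
def IsFlat (D : LRConnection R A L M) : Prop :=
  ∀ (x y : L) (m : M), D.toEnd ⁅x, y⁆ m = D.toEnd x (D.toEnd y m) - D.toEnd y (D.toEnd x m)

/-- The induced connection on alternating `A`-multilinear maps:
`(x f)(v) = x (f v) - ∑ i, f (…, x vᵢ, …)`. -/
def alt (E : LRConnection R A L N) (D : LRConnection R A L M) (k : ℕ) :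
    LRConnection R A L (N [⋀^Fin k]→ₗ[A] M) where
  toEnd :=
    { toFun := fun x =>
        { toFun := altDerivation (fun a => ⁅x, a⁆) (D.toEnd x).toAddMonoidHom
            (E.toEnd x).toAddMonoidHom (D.leibniz x) (E.leibniz x)
          map_add' := by
            intro f g
            ext v
            simp [altDerivation, Finset.sum_add_distrib]
            abel
          map_smul' := by
            intro r f
            ext v
            simp [altDerivation, Finset.smul_sum, smul_sub] }
      map_add' := by
        intro x y
        ext f v
        simp [altDerivation, Finset.sum_add_distrib]
        abel
      map_smul' := by
        intro a x
        ext f v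
        simp [altDerivation, Finset.smul_sum, smul_sub] }
  leibniz := by
    intro x a f
    ext v
    simp [altDerivation, D.leibniz, Finset.smul_sum, smul_sub]
    abel

section Differential

/-- Values of the (unsigned) Cartan-Chevalley-Eilenberg operator:
`∑ i, (-1)^i xᵢ f(…, x̂ᵢ, …) + ∑_{i < j} (-1)^(i+j) f([xᵢ, xⱼ], …, x̂ᵢ, …, x̂ⱼ, …)`,
where in the second sum the bracket is kept in the slot of `xⱼ`
(moving it there from the first slot costs the sign `(-1)^(j-1)`). -/
def ceFun (D : LRConnection R A L M) {q : ℕ} (f : L [⋀^Fin q]→ₗ[A] M) (v : Fin (q + 1) → L) : M :=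
  ∑ i : Fin (q + 1), (-1 : ℤ) ^ (i : ℕ) • (D.toEnd (v i) (f (i.removeNth v)) -
    ∑ j ∈ Finset.univ.filter (fun j : Fin (q + 1) => i < j), f (i.removeNth (update v j ⁅v i, v j⁆)))

lemma ceFun_degree_zero (D : LRConnection R A L M) (f : L [⋀^Fin 0]→ₗ[A] M) (v : Fin 1 → L)
    (w : Fin 0 → L) : D.ceFun f v = D.toEnd (v 0) (f w) := by
  have h : (Finset.univ.filter (fun j : Fin (0 + 1) => 0 < j)) = ∅ := by
    ext j; fin_cases j; simp
  unfold ceFun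
  rw [Fin.sum_univ_one, h, Finset.sum_empty]
  simp [Subsingleton.elim (Fin.tail v) w]

lemma ceFun_add (D : LRConnection R A L M) {q : ℕ} (f g : L [⋀^Fin q]→ₗ[A] M)
    (v : Fin (q + 1) → L) : D.ceFun (f + g) v = D.ceFun f v + D.ceFun g v := by
  simp only [ceFun, AlternatingMap.add_apply, map_add, Finset.sum_add_distrib]
  rw [← Finset.sum_add_distrib]
  refine Finset.sum_congr rfl fun i _ => ?_
  rw [← smul_add]
  congr 1
  abel

lemma ceFun_rsmul (D : LRConnection R A L M) {q : ℕ} (r : R) (f : L [⋀^Fin q]→ₗ[A] M)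
    (v : Fin (q + 1) → L) : D.ceFun (r • f) v = r • D.ceFun f v := by
  simp only [ceFun, AlternatingMap.smul_apply, map_smul, Finset.smul_sum]
  refine Finset.sum_congr rfl fun i _ => ?_
  rw [← Finset.smul_sum, ← smul_sub, smul_comm]

lemma ceFun_smul (D : LRConnection R A L M) {q : ℕ} (a : A) (f : L [⋀^Fin q]→ₗ[A] M)
    (v : Fin (q + 1) → L) :
    D.ceFun (a • f) v = a • D.ceFun f v +
      ∑ i : Fin (q + 1), (-1 : ℤ) ^ (i : ℕ) • ⁅v i, a⁆ • f (i.removeNth v) := by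
  have hs : ∀ (i : Fin (q + 1)) (X : M), a • (-1 : ℤ) ^ (i : ℕ) • X = (-1 : ℤ) ^ (i : ℕ) • a • X :=
    fun i X => smul_comm _ _ _
  have hp : ∀ (c : ℤ) (P Q S : M), c • (a • P + Q - a • S) = a • c • (P - S) + c • Q := by
    intro c P Q S
    rw [smul_comm a c, ← smul_add, smul_sub a P S, add_sub_right_comm]
  simp only [ceFun, AlternatingMap.smul_apply, D.leibniz, ← Finset.smul_sum, hp,
    Finset.sum_add_distrib]

variable [LieRinehartRing A L]

/-- The Lie derivative of an alternating form. -/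
def lieD (D : LRConnection R A L M) {q : ℕ} (x : L) (f : L [⋀^Fin q]→ₗ[A] M) :
    L [⋀^Fin q]→ₗ[A] M :=
  altDerivation (fun a => ⁅x, a⁆) (D.toEnd x).toAddMonoidHom
    (LieModule.toEnd R L L x).toAddMonoidHom (D.leibniz x)
    (by intro a n; simp) f

lemma lieD_apply (D : LRConnection R A L M) {q : ℕ} (x : L) (f : L [⋀^Fin q]→ₗ[A] M)
    (v : Fin q → L) : D.lieD x f v = D.toEnd x (f v) - ∑ i, f (update v i ⁅x, v i⁆) := rfl

lemma ceFun_cons (D : LRConnection R A L M) {q : ℕ} (f : L [⋀^Fin (q + 1)]→ₗ[A] M) (x : L)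
    (v : Fin (q + 1) → L) :
    D.ceFun f (Fin.cons x v) = D.lieD x f v - D.ceFun (f.curryLeft x) v := by
  unfold ceFun
  rw [Fin.sum_univ_succ, lieD_apply]
  have h0 : (Finset.univ.filter (fun j : Fin (q + 2) => 0 < j)) =
      Finset.univ.map (Fin.succEmb (q + 1)) := by
    ext j; cases j using Fin.cases <;> simp 
  have h1 : ∀ i : Fin (q + 1), (Finset.univ.filter (fun j : Fin (q + 2) => i.succ < j)) =
      (Finset.univ.filter (fun j => i < j)).map (Fin.succEmb (q + 1)) := by
    intro i
    ext j; cases j using Fin.cases <;> simp 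
  have hr : ∀ (i : Fin (q + 1)) (w : Fin (q + 1) → L),
      Fin.removeNth i.succ (Fin.cons x w : Fin (q + 2) → L) = Fin.cons x (i.removeNth w) := by
    intro i w
    exact Fin.cons_comp_succ_succAbove x w i
  simp only [h0, h1, Finset.sum_map, Fin.coe_succEmb, Fin.cons_zero, Fin.cons_succ,
    ← Fin.cons_update, Fin.removeNth_zero, Fin.tail_cons, hr, Fin.val_zero, pow_zero, one_smul,
    Fin.val_succ, pow_succ, mul_neg, mul_one, neg_smul, Finset.sum_neg_distrib,
    AlternatingMap.curryLeft_apply_apply]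
  rw [sub_eq_add_neg (D.toEnd x (f v) - _)]
  rfl


lemma lieD_add (D : LRConnection R A L M) {q : ℕ} (x y : L) (f : L [⋀^Fin q]→ₗ[A] M) :
    D.lieD (x + y) f = D.lieD x f + D.lieD y f := by
  ext v
  simp [lieD_apply, Finset.sum_add_distrib]
  abel

lemma lieD_smul (D : LRConnection R A L M) {q : ℕ} (a : A) (x : L) (f : L [⋀^Fin q]→ₗ[A] M)
    (v : Fin q → L) :
    D.lieD (a • x) f v = a • D.lieD x f v + ∑ i, ⁅v i, a⁆ • f (update v i x) := by
  have h : ∀ y : L, ⁅a • x, y⁆ = a • ⁅x, y⁆ - ⁅y, a⁆ • x := by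
    intro y
    rw [← lie_skew, LieRinehartRing.leibniz_smul_right, ← lie_skew x y, smul_neg]
    abel
  simp only [lieD_apply, map_smul, h, f.map_update_sub, f.map_update_smul, smul_sub,
    Finset.sum_sub_distrib, Finset.smul_sum, LinearMap.smul_apply]
  abel

lemma exists_alternating (D : LRConnection R A L M) (q : ℕ) (f : L [⋀^Fin q]→ₗ[A] M) :
    ∃ g : L [⋀^Fin (q + 1)]→ₗ[A] M, ∀ v, g v = D.ceFun f v := by
  induction q with
  | zero =>
    let l : L →ₗ[A] M :=
      { toFun := fun x => D.toEnd x (f ![])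
        map_add' := by simp
        map_smul' := by simp }
    refine ⟨AlternatingMap.ofSubsingleton A L M (0 : Fin 1) l, fun v => ?_⟩
    rw [ceFun_degree_zero D f v ![]]
    rfl
  | succ q ih =>
    choose g hg using ih
    have hadd : ∀ f₁ f₂, g (f₁ + f₂) = g f₁ + g f₂ := by
      intro f₁ f₂; ext v; simp [hg, ceFun_add]
    let G : L →ₗ[A] L [⋀^Fin (q + 1)]→ₗ[A] M :=
      { toFun := fun x => D.lieD x f - g (f.curryLeft x)
        map_add' := by
          intro x y
          rw [lieD_add, map_add, hadd]
          abel
        map_smul' := by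
          intro a x
          ext v
          simp only [AlternatingMap.sub_apply, hg, map_smul, ceFun_smul, lieD_smul,
            AlternatingMap.smul_apply, RingHom.id_apply, smul_sub]
          have hs : ∀ i : Fin (q + 1), (-1 : ℤ) ^ (i : ℕ) • ⁅v i, a⁆ • f.curryLeft x (i.removeNth v) =
              ⁅v i, a⁆ • f (update v i x) := by
            intro i
            rw [AlternatingMap.curryLeft_apply_apply, smul_comm,
              ← AlternatingMap.map_insertNth, Fin.insertNth_removeNth]
          simp only [hs]
          abel }
    have hG : ∀ x v, G x v = D.ceFun f (Fin.cons x v) := by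
      intro x v
      rw [ceFun_cons]
      simp [G, hg]
    have hrep : ∀ (x : L) (w : Fin q → L), G x (Fin.cons x w) = 0 := by
      intro x w
      have h1 : D.lieD x f (Fin.cons x w) = D.lieD x (f.curryLeft x) w := by
        rw [lieD_apply, lieD_apply, Fin.sum_univ_succ]
        simp only [Fin.cons_zero, lie_self, Fin.cons_succ, ← Fin.cons_update]
        rw [f.map_coord_zero (m := update (Fin.cons x w : Fin (q + 1) → L) 0 0) 0 (by simp), zero_add]
        rfl
      change D.lieD x f (Fin.cons x w) - g (f.curryLeft x) (Fin.cons x w) = 0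
      rw [hg, h1]
      cases q with
      | zero =>
        rw [ceFun_degree_zero D _ _ w, lieD_apply]
        simp
      | succ q =>
        have h0 : D.ceFun (0 : L [⋀^Fin q]→ₗ[A] M) w = 0 := by simp [ceFun]
        rw [ceFun_cons, AlternatingMap.curryLeft_same, h0, sub_zero, sub_self]
    have hrep' : ∀ (x : L) (v : Fin (q + 1) → L) (j : Fin (q + 1)), v j = x → G x v = 0 := by
      intro x v j hj
      have : v = j.insertNth x (j.removeNth v) := by
        rw [← hj, Fin.insertNth_self_removeNth]
      rw [this, AlternatingMap.map_insertNth]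
      have := hrep x (j.removeNth v)
      rw [show (Matrix.vecCons x (j.removeNth v)) = Fin.cons x (j.removeNth v) from rfl, this,
        smul_zero]
    refine ⟨{ toFun := fun w => G (w 0) (Fin.tail w), map_update_add' := ?_, map_update_smul' := ?_,
              map_eq_zero_of_eq' := ?_ }, ?_⟩
    · intro inst w j x y
      obtain rfl : inst = instDecidableEqFin _ := Subsingleton.elim _ _
      cases j using Fin.cases with
      | zero => simp
      | succ j => simp [Fin.tail_update_succ, update_of_ne (Fin.succ_ne_zero j).symm]
    · intro inst w j a x
      obtain rfl : inst = instDecidableEqFin _ := Subsingleton.elim _ _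
      cases j using Fin.cases with
      | zero => simp
      | succ j => simp [Fin.tail_update_succ, update_of_ne (Fin.succ_ne_zero j).symm]
    · intro w i j hw hij
      cases i using Fin.cases with
      | zero =>
        cases j using Fin.cases with
        | zero => exact absurd rfl hij
        | succ j => exact hrep' _ _ j hw.symm
      | succ i =>
        cases j using Fin.cases with
        | zero => exact hrep' _ _ i hw
        | succ j =>
          exact (G (w 0)).map_eq_zero_of_eq _ (i := i) (j := j) hw fun h => hij (by rw [h])
    · intro w
      exact (hG _ _).trans (by rw [Fin.cons_self_tail])

/-- The Cartan-Chevalley-Eilenberg operator as an `A`-multilinear alternating map. -/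
def ceAlt (D : LRConnection R A L M) {q : ℕ} (f : L [⋀^Fin q]→ₗ[A] M) :
    L [⋀^Fin (q + 1)]→ₗ[A] M where
  toFun := D.ceFun f
  map_update_add' := by
    intro inst v i x y
    obtain rfl : inst = instDecidableEqFin _ := Subsingleton.elim _ _
    obtain ⟨g, hg⟩ := D.exists_alternating q f
    simp only [← hg]
    exact g.map_update_add v i x y
  map_update_smul' := by
    intro inst v i a x
    obtain rfl : inst = instDecidableEqFin _ := Subsingleton.elim _ _
    obtain ⟨g, hg⟩ := D.exists_alternating q f
    simp only [← hg]
    exact g.map_update_smul v i a x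
  map_eq_zero_of_eq' := by
    intro v i j h hij
    obtain ⟨g, hg⟩ := D.exists_alternating q f
    rw [← hg]
    exact g.map_eq_zero_of_eq v h hij

/-- The Lie-Rinehart operator of a connection (the Lie-Rinehart differential if the connection is
flat), with the Eilenberg-Koszul sign `(-1)^(q+1)`, where `q + 1` is the number of arguments of the
resulting form. -/
def ce (D : LRConnection R A L M) (q : ℕ) :
    (L [⋀^Fin q]→ₗ[A] M) →ₗ[R] (L [⋀^Fin (q + 1)]→ₗ[A] M) where
  toFun f := (-1 : ℤ) ^ (q + 1) • D.ceAlt f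
  map_add' f g := by
    rw [← smul_add]
    exact congrArg _ (AlternatingMap.ext (D.ceFun_add f g))
  map_smul' r f := by
    rw [RingHom.id_apply, smul_comm]
    exact congrArg _ (AlternatingMap.ext (D.ceFun_rsmul r f))

lemma ce_apply (D : LRConnection R A L M) (q : ℕ) (f : L [⋀^Fin q]→ₗ[A] M)
    (v : Fin (q + 1) → L) : D.ce q f v = (-1 : ℤ) ^ (q + 1) • D.ceFun f v := rfl

end Differential

section LieRinehart

variable [LieRinehartRing A L] [LieRinehartAlgebra R A L]

/-- The induced connection on exterior powers:
`x (v₁ ∧ … ∧ vₚ) = ∑ i, v₁ ∧ … ∧ x vᵢ ∧ … ∧ vₚ`. -/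
noncomputable def ext (E : LRConnection R A L N) (p : ℕ) : LRConnection R A L (⋀[A]^p N) :=
  let T (x : L) : ⋀[A]^p N → ⋀[A]^p N :=
    exteriorDerivation (LieRinehartAlgebra.anchor R A L x) (E.toEnd x).toAddMonoidHom
      (E.leibniz x) p
  have hT : ∀ x v, T x (exteriorPower.ιMulti A p v) =
      ∑ i, exteriorPower.ιMulti A p (update v i (E.toEnd x (v i))) := fun x v =>
    exteriorDerivation_ιMulti _ _ (E.leibniz x) p v
  have hadd : ∀ x u w, T x (u + w) = T x u + T x w := fun x u w =>
    exteriorDerivation_add _ _ (E.leibniz x) p u w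
  have hsmul : ∀ x (a : A) u, T x (a • u) = a • T x u + ⁅x, a⁆ • u := fun x a u =>
    exteriorDerivation_smul _ _ (E.leibniz x) p a u
  have hzero : ∀ x, T x 0 = 0 := fun x => by simpa using hadd x 0 0
  { toEnd :=
      { toFun := fun x =>
          { toFun := T x
            map_add' := hadd x
            map_smul' := by
              intro r u
              rw [← algebraMap_smul A r u, hsmul,
                ← LieRinehartAlgebra.anchor_apply (R := R), Derivation.map_algebraMap, zero_smul,
                add_zero, algebraMap_smul]
              rfl }
        map_add' := by
          intro x y
          ext1 u
          change T (x + y) u = T x u + T y u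
          have hu : u ∈ Submodule.span A (Set.range (exteriorPower.ιMulti A p (M := N))) := by
            rw [exteriorPower.ιMulti_span]; trivial
          induction hu using Submodule.span_induction with
          | mem u hu =>
            obtain ⟨v, rfl⟩ := hu
            simp [hT, Finset.sum_add_distrib]
          | zero => simp [hzero]
          | add u w _ _ h1 h2 => rw [hadd, h1, h2, hadd, hadd]; abel
          | smul a u _ h =>
            rw [hsmul, h, hsmul, hsmul, add_lie, add_smul, smul_add]; abel
        map_smul' := by
          intro b x
          ext1 u
          change T (b • x) u = b • T x u
          have hu : u ∈ Submodule.span A (Set.range (exteriorPower.ιMulti A p (M := N))) := by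
            rw [exteriorPower.ιMulti_span]; trivial
          induction hu using Submodule.span_induction with
          | mem u hu =>
            obtain ⟨v, rfl⟩ := hu
            simp [hT, Finset.smul_sum]
          | zero => simp [hzero]
          | add u w _ _ h1 h2 => rw [hadd, h1, h2, hadd, smul_add]
          | smul a u _ h =>
            rw [hsmul, h, hsmul, LieRinehartRing.lie_smul_eq_mul, smul_add, smul_comm, mul_smul] }
    leibniz := hsmul }

lemma ext_ιMulti (E : LRConnection R A L N) (p : ℕ) (x : L) (v : Fin p → N) :
    (E.ext p).toEnd x (exteriorPower.ιMulti A p v) =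
      ∑ i, exteriorPower.ιMulti A p (update v i (E.toEnd x (v i))) :=
  exteriorDerivation_ιMulti _ _ (E.leibniz x) p v

/-- The connection on `A` with `x ↦ (a ↦ x(a) - α(x) a)`. Its Lie-Rinehart operator sends `1` to
the form `α`, and for `α = 0` it is the canonical `(A, L)`-module structure on `A`. -/
def ofForm (R : Type*) {A L : Type*} [CommRing R] [CommRing A] [Algebra R A]
    [LieRing L] [LieAlgebra R L] [Module A L] [LieRingModule L A] [LieRinehartRing A L]
    [LieRinehartAlgebra R A L] (α : L →ₗ[A] A) : LRConnection R A L A where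
  toEnd :=
    { toFun := fun x => LieModule.toEnd R L A x - LinearMap.mulLeft R (α x)
      map_add' := by
        intro x y
        ext a
        simp [add_mul]
        ring
      map_smul' := by
        intro b x
        ext a
        simp
        ring }
  leibniz := by
    intro x a m
    simp
    ring

end LieRinehart

end LRConnection

section Products

variable {A L M N P : Type*} [CommRing A] [AddCommGroup L] [Module A L]
  [AddCommGroup M] [Module A M] [AddCommGroup N] [Module A N] [AddCommGroup P] [Module A P]

/-- The exterior product `⋀^p L × ⋀^s L → ⋀^n L`, for `p + s = n`. -/
noncomputable def exteriorWedge (A L : Type*) [CommRing A] [AddCommGroup L] [Module A L]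
    {p s n : ℕ} (h : p + s = n) : ⋀[A]^p L →ₗ[A] ⋀[A]^s L →ₗ[A] ⋀[A]^n L :=
  LinearMap.mk₂ A
    (fun u w => ⟨(u : ExteriorAlgebra A L) * (w : ExteriorAlgebra A L),
      h ▸ SetLike.mul_mem_graded (A := fun i : ℕ => ⋀[A]^i L) u.2 w.2⟩)
    (fun _ _ _ => Subtype.ext (add_mul _ _ _))
    (fun _ _ _ => Subtype.ext (smul_mul_assoc _ _ _))
    (fun _ _ _ => Subtype.ext (mul_add _ _ _))
    (fun _ _ _ => Subtype.ext (mul_smul_comm _ _ _))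

/-- The shuffle product of alternating maps with respect to a bilinear pairing `μ` of the values:
`(f, g) ↦ ∑ sign(σ) μ (f (v_σ(1), …, v_σ(q))) (g (v_σ(q+1), …, v_σ(q+r)))`, the sum being over all
`(q, r)`-shuffles `σ`. -/
noncomputable def shuffle (μ : M →ₗ[A] N →ₗ[A] P) (q r : ℕ) :
    (L [⋀^Fin q]→ₗ[A] M) →ₗ[A] (L [⋀^Fin r]→ₗ[A] N) →ₗ[A] (L [⋀^Fin (q + r)]→ₗ[A] P) :=
  TensorProduct.curry
    ((AlternatingMap.domDomCongrₗ A finSumFinEquiv).toLinearMap ∘ₗ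
      LinearMap.compAlternatingMapₗ A (TensorProduct.lift μ) ∘ₗ AlternatingMap.domCoprod')

/-- Interchanging the two groups of arguments of an alternating map with values in
alternating maps. -/
def altFlip (A : Type*) {N₁ N₂ P : Type*} [CommRing A] [AddCommGroup N₁] [Module A N₁]
    [AddCommGroup N₂] [Module A N₂] [AddCommGroup P] [Module A P] (q k : ℕ) :
    (N₂ [⋀^Fin q]→ₗ[A] (N₁ [⋀^Fin k]→ₗ[A] P)) →ₗ[A]
      (N₁ [⋀^Fin k]→ₗ[A] (N₂ [⋀^Fin q]→ₗ[A] P)) where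
  toFun f :=
    { toFun := fun x =>
        { toFun := fun ξ => f ξ x
          map_update_add' := by intro inst v j y z; rw [f.map_update_add]; rfl
          map_update_smul' := by intro inst v j a y; rw [f.map_update_smul]; rfl
          map_eq_zero_of_eq' := by intro v i j h hij; rw [f.map_eq_zero_of_eq v h hij]; rfl }
      map_update_add' := by
        intro inst v j y z; ext ξ; exact (f ξ).map_update_add v j y z
      map_update_smul' := by
        intro inst v j a y; ext ξ; exact (f ξ).map_update_smul v j a y
      map_eq_zero_of_eq' := by
        intro v i j h hij; ext ξ; exact (f ξ).map_eq_zero_of_eq v h hij }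
  map_add' f g := rfl
  map_smul' a f := rfl

end Products

open scoped DirectSum

/-- The bigraded module `Alt^*(L, M^*)` of alternating `A`-multilinear forms on `L` with values in
a graded `A`-module `M`; the component of bidegree `(q, k)` is `Alt^q(L, M^k)`. -/
abbrev BiForms (A L : Type*) (M : ℕ → Type*) [CommRing A] [AddCommGroup L] [Module A L]
    [∀ k, AddCommGroup (M k)] [∀ k, Module A (M k)] : Type _ :=
  ⨁ d : ℕ × ℕ, L [⋀^Fin d.1]→ₗ[A] M d.2

namespace BiForms

variable {R A L : Type*} {M : ℕ → Type*} [CommRing R] [CommRing A] [Algebra R A]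

/-- The inclusion of the component of bidegree `(q, k)`. -/
abbrev of [AddCommGroup L] [Module A L] [∀ k, AddCommGroup (M k)] [∀ k, Module A (M k)]
    (q k : ℕ) : (L [⋀^Fin q]→ₗ[A] M k) →ₗ[A] BiForms A L M :=
  DirectSum.lof A (ℕ × ℕ) (fun d => L [⋀^Fin d.1]→ₗ[A] M d.2) (q, k)

/-- The operator of bidegree `(1, 0)` given by the Lie-Rinehart operators of connections on the
`A`-modules `M k`. -/
noncomputable def ce [LieRing L] [LieAlgebra R L] [Module A L] [LieRingModule L A]
    [LieRinehartRing A L] [∀ k, AddCommGroup (M k)] [∀ k, Module R (M k)] [∀ k, Module A (M k)]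
    [∀ k, IsScalarTower R A (M k)] (D : ∀ k, LRConnection R A L (M k)) :
    BiForms A L M →ₗ[R] BiForms A L M :=
  DirectSum.toModule R (ℕ × ℕ) _ fun d =>
    (of (A := A) (L := L) (M := M) (d.1 + 1) d.2).restrictScalars R ∘ₗ (D d.2).ce d.1

/-- The action of the scalar forms `Alt^*(L, A)` on `Alt^*(L, M^*)` by the shuffle product, with
the Eilenberg-Koszul sign `(-1)^(q r)` for forms of degrees `q` and `r`. -/
noncomputable def act [AddCommGroup L] [Module A L] [∀ k, AddCommGroup (M k)]
    [∀ k, Module A (M k)] :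
    (⨁ q : ℕ, L [⋀^Fin q]→ₗ[A] A) →ₗ[A] BiForms A L M →ₗ[A] BiForms A L M :=
  DirectSum.toModule A ℕ _ fun q => LinearMap.flip <|
    DirectSum.toModule A (ℕ × ℕ) _ fun d => LinearMap.flip <|
      (((-1 : ℤ) ^ (q * d.1)) • shuffle (LinearMap.lsmul A (M d.2)) q d.1).compr₂
        (of (q + d.1) d.2)

end BiForms

/-- The bigraded module `Alt^*(L₂, Λ^* L₁)`. -/
abbrev PolyForms (A L₁ L₂ : Type*) [CommRing A] [AddCommGroup L₁] [Module A L₁]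
    [AddCommGroup L₂] [Module A L₂] : Type _ :=
  BiForms A L₂ (fun p => ⋀[A]^p L₁)

/-- The bigraded module `Alt^*(L₂, Alt^*(L₁, A))`. -/
abbrev MixedForms (A L₁ L₂ : Type*) [CommRing A] [AddCommGroup L₁] [Module A L₁]
    [AddCommGroup L₂] [Module A L₂] : Type _ :=
  BiForms A L₂ (fun k => L₁ [⋀^Fin k]→ₗ[A] A)

namespace PolyForms

variable {A L₁ L₂ : Type*} [CommRing A] [AddCommGroup L₁] [Module A L₁]
  [AddCommGroup L₂] [Module A L₂]

/-- The product of `Alt^*(L₂, Λ^* L₁)`: the shuffle product combined with the exterior product, with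
the Eilenberg-Koszul sign `(-1)^((q + p) r)` for bidegrees `(q, p)` and `(r, s)`. -/
noncomputable def mul : PolyForms A L₁ L₂ →ₗ[A] PolyForms A L₁ L₂ →ₗ[A] PolyForms A L₁ L₂ :=
  DirectSum.toModule A (ℕ × ℕ) _ fun d => LinearMap.flip <|
    DirectSum.toModule A (ℕ × ℕ) _ fun e => LinearMap.flip <|
      (((-1 : ℤ) ^ ((d.1 + d.2) * e.1)) •
        shuffle (exteriorWedge A L₁ (rfl : d.2 + e.2 = d.2 + e.2)) d.1 e.1).compr₂
        (BiForms.of (M := fun p => ⋀[A]^p L₁) (d.1 + e.1) (d.2 + e.2))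

/-- An element of `L₁`, viewed in bidegree `(0, 1)`. -/
noncomputable def ofVector (L₂ : Type*) [AddCommGroup L₂] [Module A L₂] (x : L₁) :
    PolyForms A L₁ L₂ :=
  BiForms.of (M := fun p => ⋀[A]^p L₁) 0 1
    (AlternatingMap.constOfIsEmpty A L₂ (Fin 0) (exteriorPower.ιMulti A 1 ![x]))

/-- An `A`-valued form of degree `r` on `L₂`, viewed in bidegree `(r, 0)`. -/
noncomputable def ofForm (L₁ : Type*) [AddCommGroup L₁] [Module A L₁] {r : ℕ}
    (b : L₂ [⋀^Fin r]→ₗ[A] A) : PolyForms A L₁ L₂ :=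
  BiForms.of (M := fun p => ⋀[A]^p L₁) r 0
    ((LinearMap.toSpanSingleton A (⋀[A]^0 L₁) (exteriorPower.ιMulti A 0 ![])).compAlternatingMap b)

/-- Contraction `Λ^p L → Alt^k(L, A)`, `u ↦ ((y₁, …, yₖ) ↦ Ω (y₁ ∧ … ∧ yₖ ∧ u))`, with an `n`-form
`Ω`, where `k + p = n`. -/
noncomputable def contract {n p k : ℕ} (Ω : ⋀[A]^n L₁ →ₗ[A] A) (h : k + p = n) :
    ⋀[A]^p L₁ →ₗ[A] (L₁ [⋀^Fin k]→ₗ[A] A) where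
  toFun u := (Ω ∘ₗ (exteriorWedge A L₁ h).flip u).compAlternatingMap (exteriorPower.ιMulti A k)
  map_add' u w := by ext y; simp
  map_smul' a u := by ext y; simp

/-- The map `Alt^q(L₂, Λ^p L₁) → Alt^q(L₂, Alt^(n-p)(L₁, A))` induced by an `n`-form `Ω` on `L₁`. -/
noncomputable def flat {n : ℕ} (Ω : ⋀[A]^n L₁ →ₗ[A] A) :
    PolyForms A L₁ L₂ →ₗ[A] MixedForms A L₁ L₂ :=
  DirectSum.toModule A (ℕ × ℕ) _ fun d =>
    if h : d.2 ≤ n then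
      BiForms.of (M := fun k => L₁ [⋀^Fin k]→ₗ[A] A) d.1 (n - d.2) ∘ₗ
        LinearMap.compAlternatingMapₗ A (contract Ω (Nat.sub_add_cancel h))
    else 0

end PolyForms

section Bracket

variable {R A L₁ L₂ : Type*} [CommRing R] [CommRing A] [Algebra R A]
  [AddCommGroup L₁] [Module R L₁] [Module A L₁] [IsScalarTower R A L₁]
  [AddCommGroup L₂] [Module A L₂]

local notation "of₁₂" => BiForms.of (A := A) (L := L₂) (M := fun p => ⋀[A]^p L₁)

/-- A bigraded Gerstenhaber bracket on `Alt^*(L₂, Λ^* L₁)`: an `R`-bilinear bracket of bidegree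
`(0, -1)` which is a graded Lie bracket after the second degree is lowered by one, and such that
bracketing with a homogeneous element is a graded derivation of the product. Signs are governed by
the total degree `q + p` of an element of bidegree `(q, p)`. -/
structure IsGerstenhaberBracket
    (B : PolyForms A L₁ L₂ →ₗ[R] PolyForms A L₁ L₂ →ₗ[R] PolyForms A L₁ L₂) : Prop where
  bidegree : ∀ (q p r s m : ℕ) (f : L₂ [⋀^Fin q]→ₗ[A] ⋀[A]^p L₁) (g : L₂ [⋀^Fin r]→ₗ[A] ⋀[A]^s L₁),
    p + s = m + 1 → ∃ h : L₂ [⋀^Fin (q + r)]→ₗ[A] ⋀[A]^m L₁,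
      B (of₁₂ q p f) (of₁₂ r s g) = of₁₂ (q + r) m h
  bidegree_zero : ∀ (q r : ℕ) (f : L₂ [⋀^Fin q]→ₗ[A] ⋀[A]^0 L₁) (g : L₂ [⋀^Fin r]→ₗ[A] ⋀[A]^0 L₁),
    B (of₁₂ q 0 f) (of₁₂ r 0 g) = 0
  antisymm : ∀ (q p r s : ℕ) (f : L₂ [⋀^Fin q]→ₗ[A] ⋀[A]^p L₁) (g : L₂ [⋀^Fin r]→ₗ[A] ⋀[A]^s L₁),
    B (of₁₂ q p f) (of₁₂ r s g) =
      -((-1 : ℤ) ^ ((q + p + 1) * (r + s + 1)) • B (of₁₂ r s g) (of₁₂ q p f))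
  jacobi : ∀ (q p r s : ℕ) (f : L₂ [⋀^Fin q]→ₗ[A] ⋀[A]^p L₁) (g : L₂ [⋀^Fin r]→ₗ[A] ⋀[A]^s L₁)
    (c : PolyForms A L₁ L₂),
    B (of₁₂ q p f) (B (of₁₂ r s g) c) = B (B (of₁₂ q p f) (of₁₂ r s g)) c +
      (-1 : ℤ) ^ ((q + p + 1) * (r + s + 1)) • B (of₁₂ r s g) (B (of₁₂ q p f) c)
  derivation : ∀ (q p r s : ℕ) (f : L₂ [⋀^Fin q]→ₗ[A] ⋀[A]^p L₁)
    (g : L₂ [⋀^Fin r]→ₗ[A] ⋀[A]^s L₁) (c : PolyForms A L₁ L₂),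
    B (of₁₂ q p f) (PolyForms.mul (of₁₂ r s g) c) =
      PolyForms.mul (B (of₁₂ q p f) (of₁₂ r s g)) c +
      (-1 : ℤ) ^ ((q + p + 1) * (r + s)) • PolyForms.mul (of₁₂ r s g) (B (of₁₂ q p f) c)

/-- `Δ` is a generator of the bracket `B`: it is `R`-linear of bidegree `(0, -1)`, and
`[a, b] = (-1)^|a| (Δ(a b) - (Δ a) b - (-1)^|a| a (Δ b))` for homogeneous `a`, `b`. -/
structure IsGenerator
    (B : PolyForms A L₁ L₂ →ₗ[R] PolyForms A L₁ L₂ →ₗ[R] PolyForms A L₁ L₂)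
    (Δ : PolyForms A L₁ L₂ →ₗ[R] PolyForms A L₁ L₂) : Prop where
  bidegree : ∀ (q p : ℕ) (f : L₂ [⋀^Fin q]→ₗ[A] ⋀[A]^(p + 1) L₁),
    ∃ h : L₂ [⋀^Fin q]→ₗ[A] ⋀[A]^p L₁, Δ (of₁₂ q (p + 1) f) = of₁₂ q p h
  bidegree_zero : ∀ (q : ℕ) (f : L₂ [⋀^Fin q]→ₗ[A] ⋀[A]^0 L₁), Δ (of₁₂ q 0 f) = 0
  generates : ∀ (q p r s : ℕ) (f : L₂ [⋀^Fin q]→ₗ[A] ⋀[A]^p L₁)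
    (g : L₂ [⋀^Fin r]→ₗ[A] ⋀[A]^s L₁),
    B (of₁₂ q p f) (of₁₂ r s g) = (-1 : ℤ) ^ (q + p) •
      (Δ (PolyForms.mul (of₁₂ q p f) (of₁₂ r s g)) -
        PolyForms.mul (Δ (of₁₂ q p f)) (of₁₂ r s g) -
        (-1 : ℤ) ^ (q + p) • PolyForms.mul (of₁₂ q p f) (Δ (of₁₂ r s g)))

/-- An exact generator is a generator of square zero. -/
def IsExactGenerator
    (B : PolyForms A L₁ L₂ →ₗ[R] PolyForms A L₁ L₂ →ₗ[R] PolyForms A L₁ L₂)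
    (Δ : PolyForms A L₁ L₂ →ₗ[R] PolyForms A L₁ L₂) : Prop :=
  IsGenerator B Δ ∧ ∀ m, Δ (Δ m) = 0

end Bracket

/-- An almost twilled Lie-Rinehart algebra `(A, L₁, L₂)` over `R`: Lie-Rinehart algebras `(A, L₁)`
and `(A, L₂)` together with a left `(A, L₁)`-module structure on `L₂` and a left
`(A, L₂)`-module structure on `L₁`. -/
structure AlmostTwilled (R A L₁ L₂ : Type*) [CommRing R] [CommRing A] [Algebra R A]
    [LieRing L₁] [LieAlgebra R L₁] [Module A L₁] [LieRingModule L₁ A] [LieRinehartRing A L₁]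
    [LieRinehartAlgebra R A L₁]
    [LieRing L₂] [LieAlgebra R L₂] [Module A L₂] [LieRingModule L₂ A] [LieRinehartRing A L₂]
    [LieRinehartAlgebra R A L₂] where
  act₁₂ : LRConnection R A L₁ L₂
  flat₁₂ : act₁₂.IsFlat
  act₂₁ : LRConnection R A L₂ L₁
  flat₂₁ : act₂₁.IsFlat

namespace AlmostTwilled

variable {R A L₁ L₂ : Type*} [CommRing R] [CommRing A] [Algebra R A]
  [LieRing L₁] [LieAlgebra R L₁] [Module A L₁] [LieRingModule L₁ A] [LieRinehartRing A L₁]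
  [LieRinehartAlgebra R A L₁]
  [LieRing L₂] [LieAlgebra R L₂] [Module A L₂] [LieRingModule L₂ A] [LieRinehartRing A L₂]
  [LieRinehartAlgebra R A L₂]

/-- The bracket on `L₂ ⊕ L₁` assembled from the two brackets and the two actions. -/
def sumBracket (T : AlmostTwilled R A L₁ L₂) (u v : L₂ × L₁) : L₂ × L₁ :=
  (⁅u.1, v.1⁆ + T.act₁₂.toEnd u.2 v.1 - T.act₁₂.toEnd v.2 u.1,
    ⁅u.2, v.2⁆ + T.act₂₁.toEnd u.1 v.2 - T.act₂₁.toEnd v.1 u.2)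

/-- The action of `L₂ ⊕ L₁` on `A`. -/
def sumAnchor (_T : AlmostTwilled R A L₁ L₂) (u : L₂ × L₁) (a : A) : A := ⁅u.1, a⁆ + ⁅u.2, a⁆

/-- `(A, L₁, L₂)` is a twilled Lie-Rinehart algebra: the bracket and the action on `A` turn
`(A, L₂ ⊕ L₁)` into a Lie-Rinehart algebra. (`R`-bilinearity, and that `L₂ ⊕ L₁` acts by `R`-linear
derivations, are clear from the construction.) -/
structure IsTwilled (T : AlmostTwilled R A L₁ L₂) : Prop where
  lie_self : ∀ u, T.sumBracket u u = 0
  jacobi : ∀ u v w, T.sumBracket u (T.sumBracket v w) =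
    T.sumBracket (T.sumBracket u v) w + T.sumBracket v (T.sumBracket u w)
  anchor_lie : ∀ u v a, T.sumAnchor (T.sumBracket u v) a =
    T.sumAnchor u (T.sumAnchor v a) - T.sumAnchor v (T.sumAnchor u a)
  anchor_smul : ∀ (a : A) u b, T.sumAnchor (a • u) b = a * T.sumAnchor u b
  lie_smul : ∀ u (a : A) v, T.sumBracket u (a • v) = T.sumAnchor u a • v + a • T.sumBracket u v

/-- The operator `d''` on `Alt^*(L₂, Λ^* L₁)`. -/
noncomputable def dPoly (T : AlmostTwilled R A L₁ L₂) :
    PolyForms A L₁ L₂ →ₗ[R] PolyForms A L₁ L₂ :=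
  BiForms.ce fun p => T.act₂₁.ext p

/-- The operator `d''` on `Alt^*(L₂, Alt^*(L₁, A))`. -/
noncomputable def dMixed (T : AlmostTwilled R A L₁ L₂) :
    MixedForms A L₁ L₂ →ₗ[R] MixedForms A L₁ L₂ :=
  BiForms.ce fun k => T.act₂₁.alt (LRConnection.ofForm R (0 : L₂ →ₗ[A] A)) k

/-- The operator `d'_α` of bidegree `(0, 1)` on `Alt^*(L₂, Alt^*(L₁, A))`, for a 1-form `α` on
`L₁`; for `α = 0` it is `d'`. It is the Lie-Rinehart operator for the action of `L₁` on
`Alt^q(L₂, A)` induced by the action on `L₂` and the connection on `A` given by `α`. The sign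
`(-1)^q` is the Eilenberg-Koszul sign for moving an operator of degree one past a form of degree
`q`; it makes `d'` and `d''` anticommute. -/
noncomputable def dPrime (T : AlmostTwilled R A L₁ L₂) (α : L₁ →ₗ[A] A) :
    MixedForms A L₁ L₂ →ₗ[R] MixedForms A L₁ L₂ :=
  DirectSum.toModule R (ℕ × ℕ) _ fun d =>
    (-1 : ℤ) ^ d.1 •
      ((BiForms.of (A := A) (L := L₂) (M := fun k => L₁ [⋀^Fin k]→ₗ[A] A)
          d.1 (d.2 + 1)).restrictScalars R ∘ₗ
        (altFlip A (d.2 + 1) d.1).restrictScalars R ∘ₗ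
          (T.act₁₂.alt (LRConnection.ofForm R α) d.1).ce d.2 ∘ₗ
            (altFlip A d.1 d.2).restrictScalars R)

/-- The crossed product bracket on `Alt^*(L₂, Λ^* L₁)`: the bigraded Gerstenhaber bracket which
extends the Lie bracket of `L₁` and the action of `L₁` on `Alt^*(L₂, A)`. -/
structure IsCrossedProductBracket (T : AlmostTwilled R A L₁ L₂)
    (B : PolyForms A L₁ L₂ →ₗ[R] PolyForms A L₁ L₂ →ₗ[R] PolyForms A L₁ L₂) : Prop where
  gerstenhaber : IsGerstenhaberBracket B
  lie : ∀ x y : L₁, B (PolyForms.ofVector L₂ x) (PolyForms.ofVector L₂ y) =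
    PolyForms.ofVector L₂ ⁅x, y⁆
  action : ∀ (x : L₁) (r : ℕ) (b : L₂ [⋀^Fin r]→ₗ[A] A),
    B (PolyForms.ofVector L₂ x) (PolyForms.ofForm L₁ b) =
      PolyForms.ofForm L₁ ((T.act₁₂.alt (LRConnection.ofForm R (0 : L₁ →ₗ[A] A)) r).toEnd x b)

/-- The 1-form `α` on `L₁` is closed. -/
def IsClosedForm (_T : AlmostTwilled R A L₁ L₂) (α : L₁ →ₗ[A] A) : Prop :=
  ∀ x y : L₁, ⁅x, α y⁆ - ⁅y, α x⁆ - α ⁅x, y⁆ = 0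

/-- The 1-form `α` on `L₁` is `L₂`-invariant. -/
def IsInvariantForm (T : AlmostTwilled R A L₁ L₂) (α : L₁ →ₗ[A] A) : Prop :=
  ∀ (ξ : L₂) (x : L₁), ⁅ξ, α x⁆ = α (T.act₂₁.toEnd ξ x)

end AlmostTwilled

/-! Contraction with Ω identifies `Λ^p L₁` with `Alt^(n-p)(L₁, A)`, so each `d'_α` can be carried to
an operator `divergence` on `Alt(L₂, Λ L₁)`. The theorem is then read off from the way elementary
operators correspond: left multiplication by a vector becomes minus its insertion
(`PolyForms.flat_ofVector_mul`), left multiplication by a scalar form becomes the module action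
(`PolyForms.flat_ofForm_mul`), and the commutator of `divergence` with a vector becomes minus a Lie
derivative (`flat_divergence_ofVector_mul`).

Bijectivity of the contraction rests on `L₁` being a retract of a free module, so that alternating
forms are combinations of determinants of 1-forms. Such a determinant is a contraction, by
induction: an exterior product of degree `n + 1` is zero, and contracting it with a 1-form yields
the Laplace expansion (`exists_contract_eq_det`). Injectivity follows by duality between
complementary degrees. Compatibility with `d''` is naturality of the Lie-Rinehart operator, because
invariance of Ω makes the contraction a map of `(A, L₂)`-modules.

The sum `d'' + d'_α` is the Lie-Rinehart operator of `L₂ ⊕ L₁` for the connection `a ↦ u(a) - α(u₂)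
a`, which is flat when α, extended by zero to `L₂`, is closed; this amounts to α being closed and
invariant. Its square is not expanded. The iterated commutator of the operator with two insertions
is the insertion of the total bracket; hence the defect `[L_u, L_v] - L_[u,v]`, next `[d, L_u]`, and
finally `d²` commute or anticommute with all insertions. An operator of that kind vanishes as soon
as its values have no component of bidegree `(0, 0)` (`IsInsertionCalculus.square_eq_zero`).
Separating bidegrees gives `d'_α d'_α = 0` and the anticommutation with `d''` together
(`dPrime_dPrime_and_dMixed_dPrime`).

That `divergence` generates a Gerstenhaber bracket is Koszul's argument: an operator `D` of odd
degree which kills 1 and has order at most two fails to be a derivation by a biderivation, and `D² =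
0` gives the Jacobi identity (`deviation_mul`, `deviation_jacobi`). The order is tested on the
generators of the algebra, vectors and scalar forms, where the second commutators are explicit; the
same commutators show that the generated bracket has the prescribed values. Biderivations are
determined on generators (`PolyForms.IsBiderivation.ext`), so the bracket is unique and does not
depend on α.

Conversely, two generators of one bracket differ on `L₁` by an `A`-linear form, and a generator is
determined on `L₁`; hence each generator is the `divergence` of some α (`exists_eq_divergence`).
Evaluating `d'_α d'_α` and `d'' d'_α + d'_α d''` on the constant form 1 recovers closedness and
invariance of α. -/

/-! ### Shuffle products: recursion by inserting a vector. -/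

section Shuffle

open Equiv Perm

variable {α β : Type*}

/-- The first point of `Fin (q + 1) ⊕ β` split off. -/
def sumOptionInl (q : ℕ) (β : Type*) : Option (Fin q ⊕ β) ≃ Fin (q + 1) ⊕ β where
  toFun o := o.elim (Sum.inl 0) (Sum.map Fin.succ id)
  invFun := Sum.elim (Fin.cases none fun i => some (Sum.inl i)) fun b => some (Sum.inr b)
  left_inv o := by rcases o with _ | i | b <;> rfl
  right_inv x := by
    rcases x with i | b
    · cases i using Fin.cases <;> rfl
    · rfl

/-- The first point of the second summand of `α ⊕ Fin (r + 1)` split off. -/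
def sumOptionInr (α : Type*) (r : ℕ) : Option (α ⊕ Fin r) ≃ α ⊕ Fin (r + 1) where
  toFun o := o.elim (Sum.inr 0) (Sum.map id Fin.succ)
  invFun := Sum.elim (fun a => some (Sum.inl a)) (Fin.cases none fun i => some (Sum.inr i))
  left_inv o := by rcases o with _ | i | b <;> rfl
  right_inv x := by
    rcases x with i | b
    · rfl
    · cases b using Fin.cases <;> rfl

theorem mem_sumCongrHom_range_iff [Finite α] [Finite β] {σ : Perm (α ⊕ β)} :
    σ ∈ (sumCongrHom α β).range ↔ ∀ a, ∃ a', σ (Sum.inl a) = Sum.inl a' := by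
  constructor
  · rintro ⟨⟨s, t⟩, rfl⟩ a
    exact ⟨s a, rfl⟩
  · intro h
    refine mem_sumCongrHom_range_of_perm_mapsTo_inl ?_
    rintro _ ⟨a, rfl⟩
    obtain ⟨a', h'⟩ := h a
    exact ⟨a', h'.symm⟩

theorem exists_inr_of_mem_sumCongrHom_range {σ : Perm (α ⊕ β)}
    (h : σ ∈ (sumCongrHom α β).range) (b : β) : ∃ b', σ (Sum.inr b) = Sum.inr b' := by
  obtain ⟨⟨s, t⟩, rfl⟩ := h
  exact ⟨t b, rfl⟩

/-- A permutation extended by a fixed point, along an equivalence. -/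
def permExtend {X Y : Type*} (E : Option X ≃ Y) (σ : Perm X) : Perm Y := E.permCongr σ.optionCongr

theorem permExtend_none {X Y : Type*} (E : Option X ≃ Y) (σ : Perm X) :
    permExtend E σ (E none) = E none := by simp [permExtend]

theorem permExtend_some {X Y : Type*} (E : Option X ≃ Y) (σ : Perm X) (x : X) :
    permExtend E σ (E (some x)) = E (some (σ x)) := by simp [permExtend]

theorem permExtend_mul {X Y : Type*} (E : Option X ≃ Y) (σ τ : Perm X) :
    permExtend E (σ * τ) = permExtend E σ * permExtend E τ := by
  ext y
  obtain ⟨o, rfl⟩ := E.surjective y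
  rcases o with _ | x
  · simp [permExtend]
  · simp [permExtend]

theorem permExtend_inv {X Y : Type*} (E : Option X ≃ Y) (σ : Perm X) :
    permExtend E σ⁻¹ = (permExtend E σ)⁻¹ := by
  rw [eq_inv_iff_mul_eq_one, ← permExtend_mul]
  ext y
  simp [permExtend]

theorem sign_permExtend {X Y : Type*} [Fintype X] [DecidableEq X] [Fintype Y] [DecidableEq Y]
    (E : Option X ≃ Y) (σ : Perm X) : sign (permExtend E σ) = sign σ := by
  rw [permExtend, sign_permCongr, Equiv.optionCongr_sign]

theorem exists_permExtend {X Y : Type*} [DecidableEq X] (E : Option X ≃ Y) (ρ : Perm Y)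
    (h : ρ (E none) = E none) : ∃ σ, permExtend E σ = ρ := by
  refine ⟨removeNone (E.symm.permCongr ρ), ?_⟩
  rw [permExtend, map_equiv_removeNone]
  ext y
  simp [h]

/-- The added point is fixed and belongs to the first block, so it has no influence on whether the
blocks are preserved. This makes the extension compatible with cosets, and injective on them. -/
theorem permExtend_inl_mem_iff [Finite β] {q : ℕ} (σ : Perm (Fin q ⊕ β)) :
    permExtend (sumOptionInl q β) σ ∈ (sumCongrHom (Fin (q + 1)) β).range ↔
      σ ∈ (sumCongrHom (Fin q) β).range := by
  rw [mem_sumCongrHom_range_iff, mem_sumCongrHom_range_iff]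
  constructor
  · intro h a
    obtain ⟨a', h'⟩ := h a.succ
    rw [show (Sum.inl a.succ : Fin (q + 1) ⊕ β) = sumOptionInl q β (some (Sum.inl a)) from rfl,
      permExtend_some] at h'
    rcases hx : σ (Sum.inl a) with x | x
    · exact ⟨x, rfl⟩
    · rw [hx] at h'
      exact absurd h' Sum.inr_ne_inl
  · intro h a
    cases a using Fin.cases with
    | zero => exact ⟨0, permExtend_none (sumOptionInl q β) σ⟩
    | succ a =>
      obtain ⟨a', h'⟩ := h a
      exact ⟨a'.succ, by
        rw [show (Sum.inl a.succ : Fin (q + 1) ⊕ β) = sumOptionInl q β (some (Sum.inl a)) from rfl,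
          permExtend_some, h']; rfl⟩

theorem permExtend_inr_mem_iff [Finite α] {r : ℕ} (σ : Perm (α ⊕ Fin r)) :
    permExtend (sumOptionInr α r) σ ∈ (sumCongrHom α (Fin (r + 1))).range ↔
      σ ∈ (sumCongrHom α (Fin r)).range := by
  rw [mem_sumCongrHom_range_iff, mem_sumCongrHom_range_iff]
  refine forall_congr' fun a => ?_
  rw [show (Sum.inl a : α ⊕ Fin (r + 1)) = sumOptionInr α r (some (Sum.inl a)) from rfl,
    permExtend_some]
  rcases σ (Sum.inl a) with x | x <;> simp [sumOptionInr]

/-- Cosets of permutations with a given point in the first block. -/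
def modSumCongrInl (q : ℕ) (β : Type*) [Finite β] :
    ModSumCongr (Fin q) β → ModSumCongr (Fin (q + 1)) β :=
  Quotient.map' (permExtend (sumOptionInl q β)) fun σ τ h => by
    rw [QuotientGroup.leftRel_apply] at h ⊢
    rwa [← permExtend_inv, ← permExtend_mul, permExtend_inl_mem_iff]

/-- Cosets of permutations with a given point in the second block. -/
def modSumCongrInr (α : Type*) [Finite α] (r : ℕ) (τ₀ : Perm (α ⊕ Fin (r + 1))) :
    ModSumCongr α (Fin r) → ModSumCongr α (Fin (r + 1)) :=
  Quotient.map' (fun σ => τ₀ * permExtend (sumOptionInr α r) σ) fun σ τ h => by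
    rw [QuotientGroup.leftRel_apply] at h ⊢
    rwa [mul_inv_rev, mul_assoc, inv_mul_cancel_left, ← permExtend_inv, ← permExtend_mul,
      permExtend_inr_mem_iff]

theorem modSumCongrInl_injective (q : ℕ) (β : Type*) [Finite β] :
    Injective (modSumCongrInl q β) := by
  intro c d
  induction c using Quotient.inductionOn' with | _ σ
  induction d using Quotient.inductionOn' with | _ τ
  intro h
  have h' := QuotientGroup.leftRel_apply.mp (Quotient.exact' h)
  rw [← permExtend_inv, ← permExtend_mul, permExtend_inl_mem_iff] at h'
  exact Quotient.sound' (QuotientGroup.leftRel_apply.mpr h')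

theorem modSumCongrInr_injective (α : Type*) [Finite α] (r : ℕ) (τ₀ : Perm (α ⊕ Fin (r + 1))) :
    Injective (modSumCongrInr α r τ₀) := by
  intro c d
  induction c using Quotient.inductionOn' with | _ σ
  induction d using Quotient.inductionOn' with | _ τ
  intro h
  have h' := QuotientGroup.leftRel_apply.mp (Quotient.exact' h)
  rw [mul_inv_rev, mul_assoc, inv_mul_cancel_left, ← permExtend_inv, ← permExtend_mul,
    permExtend_inr_mem_iff] at h'
  exact Quotient.sound' (QuotientGroup.leftRel_apply.mpr h')

/-- A representative of the first kind takes the value `inl 0` on the first block, one of the second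
kind on the second block. Two representatives of the same coset differ by a block-preserving
permutation, so this distinguishes the cosets. -/
theorem modSumCongrInl_ne_modSumCongrInr {q r : ℕ} (c : ModSumCongr (Fin q) (Fin (r + 1)))
    (d : ModSumCongr (Fin (q + 1)) (Fin r)) :
    modSumCongrInl q (Fin (r + 1)) c ≠
      modSumCongrInr (Fin (q + 1)) r (swap (Sum.inl 0) (Sum.inr 0)) d := by
  induction c using Quotient.inductionOn' with | _ σ
  induction d using Quotient.inductionOn' with | _ τ
  intro h
  have h' := QuotientGroup.leftRel_apply.mp (Quotient.exact' h)
  obtain ⟨b, hb⟩ := exists_inr_of_mem_sumCongrHom_range h' 0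
  rw [Perm.mul_apply, Perm.inv_eq_iff_eq, Perm.mul_apply,
    show (Sum.inr 0 : Fin (q + 1) ⊕ Fin (r + 1)) = sumOptionInr _ r none from rfl,
    permExtend_none] at hb
  have h0 : permExtend (sumOptionInl q (Fin (r + 1))) σ (Sum.inl 0) = Sum.inl 0 :=
    permExtend_none _ _
  change swap (Sum.inl 0) (Sum.inr 0) (Sum.inr 0) = _ at hb
  rw [swap_apply_right, ← h0] at hb
  exact Sum.inl_ne_inr ((permExtend (sumOptionInl q (Fin (r + 1))) σ).injective hb)

theorem exists_modSumCongrInl {q : ℕ} {β : Type*} [Finite β]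
    (σ : Perm (Fin (q + 1) ⊕ β)) (a : Fin (q + 1)) (h : σ (Sum.inl a) = Sum.inl 0) :
    ∃ c, modSumCongrInl q β c = Quotient.mk'' σ := by
  classical
  -- Changing σ within its coset by the transposition of `0` and `a` in the first block makes `inl
  -- 0` a fixed point.
  obtain ⟨g, hg⟩ := exists_permExtend (sumOptionInl q β)
    (σ * Perm.sumCongr (swap 0 a) 1) (by
      change σ (Sum.inl (swap 0 a 0)) = Sum.inl 0
      rw [swap_apply_left, h])
  refine ⟨Quotient.mk'' g, Quotient.sound' ?_⟩
  rw [QuotientGroup.leftRel_apply, hg, mul_inv_rev, mul_assoc, inv_mul_cancel, mul_one]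
  exact inv_mem ⟨(swap 0 a, 1), rfl⟩

theorem exists_modSumCongrInr {α : Type*} [Finite α] {r : ℕ} (τ₀ : Perm (α ⊕ Fin (r + 1)))
    (σ : Perm (α ⊕ Fin (r + 1))) (b : Fin (r + 1)) (h : σ (Sum.inr b) = τ₀ (Sum.inr 0)) :
    ∃ c, modSumCongrInr α r τ₀ c = Quotient.mk'' σ := by
  classical
  obtain ⟨g, hg⟩ := exists_permExtend (sumOptionInr α r)
    (τ₀⁻¹ * (σ * Perm.sumCongr 1 (swap 0 b))) (by
      change τ₀⁻¹ (σ (Sum.inr (swap 0 b 0))) = Sum.inr 0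
      rw [swap_apply_left, h, ← Perm.mul_apply, inv_mul_cancel, Perm.one_apply])
  refine ⟨Quotient.mk'' g, Quotient.sound' ?_⟩
  rw [QuotientGroup.leftRel_apply]
  change (τ₀ * permExtend (sumOptionInr α r) g)⁻¹ * σ ∈ _
  rw [hg, mul_inv_cancel_left, mul_inv_rev, mul_assoc, inv_mul_cancel,
    mul_one]
  exact inv_mem ⟨(1, swap 0 b), rfl⟩

variable {A N M₁ M₂ : Type*} [CommRing A] [AddCommGroup N] [Module A N] [AddCommGroup M₁]
  [Module A M₁] [AddCommGroup M₂] [Module A M₂]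

open AlternatingMap

theorem summand_modSumCongrInl [Fintype β] [DecidableEq β] {q : ℕ}
    (f : N [⋀^Fin (q + 1)]→ₗ[A] M₁) (g : N [⋀^β]→ₗ[A] M₂) (w : Fin (q + 1) ⊕ β → N)
    (c : ModSumCongr (Fin q) β) :
    domCoprod.summand f g (modSumCongrInl q β c) w =
      domCoprod.summand (f.curryLeft (w (Sum.inl 0))) g c
        (fun x => w (sumOptionInl q β (some x))) := by
  induction c using Quotient.inductionOn' with | _ σ
  change (sign (permExtend (sumOptionInl q β) σ) • _ : MultilinearMap _ _ _) w =
    (sign σ • _ : MultilinearMap _ _ _) _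
  rw [sign_permExtend]
  simp only [_root_.smul_apply, MultilinearMap.domDomCongr_apply,
    MultilinearMap.domCoprod_apply, coe_multilinearMap, curryLeft_apply_apply]
  congr 3
  · funext i
    cases i using Fin.cases with
    | zero =>
      exact congrArg w (permExtend_none (sumOptionInl q β) σ)
    | succ i => exact congrArg w (permExtend_some (sumOptionInl q β) σ (Sum.inl i))

theorem summand_modSumCongrInr [Fintype α] [DecidableEq α] {r : ℕ}
    (τ₀ : Perm (α ⊕ Fin (r + 1)))
    (f : N [⋀^α]→ₗ[A] M₁) (g : N [⋀^Fin (r + 1)]→ₗ[A] M₂) (w : α ⊕ Fin (r + 1) → N)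
    (c : ModSumCongr α (Fin r)) :
    domCoprod.summand f g (modSumCongrInr α r τ₀ c) w =
      sign τ₀ • domCoprod.summand f (g.curryLeft (w (τ₀ (Sum.inr 0)))) c
        (fun x => w (τ₀ (sumOptionInr α r (some x)))) := by
  induction c using Quotient.inductionOn' with | _ σ
  change (sign (τ₀ * permExtend (sumOptionInr α r) σ) • _ : MultilinearMap _ _ _) w =
    sign τ₀ • (sign σ • _ : MultilinearMap _ _ _) _
  rw [Perm.sign_mul, sign_permExtend, mul_smul]
  simp only [_root_.smul_apply, MultilinearMap.domDomCongr_apply,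
    MultilinearMap.domCoprod_apply, coe_multilinearMap, curryLeft_apply_apply, Perm.mul_apply]
  congr 4
  · funext i
    cases i using Fin.cases with
    | zero =>
      exact congrArg (fun z => w (τ₀ z)) (permExtend_none (sumOptionInr α r) σ)
    | succ i => exact congrArg (fun z => w (τ₀ z)) (permExtend_some (sumOptionInr α r) σ (Sum.inr i))

theorem domCoprod_apply_eq_sum [Fintype α] [DecidableEq α] [Fintype β] [DecidableEq β]
    (f : N [⋀^α]→ₗ[A] M₁) (g : N [⋀^β]→ₗ[A] M₂) (w : α ⊕ β → N) :
    f.domCoprod g w = ∑ c, domCoprod.summand f g c w := by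
  rw [domCoprod_apply, _root_.sum_apply]

/-- Shuffles are divided according to the block that receives the first argument. In the second case
a transposition exchanges the first points of the two blocks, and its sign is the minus sign. -/
theorem domCoprod_succ_succ {q r : ℕ} (f : N [⋀^Fin (q + 1)]→ₗ[A] M₁)
    (g : N [⋀^Fin (r + 1)]→ₗ[A] M₂) (w : Fin (q + 1) ⊕ Fin (r + 1) → N) :
    f.domCoprod g w =
      (f.curryLeft (w (Sum.inl 0))).domCoprod g
        (fun x => w (sumOptionInl q (Fin (r + 1)) (some x))) -
      f.domCoprod (g.curryLeft (w (Sum.inl 0))) (fun x => w (swap (Sum.inl 0) (Sum.inr 0)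
        (sumOptionInr (Fin (q + 1)) r (some x)))) := by
  simp only [domCoprod_apply_eq_sum]
  have hb : Bijective (Sum.elim (modSumCongrInl q (Fin (r + 1)))
      (modSumCongrInr (Fin (q + 1)) r (swap (Sum.inl 0) (Sum.inr 0)))) := by
    refine ⟨(modSumCongrInl_injective _ _).sumElim (modSumCongrInr_injective _ _ _)
      modSumCongrInl_ne_modSumCongrInr, fun c => ?_⟩
    induction c using Quotient.inductionOn' with | _ σ
    rcases hx : σ⁻¹ (Sum.inl 0) with a | b
    · obtain ⟨c, hc⟩ := exists_modSumCongrInl σ a (by rw [← hx, ← Perm.mul_apply, mul_inv_cancel, Perm.one_apply])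
      exact ⟨Sum.inl c, hc⟩
    · obtain ⟨c, hc⟩ := exists_modSumCongrInr (swap (Sum.inl 0) (Sum.inr 0)) σ b
        (by rw [← hx, ← Perm.mul_apply, mul_inv_cancel, Perm.one_apply, swap_apply_right])
      exact ⟨Sum.inr c, hc⟩
  rw [← hb.sum_comp, Fintype.sum_sum_type]
  simp only [Sum.elim_inl, Sum.elim_inr, summand_modSumCongrInl, summand_modSumCongrInr,
    swap_apply_right]
  rw [sign_swap Sum.inl_ne_inr, sub_eq_add_neg, ← Finset.sum_neg_distrib]
  simp

theorem domCoprod_succ_isEmpty {q : ℕ} [IsEmpty β] [Fintype β] [DecidableEq β]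
    (f : N [⋀^Fin (q + 1)]→ₗ[A] M₁)
    (g : N [⋀^β]→ₗ[A] M₂) (w : Fin (q + 1) ⊕ β → N) :
    f.domCoprod g w =
      (f.curryLeft (w (Sum.inl 0))).domCoprod g (fun x => w (sumOptionInl q β (some x))) := by
  simp only [domCoprod_apply_eq_sum]
  have hb : Bijective (modSumCongrInl q β) := by
    refine ⟨modSumCongrInl_injective _ _, fun c => ?_⟩
    induction c using Quotient.inductionOn' with | _ σ
    rcases hx : σ⁻¹ (Sum.inl 0) with a | b
    · exact exists_modSumCongrInl σ a (by rw [← hx, ← Perm.mul_apply, mul_inv_cancel, Perm.one_apply])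
    · exact isEmptyElim b
  rw [← hb.sum_comp]
  simp only [summand_modSumCongrInl]

theorem domCoprod_isEmpty_succ {r : ℕ} [IsEmpty α] [Fintype α] [DecidableEq α]
    (f : N [⋀^α]→ₗ[A] M₁)
    (g : N [⋀^Fin (r + 1)]→ₗ[A] M₂) (w : α ⊕ Fin (r + 1) → N) :
    f.domCoprod g w =
      f.domCoprod (g.curryLeft (w (Sum.inr 0))) (fun x => w (sumOptionInr α r (some x))) := by
  simp only [domCoprod_apply_eq_sum]
  have hb : Bijective (modSumCongrInr α r 1) := by
    refine ⟨modSumCongrInr_injective _ _ _, fun c => ?_⟩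
    induction c using Quotient.inductionOn' with | _ σ
    rcases hx : σ⁻¹ (Sum.inr 0) with a | b
    · exact isEmptyElim a
    · exact exists_modSumCongrInr 1 σ b (by rw [← hx, ← Perm.mul_apply, mul_inv_cancel])
  rw [← hb.sum_comp]
  simp [summand_modSumCongrInr]

theorem domCoprod_isEmpty_isEmpty [IsEmpty α] [Fintype α] [DecidableEq α] [IsEmpty β] [Fintype β]
    [DecidableEq β] (f : N [⋀^α]→ₗ[A] M₁) (g : N [⋀^β]→ₗ[A] M₂) (w : α ⊕ β → N) :
    f.domCoprod g w = f (fun a => w (Sum.inl a)) ⊗ₜ g (fun b => w (Sum.inr b)) := by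
  rw [domCoprod_apply_eq_sum]
  have : Subsingleton (ModSumCongr α β) := Quot.Subsingleton
  refine (Fintype.sum_eq_single (Quotient.mk'' 1)
    fun c hc => absurd (Subsingleton.elim _ _) hc).trans ?_
  rw [domCoprod.summand_mk'']
  simp [MultilinearMap.domCoprod_apply]

variable {P : Type*} [AddCommGroup P] [Module A P] (μ : M₁ →ₗ[A] M₂ →ₗ[A] P)

theorem shuffle_apply {q r : ℕ} (f : N [⋀^Fin q]→ₗ[A] M₁) (g : N [⋀^Fin r]→ₗ[A] M₂)
    (v : Fin (q + r) → N) :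
    shuffle μ q r f g v = TensorProduct.lift μ (f.domCoprod g (v ∘ finSumFinEquiv)) := rfl

theorem shuffle_zero_zero (f : N [⋀^Fin 0]→ₗ[A] M₁) (g : N [⋀^Fin 0]→ₗ[A] M₂)
    (v : Fin (0 + 0) → N) : shuffle μ 0 0 f g v = μ (f ![]) (g ![]) := by
  rw [shuffle_apply, domCoprod_isEmpty_isEmpty, TensorProduct.lift.tmul]
  rw [Subsingleton.elim (fun a => (v ∘ finSumFinEquiv) (Sum.inl a)) ![],
    Subsingleton.elim (fun b => (v ∘ finSumFinEquiv) (Sum.inr b)) ![]]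

theorem shuffle_zero_succ {r : ℕ} (f : N [⋀^Fin 0]→ₗ[A] M₁) (g : N [⋀^Fin (r + 1)]→ₗ[A] M₂)
    (x : N) :
    (shuffle μ 0 (r + 1) f g).curryLeft x = shuffle μ 0 r f (g.curryLeft x) := by
  ext v
  rw [curryLeft_apply_apply, shuffle_apply, shuffle_apply, domCoprod_isEmpty_succ]
  congr 2
  funext s
  rcases s with s | s
  · exact s.elim0
  · change Matrix.vecCons x v (finSumFinEquiv (Sum.inr s.succ)) = _
    rw [show (finSumFinEquiv (Sum.inr s.succ) : Fin (0 + (r + 1))) =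
      Fin.succ (finSumFinEquiv (Sum.inr s)) from Fin.ext (by simp), Matrix.cons_val_succ]
    rfl

theorem shuffle_succ_zero {q : ℕ} (f : N [⋀^Fin (q + 1)]→ₗ[A] M₁) (g : N [⋀^Fin 0]→ₗ[A] M₂)
    (x : N) :
    (shuffle μ (q + 1) 0 f g).curryLeft x = shuffle μ q 0 (f.curryLeft x) g := by
  ext v
  rw [curryLeft_apply_apply, shuffle_apply, shuffle_apply, domCoprod_succ_isEmpty]
  congr 2
  funext s
  rcases s with s | s
  · rfl
  · exact s.elim0

/-- Insertion of a vector is an antiderivation of the shuffle product. -/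
theorem shuffle_succ_succ {q r : ℕ} (f : N [⋀^Fin (q + 1)]→ₗ[A] M₁)
    (g : N [⋀^Fin (r + 1)]→ₗ[A] M₂) (x : N) :
    (shuffle μ (q + 1) (r + 1) f g).curryLeft x =
      (shuffle μ q (r + 1) (f.curryLeft x) g).domDomCongr (finCongr (by omega)) +
        (-1 : ℤ) ^ (q + 1) • shuffle μ (q + 1) r f (g.curryLeft x) := by
  ext v
  rw [curryLeft_apply_apply, AlternatingMap.add_apply, AlternatingMap.smul_apply,
    AlternatingMap.domDomCongr_apply, shuffle_apply, shuffle_apply, domCoprod_succ_succ, map_sub,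
    sub_eq_add_neg]
  congr 1
  · congr 2
    funext s
    rcases s with s | s
    · rfl
    · change Matrix.vecCons x v (finSumFinEquiv (Sum.inr s)) = _
      rw [show (finSumFinEquiv (Sum.inr s) : Fin (q + 1 + (r + 1))) =
        Fin.succ (Fin.cast (show q + (r + 1) = q + 1 + r by omega)
          (finSumFinEquiv (Sum.inr s : Fin q ⊕ Fin (r + 1))))
        from Fin.ext (by simp; omega), Matrix.cons_val_succ]
      rfl
  -- After the transposition the remaining arguments are read in the order `q, 0, …, q - 1, q + 1,
  -- …`. Restoring the natural order takes a cycle of length `q + 1`, of sign `(-1)^q`; with the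
  -- minus sign of `domCoprod_succ_succ` this gives `(-1)^(q + 1)`.
  · let i : Fin (q + 1 + r) := ⟨q, by omega⟩
    have hs : ∀ s : Fin (q + 1) ⊕ Fin r,
        (finSumFinEquiv (swap (Sum.inl 0) (Sum.inr 0) (sumOptionInr (Fin (q + 1)) r (some s))) :
          Fin (q + 1 + (r + 1))) = Fin.succ (i.cycleRange.symm (finSumFinEquiv s)) := by
      intro s
      have key : ∀ z : Fin (q + 1 + r), finSumFinEquiv s = i.cycleRange z →
          Fin.succ (i.cycleRange.symm (finSumFinEquiv s)) = z.succ := by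
        intro z hz
        rw [hz, symm_apply_apply]
      rcases s with s | s
      · cases s using Fin.cases with
        | zero =>
          change finSumFinEquiv (swap (Sum.inl 0) (Sum.inr 0) (Sum.inl 0)) = _
          rw [swap_apply_left, key i]
          · exact Fin.ext (by simp [i])
          · refine Fin.ext ?_
            rw [Fin.coe_cycleRange_of_le le_rfl]
            simp
        | succ s =>
          change finSumFinEquiv (swap (Sum.inl 0) (Sum.inr 0) (Sum.inl s.succ)) = _
          rw [swap_apply_of_ne_of_ne (by simp [Fin.succ_ne_zero]) (by simp),
            key ⟨s, by omega⟩]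
          · exact Fin.ext (by simp)
          · refine Fin.ext ?_
            rw [Fin.coe_cycleRange_of_lt (by simp [i, Fin.lt_def])]
            simp
      · change finSumFinEquiv (swap (Sum.inl 0) (Sum.inr 0) (Sum.inr s.succ)) = _
        rw [swap_apply_of_ne_of_ne (by simp) (by simp [Fin.succ_ne_zero]),
          key ⟨q + 1 + s, by omega⟩]
        · exact Fin.ext (by simp; omega)
        · rw [Fin.cycleRange_of_gt (by simp [i, Fin.lt_def]; omega)]
          exact Fin.ext (by simp)
    have h : shuffle μ (q + 1) r f (g.curryLeft x) (v ∘ i.cycleRange.symm) =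
        (-1 : ℤ) ^ q • shuffle μ (q + 1) r f (g.curryLeft x) v := by
      rw [AlternatingMap.map_perm, Perm.sign_symm, Fin.sign_cycleRange]
      simp [Units.smul_def, i]
    rw [pow_succ, mul_neg_one, neg_smul, ← h, shuffle_apply]
    congr 3
    funext s
    exact (congrArg (Matrix.vecCons x v) (hs s)).trans (Matrix.cons_val_succ _ _ _)

end Shuffle

/-! ### Derivations of the shuffle product. -/

section ShuffleDerivation

open Equiv Perm AlternatingMap

variable {A N M₁ M₂ P : Type*} [CommRing A] [AddCommGroup N] [Module A N] [AddCommGroup M₁]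
  [Module A M₁] [AddCommGroup M₂] [Module A M₂] [AddCommGroup P] [Module A P]

theorem altDerivation_apply {k : ℕ} (δ : A → A) (D : M₁ →+ M₁) (T : N →+ N)
    (hD : ∀ (a : A) (m : M₁), D (a • m) = a • D m + δ a • m)
    (hT : ∀ (a : A) (n : N), T (a • n) = a • T n + δ a • n)
    (f : N [⋀^Fin k]→ₗ[A] M₁) (v : Fin k → N) :
    altDerivation δ D T hD hT f v = D (f v) - ∑ i, f (update v i (T (v i))) := rfl

theorem summand_mk_apply {α β : Type*} [Fintype α] [DecidableEq α] [Fintype β] [DecidableEq β]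
    (f : N [⋀^α]→ₗ[A] M₁) (g : N [⋀^β]→ₗ[A] M₂) (σ : Perm (α ⊕ β)) (w : α ⊕ β → N) :
    domCoprod.summand f g (Quotient.mk'' σ) w = (sign σ : ℤ) •
      (f (fun i => w (σ (Sum.inl i))) ⊗ₜ[A] g (fun i => w (σ (Sum.inr i)))) := rfl

/-- The operator `altDerivation` is a derivation of the shuffle product. -/
theorem altDerivation_shuffle (μ : M₁ →ₗ[A] M₂ →ₗ[A] P) (δ : A → A) (D₁ : M₁ →+ M₁)
    (D₂ : M₂ →+ M₂) (D : P →+ P) (T : N →+ N)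
    (hD₁ : ∀ (a : A) (m : M₁), D₁ (a • m) = a • D₁ m + δ a • m)
    (hD₂ : ∀ (a : A) (m : M₂), D₂ (a • m) = a • D₂ m + δ a • m)
    (hD : ∀ (a : A) (m : P), D (a • m) = a • D m + δ a • m)
    (hT : ∀ (a : A) (n : N), T (a • n) = a • T n + δ a • n)
    (hμ : ∀ a b, D (μ a b) = μ (D₁ a) b + μ a (D₂ b)) {q r : ℕ}
    (f : N [⋀^Fin q]→ₗ[A] M₁) (g : N [⋀^Fin r]→ₗ[A] M₂) :
    altDerivation δ D T hD hT (shuffle μ q r f g) =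
      shuffle μ q r (altDerivation δ D₁ T hD₁ hT f) g +
        shuffle μ q r f (altDerivation δ D₂ T hD₂ hT g) := by
  -- The derivation rule already holds for each shuffle separately: after reindexing by σ, the sum
  -- over all arguments splits into those fed to `f` and those fed to `g`.
  have key : ∀ (c : ModSumCongr (Fin q) (Fin r)) (w : Fin q ⊕ Fin r → N),
      D (TensorProduct.lift μ (domCoprod.summand f g c w)) -
        ∑ x, TensorProduct.lift μ (domCoprod.summand f g c (update w x (T (w x)))) =
      TensorProduct.lift μ (domCoprod.summand (altDerivation δ D₁ T hD₁ hT f) g c w) +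
        TensorProduct.lift μ (domCoprod.summand f (altDerivation δ D₂ T hD₂ hT g) c w) := by
    intro c w
    induction c using Quotient.inductionOn' with | _ σ
    simp only [summand_mk_apply, map_zsmul, TensorProduct.lift.tmul, altDerivation_apply, ← Finset.smul_sum, hμ]
    rw [← smul_sub, ← smul_add]
    congr 1
    have hu : ∀ y z, update w (σ y) (T (w (σ y))) (σ z) =
        update (w ∘ σ) y (T ((w ∘ σ) y)) z := by
      intro y z
      rw [update_apply_of_injective w σ.injective]
      rfl
    rw [← Equiv.sum_comp σ]
    simp only [hu]
    rw [Fintype.sum_sum_type]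
    have hl : ∀ (a : Fin q) t, (fun i => update (w ∘ σ) (Sum.inl a) t (Sum.inl i)) =
        update (fun i => w (σ (Sum.inl i))) a t := by
      intro a t
      funext i
      rcases eq_or_ne i a with rfl | h
      · simp
      · simp [h]
    have hr : ∀ (a : Fin r) t, (fun i => update (w ∘ σ) (Sum.inr a) t (Sum.inr i)) =
        update (fun i => w (σ (Sum.inr i))) a t := by
      intro a t
      funext i
      rcases eq_or_ne i a with rfl | h
      · simp
      · simp [h]
    have hl' : ∀ (a : Fin q) t, (fun i => update (w ∘ σ) (Sum.inl a) t (Sum.inr i)) =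
        (fun i => w (σ (Sum.inr i))) := by
      intro a t
      funext i
      simp
    have hr' : ∀ (a : Fin r) t, (fun i => update (w ∘ σ) (Sum.inr a) t (Sum.inl i)) =
        (fun i => w (σ (Sum.inl i))) := by
      intro a t
      funext i
      simp
    simp only [hl, hr, hl', hr', comp_apply, map_sub, map_sum, LinearMap.sub_apply,
      LinearMap.sum_apply]
    abel
  ext v
  rw [altDerivation_apply, AlternatingMap.add_apply]
  simp only [shuffle_apply, domCoprod_apply_eq_sum, map_sum, ← Finset.sum_add_distrib, ← key]
  rw [Finset.sum_sub_distrib]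
  congr 1
  refine Finset.sum_comm.trans (Finset.sum_congr rfl fun c _ =>
    (finSumFinEquiv.sum_comp _).symm.trans (Finset.sum_congr rfl fun x _ => ?_))
  rw [show update v (finSumFinEquiv x) (T (v (finSumFinEquiv x))) ∘ finSumFinEquiv =
    update (v ∘ finSumFinEquiv) x (T ((v ∘ finSumFinEquiv) x)) by
    rw [update_comp_equiv, symm_apply_apply]; rfl]

theorem shuffle_zero_left (μ : M₁ →ₗ[A] M₂ →ₗ[A] P) {r : ℕ} (f : N [⋀^Fin 0]→ₗ[A] M₁)
    (g : N [⋀^Fin r]→ₗ[A] M₂) :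
    shuffle μ 0 r f g =
      ((μ (f ![])).compAlternatingMap g).domDomCongr (finCongr (Nat.zero_add r).symm) := by
  induction r with
  | zero =>
    ext v
    rw [shuffle_zero_zero]
    simp only [domDomCongr_apply, LinearMap.compAlternatingMap_apply]
    congr 2
    exact Subsingleton.elim _ _
  | succ r ih =>
    ext v
    have hv : v = Matrix.vecCons (v 0) (Fin.tail v) := (Fin.cons_self_tail v).symm
    have h1 := congrFun (congrArg DFunLike.coe (shuffle_zero_succ μ f g (v 0))) (Fin.tail v)
    rw [curryLeft_apply_apply, ← hv, ih] at h1
    rw [h1]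
    simp only [domDomCongr_apply, LinearMap.compAlternatingMap_apply, curryLeft_apply_apply]
    congr 2
    funext i
    cases i using Fin.cases with
    | zero => rfl
    | succ i => rfl

end ShuffleDerivation

/-! ### Insertion operators on bigraded forms. -/

namespace BiForms

variable {R A L : Type*} {M : ℕ → Type*} [CommRing R] [CommRing A] [Algebra R A]
  [AddCommGroup L] [Module A L] [∀ k, AddCommGroup (M k)] [∀ k, Module A (M k)]

theorem of_congr {q q' : ℕ} (p : ℕ) (h : q = q') (f : L [⋀^Fin q]→ₗ[A] M p) :
    of q p f = of q' p (f.domDomCongr (finCongr h)) := by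
  subst h
  rfl

theorem exists_of_congr {q q' p p' : ℕ} (hq : q = q') (hp : p = p') (f : L [⋀^Fin q]→ₗ[A] M p) :
    ∃ f', of q p f = of (A := A) (L := L) (M := M) q' p' f' := by
  subst hq hp
  exact ⟨f, rfl⟩

theorem of_injective (q p : ℕ) : Injective (of (A := A) (L := L) (M := M) q p) :=
  DirectSum.of_injective (β := fun d : ℕ × ℕ => L [⋀^Fin d.1]→ₗ[A] M d.2) (q, p)

/-- Insertion of `x` on the component of bidegree `d`, with sign `(-1)^q` on forms of degree `q`. -/
noncomputable def contrAux (x : L) :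
    (d : ℕ × ℕ) → (L [⋀^Fin d.1]→ₗ[A] M d.2) →ₗ[A] BiForms A L M
  | (0, _) => 0
  | (q + 1, k) => (-1 : ℤ) ^ (q + 1) • (of q k ∘ₗ AlternatingMap.curryLeftLinearMap.flip x)

/-- Insertion of a vector, an operator of bidegree `(-1, 0)`. -/
noncomputable def contr (x : L) : BiForms A L M →ₗ[A] BiForms A L M :=
  DirectSum.toModule A (ℕ × ℕ) _ (contrAux x)

theorem contr_of_zero (x : L) (k : ℕ) (f : L [⋀^Fin 0]→ₗ[A] M k) :
    contr x (of 0 k f) = 0 := by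
  rw [contr, of, DirectSum.toModule_lof]
  rfl

theorem contr_of_succ (x : L) (q k : ℕ) (f : L [⋀^Fin (q + 1)]→ₗ[A] M k) :
    contr x (of (q + 1) k f) = (-1 : ℤ) ^ (q + 1) • of q k (f.curryLeft x) := by
  rw [contr, of, DirectSum.toModule_lof]
  rfl

/-- A form of positive degree is recovered from its insertions. Identities between products are
proved from this by induction on the form degree, without handling shuffles again. -/
theorem of_eq_zero_of_contr {q k : ℕ} (f : L [⋀^Fin (q + 1)]→ₗ[A] M k)
    (h : ∀ x, contr x (of (q + 1) k f) = 0) : of (q + 1) k f = 0 := by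
  suffices f = 0 by rw [this, map_zero]
  ext v
  have h1 := h (v 0)
  rw [contr_of_succ] at h1
  have h2 : of q k (f.curryLeft (v 0)) = 0 := by
    have := congrArg (fun z => (-1 : ℤ) ^ (q + 1) • z) h1
    simpa only [smul_smul, ← mul_pow, neg_mul_neg, one_mul, one_pow, one_smul, smul_zero] using this
  have h3 := of_injective q k (h2.trans (map_zero _).symm)
  have h4 := congrFun (congrArg DFunLike.coe h3) (Fin.tail v)
  rw [AlternatingMap.curryLeft_apply_apply,
    show Matrix.vecCons (v 0) (Fin.tail v) = v from Fin.cons_self_tail v] at h4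
  exact h4

@[elab_as_elim]
theorem induction {motive : BiForms A L M → Prop} (m : BiForms A L M) (zero : motive 0)
    (of : ∀ q k f, motive (of q k f)) (add : ∀ m m', motive m → motive m' → motive (m + m')) :
    motive m :=
  DirectSum.induction_on m zero (fun d f => of d.1 d.2 f) add

theorem addHom_ext {Q : Type*} [AddCommMonoid Q] {F : Type*} [FunLike F (BiForms A L M) Q]
    [AddMonoidHomClass F (BiForms A L M) Q] {φ ψ : F}
    (h : ∀ q k f, φ (of q k f) = ψ (of q k f)) : φ = ψ := by
  refine DFunLike.ext _ _ fun m => ?_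
  induction m using BiForms.induction with
  | zero => rw [map_zero, map_zero]
  | of q k f => exact h q k f
  | add m m' h h' => rw [map_add, map_add, h, h']

end BiForms

/-! ### Graded commutativity of the exterior product. -/

section ExteriorWedge

variable {A L : Type*} [CommRing A] [AddCommGroup L] [Module A L]

theorem coe_exteriorWedge {p s n : ℕ} (h : p + s = n) (u : ⋀[A]^p L) (w : ⋀[A]^s L) :
    (exteriorWedge A L h u w : ExteriorAlgebra A L) = u * w := rfl

@[elab_as_elim]
theorem exteriorPower.induction {p : ℕ} {motive : ⋀[A]^p L → Prop} (u : ⋀[A]^p L)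
    (ιMulti : ∀ v, motive (exteriorPower.ιMulti A p v))
    (add : ∀ u w, motive u → motive w → motive (u + w))
    (smul : ∀ (a : A) u, motive u → motive (a • u)) : motive u := by
  have hu : u ∈ Submodule.span A (Set.range (exteriorPower.ιMulti A p (M := L))) := by
    rw [exteriorPower.ιMulti_span]; trivial
  induction hu using Submodule.span_induction with
  | mem u hu =>
    obtain ⟨v, rfl⟩ := hu
    exact ιMulti v
  | zero => simpa using smul 0 (exteriorPower.ιMulti A p 0) (ιMulti 0)
  | add u w _ _ h1 h2 => exact add u w h1 h2
  | smul a u _ h => exact smul a u h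

theorem ExteriorAlgebra.ι_mul_ιMulti (x : L) {s : ℕ} (w : Fin s → L) :
    ExteriorAlgebra.ι A x * ExteriorAlgebra.ιMulti A s w =
      (-1 : ℤ) ^ s • (ExteriorAlgebra.ιMulti A s w * ExteriorAlgebra.ι A x) := by
  induction s with
  | zero => simp [ExteriorAlgebra.ιMulti_zero_apply]
  | succ s ih =>
    have h : ExteriorAlgebra.ι A x * ExteriorAlgebra.ι A (w 0) =
        -(ExteriorAlgebra.ι A (w 0) * ExteriorAlgebra.ι A x) :=
      eq_neg_of_add_eq_zero_left (ExteriorAlgebra.ι_add_mul_swap _ _)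
    rw [ExteriorAlgebra.ιMulti_succ_apply, ← mul_assoc, h, neg_mul, mul_assoc, ih, mul_assoc,
      pow_succ, mul_neg_one, neg_smul, mul_smul_comm]

theorem ExteriorAlgebra.ιMulti_mul_ιMulti_comm {p s : ℕ} (v : Fin p → L) (w : Fin s → L) :
    ExteriorAlgebra.ιMulti A p v * ExteriorAlgebra.ιMulti A s w =
      (-1 : ℤ) ^ (p * s) • (ExteriorAlgebra.ιMulti A s w * ExteriorAlgebra.ιMulti A p v) := by
  induction p with
  | zero => simp [ExteriorAlgebra.ιMulti_zero_apply]
  | succ p ih =>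
    rw [ExteriorAlgebra.ιMulti_succ_apply, mul_assoc, ih, mul_smul_comm, ← mul_assoc,
      ExteriorAlgebra.ι_mul_ιMulti, smul_mul_assoc, smul_smul, ← pow_add, mul_assoc, add_mul,
      one_mul]

theorem exteriorPower.coe_mul_comm {p s : ℕ} (u : ⋀[A]^p L) (w : ⋀[A]^s L) :
    (u : ExteriorAlgebra A L) * (w : ExteriorAlgebra A L) =
      (-1 : ℤ) ^ (p * s) • ((w : ExteriorAlgebra A L) * (u : ExteriorAlgebra A L)) := by
  induction u using exteriorPower.induction with
  | ιMulti v =>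
    induction w using exteriorPower.induction with
    | ιMulti w => exact ExteriorAlgebra.ιMulti_mul_ιMulti_comm v w
    | add w w' h h' =>
      rw [Submodule.coe_add, mul_add, h, h', add_mul, smul_add]
    | smul a w h => rw [Submodule.coe_smul, mul_smul_comm, h, smul_mul_assoc, smul_comm]
  | add w w' h h' => rw [Submodule.coe_add, mul_add, add_mul, h, h', smul_add]
  | smul a w h => rw [Submodule.coe_smul, mul_smul_comm, smul_mul_assoc, h, smul_comm]

end ExteriorWedge

theorem neg_one_pow_smul_smul {V : Type*} [AddCommGroup V] (i : ℕ) (v : V) :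
    (-1 : ℤ) ^ i • (-1 : ℤ) ^ i • v = v := by
  rw [smul_smul, ← mul_pow, neg_mul_neg, one_mul, one_pow, one_smul]

/-! ### The product of bigraded forms: associativity and graded commutativity. -/

namespace BiForms

variable {A L : Type*} {M : ℕ → Type*} [CommRing A] [AddCommGroup L] [Module A L]
  [∀ k, AddCommGroup (M k)] [∀ k, Module A (M k)]

local notation "ofM" => BiForms.of (A := A) (L := L) (M := M)

theorem of_sub (q p : ℕ) (f g : L [⋀^Fin q]→ₗ[A] M p) :
    ofM q p (f - g) = ofM q p f - ofM q p g := map_sub (ofM q p) f g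

theorem of_add (q p : ℕ) (f g : L [⋀^Fin q]→ₗ[A] M p) :
    ofM q p (f + g) = ofM q p f + ofM q p g := map_add (ofM q p) f g

theorem of_zsmul (q p : ℕ) (c : ℤ) (f : L [⋀^Fin q]→ₗ[A] M p) :
    ofM q p (c • f) = c • ofM q p f := map_zsmul (ofM q p) c f

theorem contr_sub (x : L) (a b : BiForms A L M) : contr x (a - b) = contr x a - contr x b :=
  map_sub (contr x) a b

theorem contr_zsmul (x : L) (c : ℤ) (a : BiForms A L M) : contr x (c • a) = c • contr x a :=
  map_zsmul (contr x) c a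

/-- The product of `Alt^*(L, M^*)` induced by a graded pairing of `M^*`, with the Eilenberg-Koszul
sign `(-1)^((q + p) r)` for bidegrees `(q, p)` and `(r, s)`. -/
noncomputable def prod (μ : ∀ p s, M p →ₗ[A] M s →ₗ[A] M (p + s)) :
    BiForms A L M →ₗ[A] BiForms A L M →ₗ[A] BiForms A L M :=
  DirectSum.toModule A (ℕ × ℕ) _ fun d => LinearMap.flip <|
    DirectSum.toModule A (ℕ × ℕ) _ fun e => LinearMap.flip <|
      (((-1 : ℤ) ^ ((d.1 + d.2) * e.1)) •
        shuffle (μ d.2 e.2) d.1 e.1).compr₂ (ofM (d.1 + e.1) (d.2 + e.2))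

variable (μ : ∀ p s, M p →ₗ[A] M s →ₗ[A] M (p + s))

theorem prod_add_right (a b c : BiForms A L M) : prod μ a (b + c) = prod μ a b + prod μ a c :=
  map_add (prod μ a) b c

theorem prod_add_left (a b c : BiForms A L M) : prod μ (a + b) c = prod μ a c + prod μ b c :=
  map_add ((prod μ).flip c) a b

theorem prod_zero_right (a : BiForms A L M) : prod μ a 0 = 0 := map_zero (prod μ a)

theorem prod_zero_left (a : BiForms A L M) : prod μ 0 a = 0 := map_zero ((prod μ).flip a)

theorem prod_zsmul_right (c : ℤ) (a b : BiForms A L M) : prod μ a (c • b) = c • prod μ a b :=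
  map_zsmul (prod μ a) c b

theorem prod_zsmul_left (c : ℤ) (a b : BiForms A L M) : prod μ (c • a) b = c • prod μ a b :=
  map_zsmul ((prod μ).flip b) c a

theorem prod_of_of {q p r s : ℕ} (f : L [⋀^Fin q]→ₗ[A] M p)
    (g : L [⋀^Fin r]→ₗ[A] M s) :
    prod μ (ofM q p f) (ofM r s g) = (-1 : ℤ) ^ ((q + p) * r) •
      ofM (q + r) (p + s) (shuffle (μ p s) q r f g) := by
  rw [prod, of, DirectSum.toModule_lof, LinearMap.flip_apply, of,
    DirectSum.toModule_lof, LinearMap.flip_apply, LinearMap.compr₂_apply, LinearMap.smul_apply,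
    LinearMap.smul_apply]
  exact map_zsmul (ofM (q + r) (p + s)) _ _

/-- The signs in `contr` and in `prod` are chosen together so that insertion is an antiderivation
for the total degree. The four cases arise because the recursion for `shuffle` has a different shape
when one of the form degrees is zero. -/
theorem contr_prod_of_of (x : L) {q p r s : ℕ} (f : L [⋀^Fin q]→ₗ[A] M p)
    (g : L [⋀^Fin r]→ₗ[A] M s) :
    contr x (prod μ (ofM q p f) (ofM r s g)) =
      prod μ (contr x (ofM q p f)) (ofM r s g) +
        (-1 : ℤ) ^ (q + p) • prod μ (ofM q p f) (contr x (ofM r s g)) := by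
  rw [prod_of_of, contr_zsmul]
  rcases q with _ | q <;> rcases r with _ | r
  · have h : contr x (ofM (0 + 0) (p + s)
        (shuffle (μ p s) 0 0 f g)) = 0 := contr_of_zero _ _ _
    rw [h, contr_of_zero, contr_of_zero, prod_zero_left, prod_zero_right, smul_zero, smul_zero,
      add_zero]
  · have h : contr x (ofM (0 + (r + 1)) (p + s)
        (shuffle (μ p s) 0 (r + 1) f g)) = (-1 : ℤ) ^ (0 + r + 1) •
          ofM (0 + r) (p + s) ((shuffle (μ p s) 0 (r + 1) f g).curryLeft x) :=
      contr_of_succ _ _ _ _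
    rw [contr_of_zero, prod_zero_left, zero_add,
      contr_of_succ x r s g, prod_zsmul_right, prod_of_of, h, shuffle_zero_succ,
      smul_smul, smul_smul, smul_smul, ← pow_add, ← pow_add, ← pow_add]
    have e : (-1 : ℤ) ^ (p * (r + 1) + (0 + r + 1)) = (-1) ^ (p + (r + 1) + (0 + p) * r) :=
      neg_one_pow_congr (by simp only [Nat.even_add, Nat.even_mul, Nat.even_add_one]; grind)
    rw [e]
    exact (zero_add _).symm
  · have h : contr x (ofM (q + 1 + 0) (p + s)
        (shuffle (μ p s) (q + 1) 0 f g)) = (-1 : ℤ) ^ (q + 1) •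
          ofM q (p + s) ((shuffle (μ p s) (q + 1) 0 f g).curryLeft x) :=
      contr_of_succ _ _ _ _
    have h' : prod μ (contr x (ofM (q + 1) p f)) (ofM 0 s g) = (-1 : ℤ) ^ (q + 1) •
        ofM (q + 0) (p + s) (shuffle (μ p s) q 0 (f.curryLeft x) g) := by
      rw [contr_of_succ x q p f, prod_zsmul_left, prod_of_of, mul_zero, pow_zero, one_smul]
    rw [contr_of_zero, prod_zero_right, smul_zero, h, h', shuffle_succ_zero, mul_zero, pow_zero,
      one_smul]
    exact (add_zero _).symm
  · have h : contr x (ofM (q + 1 + (r + 1)) (p + s)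
        (shuffle (μ p s) (q + 1) (r + 1) f g)) = (-1 : ℤ) ^ (q + 1 + r + 1) •
          ofM (q + 1 + r) (p + s)
            ((shuffle (μ p s) (q + 1) (r + 1) f g).curryLeft x) :=
      contr_of_succ _ _ _ _
    rw [h, shuffle_succ_succ, contr_of_succ x q p f, contr_of_succ x r s g,
      prod_zsmul_right, prod_zsmul_left, prod_of_of, prod_of_of, of_add,
      of_congr _ (show q + (r + 1) = q + 1 + r by omega), smul_add, smul_add]
    refine congrArg₂ _ ?_ ?_
    · rw [smul_smul, smul_smul, ← pow_add, ← pow_add]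
      refine congrArg (· • _) (neg_one_pow_congr ?_)
      simp only [Nat.even_add, Nat.even_mul, Nat.even_add_one]
      grind
    · rw [of_zsmul, smul_smul, smul_smul, smul_smul, smul_smul, ← pow_add, ← pow_add, ← pow_add, ← pow_add]
      refine congrArg (· • _) (neg_one_pow_congr ?_)
      simp only [Nat.even_add, Nat.even_mul, Nat.even_add_one]
      grind

theorem contr_prod (x : L) {q p : ℕ} (f : L [⋀^Fin q]→ₗ[A] M p) (c : BiForms A L M) :
    contr x (prod μ (ofM q p f) c) = prod μ (contr x (ofM q p f)) c +
        (-1 : ℤ) ^ (q + p) • prod μ (ofM q p f) (contr x c) := by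
  induction c using induction with
  | zero => simp only [map_zero, smul_zero, add_zero]
  | of r s g => exact contr_prod_of_of μ x f g
  | add c c' h h' =>
    rw [prod_add_right, map_add, h, h', prod_add_right, map_add, prod_add_right, smul_add]
    abel

theorem exists_prod_of_of {q p r s : ℕ} (f : L [⋀^Fin q]→ₗ[A] M p)
    (g : L [⋀^Fin r]→ₗ[A] M s) : ∃ h, prod μ (ofM q p f) (ofM r s g) =
      ofM (q + r) (p + s) h :=
  ⟨_, (prod_of_of μ f g).trans (of_zsmul _ _ _ _).symm⟩

/-- Insertion is an antiderivation, so inserting a vector into the associator gives associators of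
smaller form degree. Induction on the total form degree leaves the case of degree zero, an identity
for the values alone. -/
theorem prod_assoc_of (h₀ : ∀ (p s u : ℕ) (f : L [⋀^Fin 0]→ₗ[A] M p) (g : L [⋀^Fin 0]→ₗ[A] M s)
    (h : L [⋀^Fin 0]→ₗ[A] M u), prod μ (prod μ (ofM 0 p f) (ofM 0 s g)) (ofM 0 u h) =
      prod μ (ofM 0 p f) (prod μ (ofM 0 s g) (ofM 0 u h))) (N : ℕ) : ∀ {q p r s t u : ℕ} (f : L [⋀^Fin q]→ₗ[A] M p)
    (g : L [⋀^Fin r]→ₗ[A] M s) (h : L [⋀^Fin t]→ₗ[A] M u), q + r + t = N →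
    prod μ (prod μ (ofM q p f) (ofM r s g)) (ofM t u h) =
      prod μ (ofM q p f) (prod μ (ofM r s g) (ofM t u h)) := by
  induction N with
  | zero =>
    intro q p r s t u f g h hN
    obtain rfl : q = 0 := by omega
    obtain rfl : r = 0 := by omega
    obtain rfl : t = 0 := by omega
    exact h₀ p s u f g h
  | succ N ih =>
    intro q p r s t u f g h hN
    obtain ⟨k, hk⟩ := exists_prod_of_of μ f g
    obtain ⟨l, hl⟩ := exists_prod_of_of μ g h
    -- The two products live in bidegrees that are equal only propositionally. Both are moved to a
    -- single component, where `of_eq_zero_of_contr` applies.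
    obtain ⟨m, hm⟩ : ∃ m, prod μ (prod μ (ofM q p f) (ofM r s g)) (ofM t u h) -
        prod μ (ofM q p f) (prod μ (ofM r s g) (ofM t u h)) = ofM (N + 1) (p + s + u) m := by
      rw [hk, hl]
      obtain ⟨m₁, h₁⟩ := exists_prod_of_of μ k h
      obtain ⟨m₂, h₂⟩ := exists_prod_of_of μ f l
      obtain ⟨m₁', h₁'⟩ := exists_of_congr hN rfl m₁
      obtain ⟨m₂', h₂'⟩ := exists_of_congr (q' := N + 1) (p' := p + s + u) (by omega) (by omega) m₂
      exact ⟨m₁' - m₂', by rw [h₁, h₁', h₂, h₂', of_sub]⟩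
    rw [← sub_eq_zero, hm]
    refine of_eq_zero_of_contr _ fun x => ?_
    -- The antiderivation rule needs a homogeneous left factor, so the product of `f` and `g` is
    -- temporarily replaced by its single component `k`.
    rw [← hm, contr_sub, hk, contr_prod, ← hk, contr_prod, contr_prod, contr_prod]
    have h₁ : prod μ (prod μ (contr x (ofM q p f)) (ofM r s g)) (ofM t u h) =
        prod μ (contr x (ofM q p f)) (prod μ (ofM r s g) (ofM t u h)) := by
      rcases q with _ | q
      · simp only [contr_of_zero, prod_zero_left]
      · simp only [contr_of_succ, prod_zsmul_left]
        rw [ih _ _ _ (by omega)]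
    have h₂ : prod μ (prod μ (ofM q p f) (contr x (ofM r s g))) (ofM t u h) =
        prod μ (ofM q p f) (prod μ (contr x (ofM r s g)) (ofM t u h)) := by
      rcases r with _ | r
      · simp only [contr_of_zero, prod_zero_left, prod_zero_right]
      · simp only [contr_of_succ, prod_zsmul_left, prod_zsmul_right]
        rw [ih _ _ _ (by omega)]
    have h₃ : prod μ (prod μ (ofM q p f) (ofM r s g)) (contr x (ofM t u h)) =
        prod μ (ofM q p f) (prod μ (ofM r s g) (contr x (ofM t u h))) := by
      rcases t with _ | t
      · simp only [contr_of_zero, prod_zero_right]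
      · simp only [contr_of_succ, prod_zsmul_right]
        rw [ih _ _ _ (by omega)]
    rw [prod_add_right, prod_add_left, prod_zsmul_left, prod_zsmul_right, h₁, h₂, h₃,
      smul_add, smul_smul, ← pow_add, show q + r + (p + s) = q + p + (r + s) by omega]
    abel

/-- The same induction as for associativity, applied to the graded commutator. -/
theorem prod_comm_of (h₀ : ∀ (p s : ℕ) (f : L [⋀^Fin 0]→ₗ[A] M p) (g : L [⋀^Fin 0]→ₗ[A] M s),
    prod μ (ofM 0 p f) (ofM 0 s g) = (-1 : ℤ) ^ (p * s) • prod μ (ofM 0 s g) (ofM 0 p f))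
    (N : ℕ) : ∀ {q p r s : ℕ} (f : L [⋀^Fin q]→ₗ[A] M p)
    (g : L [⋀^Fin r]→ₗ[A] M s), q + r = N →
    prod μ (ofM q p f) (ofM r s g) =
      (-1 : ℤ) ^ ((q + p) * (r + s)) • prod μ (ofM r s g) (ofM q p f) := by
  induction N with
  | zero =>
    intro q p r s f g hN
    obtain rfl : q = 0 := by omega
    obtain rfl : r = 0 := by omega
    simpa only [zero_add] using h₀ p s f g
  | succ N ih =>
    intro q p r s f g hN
    obtain ⟨m, hm⟩ : ∃ m, prod μ (ofM q p f) (ofM r s g) -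
        (-1 : ℤ) ^ ((q + p) * (r + s)) • prod μ (ofM r s g) (ofM q p f) =
        ofM (N + 1) (p + s) m := by
      obtain ⟨m₁, h₁⟩ := exists_prod_of_of μ f g
      obtain ⟨m₂, h₂⟩ := exists_prod_of_of μ g f
      obtain ⟨m₁', h₁'⟩ := exists_of_congr hN rfl m₁
      obtain ⟨m₂', h₂'⟩ := exists_of_congr (q' := N + 1) (p' := p + s) (by omega) (by omega) m₂
      exact ⟨m₁' - (-1 : ℤ) ^ ((q + p) * (r + s)) • m₂', by
        rw [h₁, h₁', h₂, h₂', of_sub, of_zsmul]⟩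
    rw [← sub_eq_zero, hm]
    refine of_eq_zero_of_contr _ fun x => ?_
    rw [← hm, contr_sub, contr_zsmul, contr_prod, contr_prod]
    have h₁ : prod μ (contr x (ofM q p f)) (ofM r s g) =
        (-1 : ℤ) ^ ((q + p + 1) * (r + s)) •
          prod μ (ofM r s g) (contr x (ofM q p f)) := by
      rcases q with _ | q
      · simp only [contr_of_zero, prod_zero_left, prod_zero_right, smul_zero]
      · simp only [contr_of_succ, prod_zsmul_left, prod_zsmul_right]
        rw [ih _ _ (by omega), smul_comm]
        refine congrArg (fun z => z • _) (neg_one_pow_congr ?_)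
        simp only [Nat.even_add, Nat.even_mul, Nat.even_add_one]
        grind
    have h₂ : prod μ (contr x (ofM r s g)) (ofM q p f) =
        (-1 : ℤ) ^ ((q + p) * (r + s + 1)) •
          prod μ (ofM q p f) (contr x (ofM r s g)) := by
      rcases r with _ | r
      · simp only [contr_of_zero, prod_zero_left, prod_zero_right, smul_zero]
      · simp only [contr_of_succ, prod_zsmul_left, prod_zsmul_right]
        rw [ih _ _ (by omega), smul_comm]
        refine congrArg (fun z => z • _) (neg_one_pow_congr ?_)
        simp only [Nat.even_add, Nat.even_mul, Nat.even_add_one]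
        grind
    rw [h₁, h₂]
    have e₁ : (-1 : ℤ) ^ ((q + p) * (r + s)) * (-1) ^ ((q + p) * (r + s + 1)) = (-1) ^ (q + p) := by
      rw [← pow_add]
      refine neg_one_pow_congr ?_
      simp only [Nat.even_add, Nat.even_mul, Nat.even_add_one]
      grind
    have e₂ : (-1 : ℤ) ^ ((q + p) * (r + s)) * (-1) ^ (r + s) = (-1) ^ ((q + p + 1) * (r + s)) := by
      ring
    rw [smul_add, smul_smul, smul_smul, e₁, e₂]
    abel

end BiForms

/-! ### The graded commutative algebra `Alt(L₂, Λ L₁)`. -/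

namespace PolyForms

variable {A L₁ L₂ : Type*} [CommRing A] [AddCommGroup L₁] [Module A L₁]
  [AddCommGroup L₂] [Module A L₂]

local notation "of₁₂" => BiForms.of (A := A) (L := L₂) (M := fun p => ⋀[A]^p L₁)

theorem mul_eq_prod : (mul : PolyForms A L₁ L₂ →ₗ[A] _) =
    BiForms.prod (fun p s => exteriorWedge A L₁ (rfl : p + s = p + s)) := rfl

theorem of_zero_eq {p p' : ℕ} (h : p = p') (f : L₂ [⋀^Fin 0]→ₗ[A] ⋀[A]^p L₁)
    (g : L₂ [⋀^Fin 0]→ₗ[A] ⋀[A]^p' L₁)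
    (hfg : (f ![] : ExteriorAlgebra A L₁) = (g ![] : ExteriorAlgebra A L₁)) :
    of₁₂ 0 p f = of₁₂ 0 p' g := by
  subst h
  congr 1
  ext v : 1
  rw [Subsingleton.elim v ![]]
  exact Subtype.ext hfg

theorem mul_of_of {q p r s : ℕ} (f : L₂ [⋀^Fin q]→ₗ[A] ⋀[A]^p L₁)
    (g : L₂ [⋀^Fin r]→ₗ[A] ⋀[A]^s L₁) :
    mul (of₁₂ q p f) (of₁₂ r s g) = (-1 : ℤ) ^ ((q + p) * r) •
      of₁₂ (q + r) (p + s) (shuffle (exteriorWedge A L₁ (rfl : p + s = p + s)) q r f g) := by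
  rw [mul_eq_prod]
  exact BiForms.prod_of_of (M := fun p => ⋀[A]^p L₁)
    (fun p s => exteriorWedge A L₁ (rfl : p + s = p + s)) f g

theorem mul_of_zero_of_zero {p s : ℕ} (f : L₂ [⋀^Fin 0]→ₗ[A] ⋀[A]^p L₁)
    (g : L₂ [⋀^Fin 0]→ₗ[A] ⋀[A]^s L₁) : mul (of₁₂ 0 p f) (of₁₂ 0 s g) =
      of₁₂ 0 (p + s) (AlternatingMap.constOfIsEmpty A L₂ (Fin 0)
        (exteriorWedge A L₁ rfl (f ![]) (g ![]))) := by
  rw [mul_of_of, mul_zero, pow_zero, one_smul]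
  refine of_zero_eq rfl _ _ ?_
  change ((shuffle _ 0 0 f g ![] : ⋀[A]^(p + s) L₁) : ExteriorAlgebra A L₁) = _
  rw [shuffle_zero_zero]
  rfl

theorem mul_add (a b c : PolyForms A L₁ L₂) : mul a (b + c) = mul a b + mul a c :=
  map_add (mul a) b c

theorem add_mul (a b c : PolyForms A L₁ L₂) : mul (a + b) c = mul a c + mul b c :=
  map_add (mul.flip c) a b

theorem mul_zero' (a : PolyForms A L₁ L₂) : mul a 0 = 0 := map_zero (mul a)

theorem zero_mul' (a : PolyForms A L₁ L₂) : mul 0 a = 0 := map_zero (mul.flip a)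

theorem zsmul_mul (c : ℤ) (a b : PolyForms A L₁ L₂) : mul (c • a) b = c • mul a b :=
  map_zsmul (mul.flip b) c a

theorem mul_assoc_of {q p r s t u : ℕ} (f : L₂ [⋀^Fin q]→ₗ[A] ⋀[A]^p L₁)
    (g : L₂ [⋀^Fin r]→ₗ[A] ⋀[A]^s L₁) (h : L₂ [⋀^Fin t]→ₗ[A] ⋀[A]^u L₁) :
    mul (mul (of₁₂ q p f) (of₁₂ r s g)) (of₁₂ t u h) =
      mul (of₁₂ q p f) (mul (of₁₂ r s g) (of₁₂ t u h)) := by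
  refine BiForms.prod_assoc_of (M := fun p => ⋀[A]^p L₁)
    (fun p s => exteriorWedge A L₁ (rfl : p + s = p + s)) ?_ _ f g h rfl
  intro p s u f g h
  rw [← mul_eq_prod, mul_of_zero_of_zero, mul_of_zero_of_zero, mul_of_zero_of_zero,
    mul_of_zero_of_zero]
  exact of_zero_eq (add_assoc p s u) _ _ (mul_assoc _ _ _)

theorem mul_assoc' (a b c : PolyForms A L₁ L₂) : mul (mul a b) c = mul a (mul b c) := by
  induction a using BiForms.induction with
  | zero => rw [zero_mul', zero_mul', zero_mul']
  | add a a' h h' => rw [add_mul, add_mul, h, h', add_mul]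
  | of q p f =>
    induction b using BiForms.induction with
    | zero => rw [mul_zero', zero_mul', mul_zero']
    | add a a' h h' => rw [mul_add, add_mul, h, h', add_mul, mul_add]
    | of r s g =>
      induction c using BiForms.induction with
      | zero => rw [mul_zero', mul_zero', mul_zero']
      | add a a' h h' => rw [mul_add, mul_add, h, h', mul_add]
      | of t u h => exact mul_assoc_of f g h

theorem mul_comm_of_of {q p r s : ℕ} (f : L₂ [⋀^Fin q]→ₗ[A] ⋀[A]^p L₁)
    (g : L₂ [⋀^Fin r]→ₗ[A] ⋀[A]^s L₁) :
    mul (of₁₂ q p f) (of₁₂ r s g) =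
      (-1 : ℤ) ^ ((q + p) * (r + s)) • mul (of₁₂ r s g) (of₁₂ q p f) := by
  refine BiForms.prod_comm_of (M := fun p => ⋀[A]^p L₁)
    (fun p s => exteriorWedge A L₁ (rfl : p + s = p + s)) ?_ _ f g rfl
  intro p s f g
  rw [← mul_eq_prod, mul_of_zero_of_zero, mul_of_zero_of_zero, ← BiForms.of_zsmul]
  exact of_zero_eq (add_comm p s) _ _ (exteriorPower.coe_mul_comm _ _)

/-- The unit of `Alt^*(L₂, Λ^* L₁)`. -/
noncomputable def one : PolyForms A L₁ L₂ :=
  of₁₂ 0 0 (AlternatingMap.constOfIsEmpty A L₂ (Fin 0) (exteriorPower.ιMulti A 0 ![]))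

theorem one_mul' (a : PolyForms A L₁ L₂) : mul one a = a := by
  induction a using BiForms.induction with
  | zero => rw [mul_zero']
  | add a a' h h' => rw [mul_add, h, h']
  | of r s g =>
    rw [one, mul_of_of, shuffle_zero_left, zero_add, zero_mul, pow_zero, one_smul]
    -- `0 + r` and `0 + s` do not reduce to `r` and `s`. The exterior degree is replaced by a
    -- variable, so that the two degrees can be corrected one after the other.
    have key : ∀ (s' : ℕ) (hs : 0 + s = s'), of₁₂ (0 + r) s' ((((exteriorWedge A L₁ hs)
        ((AlternatingMap.constOfIsEmpty A L₂ (Fin 0)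
          (exteriorPower.ιMulti A 0 ![])) ![])).compAlternatingMap g).domDomCongr
          (finCongr (Nat.zero_add r).symm)) = of₁₂ r s' (((exteriorWedge A L₁ hs)
        ((AlternatingMap.constOfIsEmpty A L₂ (Fin 0)
          (exteriorPower.ιMulti A 0 ![])) ![])).compAlternatingMap g) := fun s' hs =>
      (BiForms.of_congr (M := fun p => ⋀[A]^p L₁) s' (Nat.zero_add r).symm _).symm
    refine (key _ rfl).trans ?_
    have key₂ : ∀ (s' : ℕ) (hs : 0 + s = s') (hs' : s = s'), of₁₂ r s' (((exteriorWedge A L₁ hs)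
        ((AlternatingMap.constOfIsEmpty A L₂ (Fin 0)
          (exteriorPower.ιMulti A 0 ![])) ![])).compAlternatingMap g) = of₁₂ r s g := by
      intro s' hs hs'
      subst hs'
      congr 1
      ext v
      change (ExteriorAlgebra.ιMulti A 0 (![] : Fin 0 → L₁)) * ((g v : ⋀[A]^s L₁) : ExteriorAlgebra A L₁) = g v
      rw [ExteriorAlgebra.ιMulti_zero_apply, one_mul]
    exact key₂ _ rfl (zero_add s).symm

theorem mul_one' (a : PolyForms A L₁ L₂) : mul a one = a := by
  induction a using BiForms.induction with
  | zero => rw [zero_mul']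
  | add a a' h h' => rw [add_mul, h, h']
  | of r s g =>
    have h := mul_comm_of_of g (AlternatingMap.constOfIsEmpty A L₂ (Fin 0)
      (exteriorPower.ιMulti A 0 ![]))
    rw [add_zero, Nat.mul_zero, pow_zero, one_smul] at h
    exact h.trans (one_mul' _)

end PolyForms

/-! ### Vanishing above the rank. -/

section TopDegree

variable {A L M : Type*} [CommRing A] [AddCommGroup L] [Module A L] [AddCommGroup M] [Module A M]

theorem AlternatingMap.eq_zero_of_lt {n m : ℕ} (h : n < m) (f : (Fin n → A) [⋀^Fin m]→ₗ[A] M) :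
    f = 0 := by
  refine Module.Basis.ext_alternating (Pi.basisFun A (Fin n)) fun v hv => ?_
  have := Fintype.card_le_of_injective v hv
  simp only [Fintype.card_fin] at this
  omega

/-- Every vector lies, up to an element outside `P`, in a submodule with `n` generators, if the
stalk at `P` is free of rank `n`. -/
theorem exists_smul_mem_span_of_rankAtStalk [Module.Finite A L] [Module.Projective A L]
    (P : PrimeSpectrum A) {n : ℕ} (hn : Module.rankAtStalk L P = n) :
    ∃ e : Fin n → L, ∀ v : L, ∃ s ∉ P.asIdeal, s • v ∈ Submodule.span A (Set.range e) := by
  let S := P.asIdeal.primeCompl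
  let Aₚ := Localization.AtPrime P.asIdeal
  let Lₚ := LocalizedModule S L
  let ι := LocalizedModule.mkLinearMap S L
  have hfree : Module.Free Aₚ Lₚ := Module.free_of_flat_of_isLocalRing
  obtain ⟨b⟩ : Nonempty (Module.Basis (Fin n) Aₚ Lₚ) :=
    ⟨Module.finBasisOfFinrankEq Aₚ Lₚ hn⟩
  choose c hc using fun i => IsLocalizedModule.surj S ι (b i)
  refine ⟨fun i => (c i).1, fun v => ?_⟩
  -- The numerators of a basis of the stalk still span it, since the denominators are units there.
  have hspan : (Submodule.span A (Set.range fun i => (c i).1)).localized' Aₚ S ι = ⊤ := by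
    rw [Submodule.localized'_span, eq_top_iff, ← b.span_eq, Submodule.span_le]
    rintro _ ⟨i, rfl⟩
    have hu : IsUnit (algebraMap A Aₚ (c i).2) := IsLocalization.map_units Aₚ (c i).2
    have h1 : algebraMap A Aₚ (c i).2 • b i ∈
        Submodule.span Aₚ (ι '' Set.range fun i => (c i).1) := by
      refine Submodule.subset_span ⟨(c i).1, ⟨i, rfl⟩, ?_⟩
      rw [algebraMap_smul]
      exact (hc i).symm
    exact (Submodule.smul_mem_iff_of_isUnit _ hu).1 h1
  obtain ⟨m, hm, s, hs⟩ : ι v ∈ (Submodule.span A (Set.range fun i => (c i).1)).localized' Aₚ S ι := by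
    rw [hspan]; trivial
  rw [IsLocalizedModule.mk'_eq_iff] at hs
  have hs' : ι m = ι ((s : A) • v) := by rw [map_smul]; exact hs
  obtain ⟨t, ht⟩ := (IsLocalizedModule.eq_iff_exists S ι).1 hs'
  refine ⟨t * s, (t * s).2, ?_⟩
  have : ((t : A) * s) • v = (t : A) • m := by rw [mul_smul]; exact ht.symm
  rw [this]
  exact Submodule.smul_mem _ _ hm

/-- If a value is nonzero, its annihilator lies in a maximal ideal `P`. Multiplying each argument by
an element outside `P` moves all of them into a submodule with `n` generators, where a form with
more than `n` arguments is zero. The product of these multipliers then annihilates the value and so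
lies in `P`, which is prime. -/
theorem AlternatingMap.eq_zero_of_rankAtStalk_lt [Module.Finite A L] [Module.Projective A L]
    {n m : ℕ} (hrank : ∀ P : PrimeSpectrum A, Module.rankAtStalk L P = n) (h : n < m)
    (f : L [⋀^Fin m]→ₗ[A] M) : f = 0 := by
  ext v
  by_contra hv
  have hI : Ideal.torsionOf A M (f v) ≠ ⊤ := fun h => hv (by
    have h1 : (1 : A) ∈ Ideal.torsionOf A M (f v) := by rw [h]; trivial
    simpa using h1)
  obtain ⟨P, hP, hle⟩ := Ideal.exists_le_maximal _ hI
  obtain ⟨e, he⟩ := exists_smul_mem_span_of_rankAtStalk ⟨P, hP.isPrime⟩ (hrank _)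
  choose s hs hse using fun i => he (v i)
  have h0 : f (fun i => s i • v i) = 0 := by
    have : ∀ i, ∃ a : Fin n → A, Fintype.linearCombination A e a = s i • v i := by
      intro i
      have := hse i
      rwa [← Fintype.range_linearCombination] at this
    choose a ha using this
    simp only [← ha]
    exact congrFun (congrArg DFunLike.coe
      (AlternatingMap.eq_zero_of_lt h (f.compLinearMap (Fintype.linearCombination A e)))) a
  have h1 : (∏ i, s i) • f v = 0 := by
    rw [← h0]
    exact (f.toMultilinearMap.map_smul_univ s v).symm
  have h2 : ∏ i, s i ∈ P := hle h1
  obtain ⟨i, -, hi⟩ := (hP.isPrime.prod_mem_iff).1 h2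
  exact hs i hi

theorem exteriorPower.eq_zero_of_rankAtStalk_lt [Module.Finite A L] [Module.Projective A L]
    {n m : ℕ} (hrank : ∀ P : PrimeSpectrum A, Module.rankAtStalk L P = n) (h : n < m)
    (u : ⋀[A]^m L) : u = 0 := by
  induction u using exteriorPower.induction with
  | ιMulti v => rw [AlternatingMap.eq_zero_of_rankAtStalk_lt hrank h (exteriorPower.ιMulti A m)]; rfl
  | add u w hu hw => rw [hu, hw, add_zero]
  | smul a u hu => rw [hu, smul_zero]

end TopDegree

/-! ### Linear forms on exterior powers, and contraction with a 1-form. -/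

section Determinants

variable {A L : Type*} [CommRing A] [AddCommGroup L] [Module A L]

/-- `L` is a retract of a free module of finite rank. On its exterior power the coordinate functions
are determinants of coordinate forms, and these restrict along the section to determinants of
1-forms on `L`. -/
theorem exteriorPower.linearMap_mem_span_pairingDual [Module.Finite A L] [Module.Projective A L]
    {k : ℕ} (φ : ⋀[A]^k L →ₗ[A] A) :
    φ ∈ Submodule.span A (Set.range fun β : Fin k → Module.Dual A L =>
      exteriorPower.pairingDual A L k (exteriorPower.ιMulti A k β)) := by
  obtain ⟨m, π, σ, -, -, hπσ⟩ := Module.Finite.exists_comp_eq_id_of_projective A L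
  let b := (Pi.basisFun A (Fin m)).exteriorPower k
  let ψ := φ ∘ₗ exteriorPower.map k π
  have hψ : φ = ψ ∘ₗ exteriorPower.map k σ := by
    rw [LinearMap.comp_assoc, ← exteriorPower.map_comp, hπσ, exteriorPower.map_id,
      LinearMap.comp_id]
  have hsum : ψ = ∑ s, ψ (b s) • b.coord s := by
    refine b.ext fun t => ?_
    simp
  rw [hψ, hsum, show (∑ s, ψ (b s) • b.coord s) ∘ₗ exteriorPower.map k σ =
    ∑ s, ψ (b s) • (b.coord s ∘ₗ exteriorPower.map k σ) from
      LinearMap.ext fun u => by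
        simp only [LinearMap.comp_apply, LinearMap.sum_apply, LinearMap.smul_apply]]
  refine Submodule.sum_mem _ fun s _ => ?_
  refine Submodule.smul_mem _ _ (Submodule.subset_span
    ⟨fun j => (Pi.basisFun A (Fin m)).coord (Set.powersetCard.ofFinEmbEquiv.symm s j) ∘ₗ σ, ?_⟩)
  refine exteriorPower.linearMap_ext ?_
  ext v
  simp only [b, LinearMap.compAlternatingMap_apply, exteriorPower.pairingDual_ιMulti_ιMulti,
    exteriorPower.basis_coord, LinearMap.comp_apply, exteriorPower.map_apply_ιMulti,
    exteriorPower.ιMultiDual_apply_ιMulti]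
  rfl

theorem exteriorPower.eq_zero_of_forall_dual [Module.Finite A L] [Module.Projective A L]
    {k : ℕ} (u : ⋀[A]^k L) (h : ∀ φ : ⋀[A]^k L →ₗ[A] A, φ u = 0) : u = 0 := by
  obtain ⟨m, π, σ, -, -, hπσ⟩ := Module.Finite.exists_comp_eq_id_of_projective A L
  let b := (Pi.basisFun A (Fin m)).exteriorPower k
  have h0 : exteriorPower.map k σ u = 0 :=
    b.repr.injective (Finsupp.ext fun s => by
      rw [map_zero]; exact h (b.coord s ∘ₗ exteriorPower.map k σ))
  exact exteriorPower.map_injective π hπσ (h0.trans (map_zero _).symm)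

open CliffordAlgebra in
-- Contraction is an antiderivation, so the Leibniz rule can be iterated over the vectors of the
-- decomposable factor. The right factor `c` is kept general for the induction.
theorem ExteriorAlgebra.contractLeft_ιMulti_mul (β : Module.Dual A L) {p : ℕ}
    (v : Fin (p + 1) → L) (c : ExteriorAlgebra A L) :
    contractLeft (Q := 0) β (ExteriorAlgebra.ιMulti A (p + 1) v * c) =
      ∑ j : Fin (p + 1), (-1 : ℤ) ^ (j : ℕ) • β (v j) •
        (ExteriorAlgebra.ιMulti A p (j.removeNth v) * c) +
      (-1 : ℤ) ^ (p + 1) • (ExteriorAlgebra.ιMulti A (p + 1) v * contractLeft (Q := 0) β c) := by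
  induction p generalizing c with
  | zero =>
    rw [ExteriorAlgebra.ιMulti_succ_apply, mul_assoc]
    refine (contractLeft_ι_mul (Q := 0) β (v 0) _).trans ?_
    simp [ExteriorAlgebra.ιMulti_zero_apply, sub_eq_add_neg, ExteriorAlgebra.ι]
  | succ p ih =>
    rw [ExteriorAlgebra.ιMulti_succ_apply, mul_assoc]
    refine (contractLeft_ι_mul (Q := 0) β (v 0) _).trans ?_
    rw [ih, Fin.sum_univ_succ (n := p + 1)]
    have h : ∀ j : Fin (p + 1), ExteriorAlgebra.ιMulti A (p + 1) (j.succ.removeNth v) =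
        ExteriorAlgebra.ι A (v 0) * ExteriorAlgebra.ιMulti A p (j.removeNth (Matrix.vecTail v)) := by
      intro j
      rw [ExteriorAlgebra.ιMulti_succ_apply]
      congr 3
      funext i
      exact congrArg v (Fin.succ_succAbove_succ j i)
    simp only [h, mul_add, Finset.mul_sum, Fin.val_succ, mul_smul_comm, Fin.val_zero, pow_zero,
      one_smul, mul_assoc, pow_succ, mul_neg_one, neg_smul, Finset.sum_neg_distrib]
    rw [sub_eq_add_neg, neg_add, mul_neg, neg_neg, mul_smul_comm, ← add_assoc]
    simp only [neg_neg]
    rfl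

open CliffordAlgebra in
/-- Contraction of an element of an exterior power with a linear form. -/
theorem exteriorPower.contractLeft_mem (β : Module.Dual A L) {p : ℕ} (u : ⋀[A]^(p + 1) L) :
    contractLeft (Q := 0) β (u : ExteriorAlgebra A L) ∈ ⋀[A]^p L := by
  induction u using exteriorPower.induction with
  | ιMulti v =>
    have h := ExteriorAlgebra.contractLeft_ιMulti_mul β v 1
    rw [mul_one, contractLeft_one, mul_zero, smul_zero, add_zero] at h
    rw [exteriorPower.ιMulti_apply_coe, h]
    refine Submodule.sum_mem _ fun j _ => zsmul_mem (Submodule.smul_mem _ _ ?_) _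
    rw [mul_one]
    exact (exteriorPower.ιMulti A p _).2
  | add u w hu hw => rw [Submodule.coe_add, map_add]; exact add_mem hu hw
  | smul a u hu => rw [Submodule.coe_smul, map_smul]; exact Submodule.smul_mem _ _ hu

end Determinants

/-! ### Contraction with a volume form is bijective. -/

namespace PolyForms

variable {A L₁ : Type*} [CommRing A] [AddCommGroup L₁] [Module A L₁]

theorem contract_apply {n p k : ℕ} (Ω : ⋀[A]^n L₁ →ₗ[A] A) (h : k + p = n) (u : ⋀[A]^p L₁)
    (y : Fin k → L₁) :
    contract Ω h u y = Ω (exteriorWedge A L₁ h (exteriorPower.ιMulti A k y) u) := rfl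

/-- Induction on the number of 1-forms. If `u` represents the determinant of the last `k` of them,
then `y₀ ∧ … ∧ yₖ ∧ u` has degree `n + 1` and is zero; contracting it with the first 1-form
expresses `y₀ ∧ … ∧ yₖ ∧ (contraction of u)` by the Laplace expansion along the first column. -/
theorem exists_contract_eq_det [Module.Finite A L₁] [Module.Projective A L₁] {n : ℕ}
    (hrank : ∀ P : PrimeSpectrum A, Module.rankAtStalk L₁ P = n) (Ω : ⋀[A]^n L₁ ≃ₗ[A] A)
    {k : ℕ} : ∀ {p : ℕ} (h : k + p = n) (β : Fin k → Module.Dual A L₁),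
    ∃ u : ⋀[A]^p L₁, ∀ y : Fin k → L₁, contract (Ω : ⋀[A]^n L₁ →ₗ[A] A) h u y =
      (Matrix.of fun i j => β j (y i)).det := by
  induction k with
  | zero =>
    intro p h β
    obtain rfl : p = n := by omega
    refine ⟨Ω.symm 1, fun y => ?_⟩
    rw [contract_apply, Matrix.det_isEmpty]
    have : exteriorWedge A L₁ h (exteriorPower.ιMulti A 0 y) (Ω.symm 1) = Ω.symm 1 := by
      refine Subtype.ext ?_
      rw [coe_exteriorWedge, exteriorPower.ιMulti_apply_coe, ExteriorAlgebra.ιMulti_zero_apply,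
        one_mul]
    rw [this]
    simp
  | succ k ih =>
    intro p h β
    obtain ⟨u, hu⟩ := ih (p := p + 1) (by omega) (fun j => β j.succ)
    -- The antiderivation rule contributes `(-1)^(k + 1)`, and moving that term to the other side
    -- contributes one more sign; `(-1)^k` cancels both.
    refine ⟨(-1 : ℤ) ^ k • ⟨_, exteriorPower.contractLeft_mem (β 0) u⟩, fun y => ?_⟩
    have h0 : exteriorWedge A L₁ (show k + 1 + (p + 1) = n + 1 by omega)
        (exteriorPower.ιMulti A (k + 1) y) u = 0 :=
      exteriorPower.eq_zero_of_rankAtStalk_lt hrank (Nat.lt_succ_self n) _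
    have h1 := ExteriorAlgebra.contractLeft_ιMulti_mul (β 0) y (u : ExteriorAlgebra A L₁)
    have h2 : ExteriorAlgebra.ιMulti A (k + 1) y * (u : ExteriorAlgebra A L₁) = 0 :=
      congrArg Subtype.val h0
    rw [h2, map_zero] at h1
    have h3 : exteriorWedge A L₁ h (exteriorPower.ιMulti A (k + 1) y)
        ((-1 : ℤ) ^ k • ⟨_, exteriorPower.contractLeft_mem (β 0) u⟩) =
        ∑ j : Fin (k + 1), (-1 : ℤ) ^ (j : ℕ) • β 0 (y j) •
          exteriorWedge A L₁ (show k + (p + 1) = n by omega)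
            (exteriorPower.ιMulti A k (j.removeNth y)) u := by
      refine Subtype.ext ?_
      rw [map_zsmul]
      have e := eq_neg_of_add_eq_zero_left h1.symm
      simp only [AddSubgroupClass.coe_zsmul, AddSubmonoidClass.coe_finsetSum, Submodule.coe_smul,
        coe_exteriorWedge, exteriorPower.ιMulti_apply_coe]
      rw [e, pow_succ, mul_neg_one, neg_smul, neg_neg]
    rw [contract_apply, h3, Matrix.det_succ_column_zero]
    simp only [map_sum, map_zsmul, map_smul]
    refine Finset.sum_congr rfl fun j _ => ?_
    have h4 := hu (j.removeNth y)
    rw [contract_apply] at h4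
    rw [h4, zsmul_eq_mul, smul_eq_mul, mul_assoc]
    push_cast
    rfl

theorem contract_surjective [Module.Finite A L₁] [Module.Projective A L₁] {n : ℕ}
    (hrank : ∀ P : PrimeSpectrum A, Module.rankAtStalk L₁ P = n) (Ω : ⋀[A]^n L₁ ≃ₗ[A] A)
    {k p : ℕ} (h : k + p = n) : Surjective (contract (Ω : ⋀[A]^n L₁ →ₗ[A] A) h) := by
  intro f
  have hf := exteriorPower.linearMap_mem_span_pairingDual
    (exteriorPower.alternatingMapLinearEquiv f)
  have key : ∀ φ ∈ Submodule.span A (Set.range fun β : Fin k → Module.Dual A L₁ =>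
      exteriorPower.pairingDual A L₁ k (exteriorPower.ιMulti A k β)), ∃ u,
      contract (Ω : ⋀[A]^n L₁ →ₗ[A] A) h u = exteriorPower.alternatingMapLinearEquiv.symm φ := by
    intro φ hφ
    induction hφ using Submodule.span_induction with
    | mem φ hφ =>
      obtain ⟨β, rfl⟩ := hφ
      obtain ⟨u, hu⟩ := exists_contract_eq_det hrank Ω h β
      refine ⟨u, AlternatingMap.ext fun y => ?_⟩
      rw [hu]
      exact (exteriorPower.pairingDual_ιMulti_ιMulti β y).symm
    | zero => exact ⟨0, by rw [map_zero, map_zero]⟩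
    | add φ ψ _ _ hφ hψ =>
      obtain ⟨u, hu⟩ := hφ
      obtain ⟨w, hw⟩ := hψ
      exact ⟨u + w, by rw [map_add, map_add, hu, hw]⟩
    | smul a φ _ hφ =>
      obtain ⟨u, hu⟩ := hφ
      exact ⟨a • u, by rw [map_smul, map_smul, hu]⟩
  obtain ⟨u, hu⟩ := key _ hf
  exact ⟨u, by rw [hu, LinearEquiv.symm_apply_apply]⟩

/-- By surjectivity in the complementary degree each linear form φ on `Λ^p L₁` is `Ω (· ∧ w)` for
some `w`. If `u` contracts to zero, then `φ u = Ω (u ∧ w) = ± Ω (w ∧ u) = 0`, and linear forms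
separate the points of `Λ^p L₁`. -/
theorem contract_injective [Module.Finite A L₁] [Module.Projective A L₁] {n : ℕ}
    (hrank : ∀ P : PrimeSpectrum A, Module.rankAtStalk L₁ P = n) (Ω : ⋀[A]^n L₁ ≃ₗ[A] A)
    {k p : ℕ} (h : k + p = n) : Injective (contract (Ω : ⋀[A]^n L₁ →ₗ[A] A) h) := by
  refine (injective_iff_map_eq_zero _).2 fun u hu => exteriorPower.eq_zero_of_forall_dual u ?_
  intro φ
  obtain ⟨w, hw⟩ := contract_surjective hrank Ω (show p + k = n by omega)
    (φ.compAlternatingMap (exteriorPower.ιMulti A p))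
  have h1 : φ = (Ω : ⋀[A]^n L₁ →ₗ[A] A) ∘ₗ (exteriorWedge A L₁ (show p + k = n by omega)).flip w :=
    exteriorPower.linearMap_ext hw.symm
  have h2 : (Ω : ⋀[A]^n L₁ →ₗ[A] A) ∘ₗ (exteriorWedge A L₁ h).flip u = 0 :=
    exteriorPower.linearMap_ext hu
  have h3 : exteriorWedge A L₁ (show p + k = n by omega) u w =
      (-1 : ℤ) ^ (p * k) • exteriorWedge A L₁ h w u :=
    Subtype.ext (exteriorPower.coe_mul_comm u w)
  rw [h1, LinearMap.comp_apply, LinearMap.flip_apply, h3, map_zsmul]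
  have h4 := LinearMap.congr_fun h2 w
  rw [LinearMap.comp_apply, LinearMap.flip_apply, LinearMap.zero_apply] at h4
  rw [h4, smul_zero]

end PolyForms

/-! ### Compatibility of connections and shuffles with products and linear maps. -/

theorem Fin.append_update_left' {N : Type*} {p s : ℕ} (v : Fin p → N) (w : Fin s → N) (i : Fin p) (x : N) :
    Fin.append (update v i x) w = update (Fin.append v w) (Fin.castAdd s i) x := by
  funext j
  cases j using Fin.addCases with
  | left j =>
    rcases eq_or_ne j i with rfl | h
    · simp
    · rw [Fin.append_left, update_of_ne h, update_of_ne, Fin.append_left]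
      exact fun h' => h (Fin.castAdd_injective _ _ h')
  | right j =>
    rw [Fin.append_right, update_of_ne, Fin.append_right]
    intro h
    have := congrArg Fin.val h
    simp at this
    omega

theorem Fin.append_update_right' {N : Type*} {p s : ℕ} (v : Fin p → N) (w : Fin s → N) (i : Fin s) (x : N) :
    Fin.append v (update w i x) = update (Fin.append v w) (Fin.natAdd p i) x := by
  funext j
  cases j using Fin.addCases with
  | right j =>
    rcases eq_or_ne j i with rfl | h
    · simp
    · rw [Fin.append_right, update_of_ne h, update_of_ne, Fin.append_right]
      exact fun h' => h (Fin.natAdd_injective _ _ h')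
  | left j =>
    rw [Fin.append_left, update_of_ne, Fin.append_left]
    intro h
    have := congrArg Fin.val h
    simp at this
    omega

/-- Scalar forms only rescale values, so any `A`-linear map of the values commutes with them. It is
applied to contraction with Ω and to insertion of a vector of `L₁`. -/
theorem compAlternatingMap_shuffle_lsmul {A L M N : Type*} [CommRing A] [AddCommGroup L] [Module A L] [AddCommGroup M]
    [Module A M] [AddCommGroup N] [Module A N] (φ : M →ₗ[A] N) {q r : ℕ} (b : L [⋀^Fin q]→ₗ[A] A)
    (f : L [⋀^Fin r]→ₗ[A] M) :
    φ.compAlternatingMap (shuffle (LinearMap.lsmul A M) q r b f) =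
      shuffle (LinearMap.lsmul A N) q r b (φ.compAlternatingMap f) := by
  ext v
  rw [LinearMap.compAlternatingMap_apply]
  simp only [shuffle_apply, domCoprod_apply_eq_sum, map_sum]
  refine Finset.sum_congr rfl fun c _ => ?_
  induction c using Quotient.inductionOn' with | _ σ
  simp only [summand_mk_apply, map_zsmul, TensorProduct.lift.tmul, LinearMap.lsmul_apply, map_smul,
    LinearMap.compAlternatingMap_apply]

section ExtWedge

variable {R A L N : Type*} [CommRing R] [CommRing A] [Algebra R A]
  [LieRing L] [LieAlgebra R L] [Module A L] [LieRingModule L A]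
  [LieRinehartRing A L] [LieRinehartAlgebra R A L]
  [AddCommGroup N] [Module R N] [Module A N] [IsScalarTower R A N]

theorem LRConnection.ext_exteriorWedge (E : LRConnection R A L N) {p s n : ℕ} (h : p + s = n)
    (x : L) (u : ⋀[A]^p N) (w : ⋀[A]^s N) :
    (E.ext n).toEnd x (exteriorWedge A N h u w) =
      exteriorWedge A N h ((E.ext p).toEnd x u) w +
        exteriorWedge A N h u ((E.ext s).toEnd x w) := by
  subst h
  have hmul : ∀ (v : Fin p → N) (w : Fin s → N), exteriorWedge A N (rfl : p + s = p + s)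
      (exteriorPower.ιMulti A p v) (exteriorPower.ιMulti A s w) =
        exteriorPower.ιMulti A (p + s) (Fin.append v w) := fun v w =>
    Subtype.ext (ExteriorAlgebra.ιMulti_mul_ιMulti v w)
  induction u using exteriorPower.induction with
  | ιMulti v =>
    induction w using exteriorPower.induction with
    | ιMulti w =>
      rw [hmul, ext_ιMulti, ext_ιMulti, ext_ιMulti, map_sum, map_sum, LinearMap.sum_apply,
        Fin.sum_univ_add]
      simp only [hmul, Fin.append_update_left', Fin.append_update_right', Fin.append_left,
        Fin.append_right]
    | add w w' h h' => rw [map_add, map_add, h, h', map_add, map_add, map_add]; abel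
    | smul a w h =>
      rw [map_smul, leibniz, h, leibniz, map_smul, map_add, map_smul, map_smul, smul_add, add_assoc]
  | add u u' h h' =>
    simp only [map_add, LinearMap.add_apply, h, h']
    abel
  | smul a u h =>
    simp only [map_smul, map_add, LinearMap.add_apply, LinearMap.smul_apply, leibniz, h, smul_add]
    abel

end ExtWedge

section Naturality

variable {R A L M N : Type*} [CommRing R] [CommRing A] [Algebra R A]
  [LieRing L] [LieAlgebra R L] [Module A L] [LieRingModule L A] [LieRinehartRing A L]
  [AddCommGroup M] [Module R M] [Module A M] [IsScalarTower R A M]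
  [AddCommGroup N] [Module R N] [Module A N] [IsScalarTower R A N]

theorem LRConnection.ce_compAlternatingMap (D : LRConnection R A L M) (E : LRConnection R A L N)
    (φ : M →ₗ[A] N) (hφ : ∀ x m, φ (D.toEnd x m) = E.toEnd x (φ m)) (q : ℕ)
    (f : L [⋀^Fin q]→ₗ[A] M) : φ.compAlternatingMap (D.ce q f) = E.ce q (φ.compAlternatingMap f) := by
  ext v
  simp only [LinearMap.compAlternatingMap_apply, ce_apply, ceFun, map_zsmul, map_sum, map_sub, hφ]

end Naturality

/-! ### `flat` is an isomorphism of differential graded modules. -/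

namespace BiForms

variable {A L : Type*} {M : ℕ → Type*} [CommRing A] [AddCommGroup L] [Module A L]
  [∀ k, AddCommGroup (M k)] [∀ k, Module A (M k)]

/-- The inclusion of a homogeneous scalar form. -/
noncomputable abbrev scalar (q : ℕ) (b : L [⋀^Fin q]→ₗ[A] A) : ⨁ q : ℕ, L [⋀^Fin q]→ₗ[A] A :=
  DirectSum.lof A ℕ (fun q => L [⋀^Fin q]→ₗ[A] A) q b

theorem act_of {q r k : ℕ} (b : L [⋀^Fin q]→ₗ[A] A) (f : L [⋀^Fin r]→ₗ[A] M k) :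
    act (scalar q b) (of (A := A) (L := L) (M := M) r k f) = (-1 : ℤ) ^ (q * r) •
      of (q + r) k (shuffle (LinearMap.lsmul A (M k)) q r b f) := by
  rw [act, scalar, DirectSum.toModule_lof, LinearMap.flip_apply, of,
    DirectSum.toModule_lof, LinearMap.flip_apply, LinearMap.compr₂_apply, LinearMap.smul_apply,
    LinearMap.smul_apply]
  exact map_zsmul (of (A := A) (L := L) (M := M) (q + r) k) _ _

end BiForms

theorem BiForms.ce_of {R A L : Type*} {M : ℕ → Type*} [CommRing R] [CommRing A] [Algebra R A]
    [LieRing L] [LieAlgebra R L] [Module A L] [LieRingModule L A]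
    [LieRinehartRing A L] [∀ k, AddCommGroup (M k)] [∀ k, Module R (M k)] [∀ k, Module A (M k)]
    [∀ k, IsScalarTower R A (M k)] (D : ∀ k, LRConnection R A L (M k)) {q k : ℕ}
    (f : L [⋀^Fin q]→ₗ[A] M k) : ce D (of q k f) = of (q + 1) k ((D k).ce q f) := by
  rw [ce, of]
  erw [DirectSum.toModule_lof]
  rfl

namespace PolyForms

variable {A L₁ L₂ : Type*} [CommRing A] [AddCommGroup L₁] [Module A L₁]
  [AddCommGroup L₂] [Module A L₂]

local notation "of₁₂" => BiForms.of (A := A) (L := L₂) (M := fun p => ⋀[A]^p L₁)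
local notation "ofW" => BiForms.of (A := A) (L := L₂) (M := fun k => L₁ [⋀^Fin k]→ₗ[A] A)

theorem flat_of {n q p k : ℕ} (Ω : ⋀[A]^n L₁ →ₗ[A] A) (h : k + p = n)
    (f : L₂ [⋀^Fin q]→ₗ[A] ⋀[A]^p L₁) :
    flat Ω (of₁₂ q p f) = ofW q k ((contract Ω h).compAlternatingMap f) := by
  obtain rfl : k = n - p := by omega
  rw [flat, BiForms.of, DirectSum.toModule_lof, dif_pos (show (q, p).2 ≤ n by dsimp only; omega)]
  rfl

theorem flat_of_lt {n q p : ℕ} (Ω : ⋀[A]^n L₁ →ₗ[A] A) (h : n < p)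
    (f : L₂ [⋀^Fin q]→ₗ[A] ⋀[A]^p L₁) : flat Ω (of₁₂ q p f) = 0 := by
  rw [flat, BiForms.of, DirectSum.toModule_lof, dif_neg (show ¬ (q, p).2 ≤ n by dsimp only; omega)]
  rfl

section Bijective

variable [Module.Finite A L₁] [Module.Projective A L₁] {n : ℕ}
    (hrank : ∀ P : PrimeSpectrum A, Module.rankAtStalk L₁ P = n) (Ω : ⋀[A]^n L₁ ≃ₗ[A] A)

/-- The isomorphism `Λ^p L₁ ≃ Alt^k(L₁, A)` for `k + p = n`. -/
noncomputable def contractEquiv {k p : ℕ} (h : k + p = n) :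
    ⋀[A]^p L₁ ≃ₗ[A] (L₁ [⋀^Fin k]→ₗ[A] A) :=
  LinearEquiv.ofBijective (contract (Ω : ⋀[A]^n L₁ →ₗ[A] A) h)
    ⟨contract_injective hrank Ω h, contract_surjective hrank Ω h⟩

/-- The inverse of `flat`. -/
noncomputable def unflat : MixedForms A L₁ L₂ →ₗ[A] PolyForms A L₁ L₂ :=
  DirectSum.toModule A (ℕ × ℕ) _ fun d =>
    if h : d.2 ≤ n then
      of₁₂ d.1 (n - d.2) ∘ₗ LinearMap.compAlternatingMapₗ A
        (contractEquiv hrank Ω (Nat.add_sub_cancel' h)).symm.toLinearMap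
    else 0

theorem unflat_of {q p k : ℕ} (h : k + p = n) (f : L₂ [⋀^Fin q]→ₗ[A] (L₁ [⋀^Fin k]→ₗ[A] A)) :
    unflat hrank Ω (ofW q k f) =
      of₁₂ q p ((contractEquiv hrank Ω h).symm.toLinearMap.compAlternatingMap f) := by
  obtain rfl : p = n - k := by omega
  rw [unflat, BiForms.of, DirectSum.toModule_lof, dif_pos (show (q, k).2 ≤ n by dsimp only; omega)]
  rfl

include hrank in
-- In exterior degrees from `0` to `n` this is bijectivity of the contraction; in higher degrees
-- source and target are both zero.
theorem flat_bijective :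
    Bijective (flat (L₂ := L₂) (Ω : ⋀[A]^n L₁ →ₗ[A] A)) := by
  refine bijective_iff_has_inverse.2 ⟨unflat hrank Ω, fun m => ?_, fun m => ?_⟩
  · induction m using BiForms.induction with
    | zero => rw [map_zero, map_zero]
    | add m m' h h' => rw [map_add, map_add, h, h']
    | of q p f =>
      by_cases hp : p ≤ n
      · rw [flat_of _ (Nat.sub_add_cancel hp), unflat_of hrank Ω (Nat.sub_add_cancel hp)]
        congr 1
        ext v : 1
        exact (contractEquiv hrank Ω (Nat.sub_add_cancel hp)).symm_apply_apply (f v)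
      · have : f = 0 := AlternatingMap.ext fun v =>
          exteriorPower.eq_zero_of_rankAtStalk_lt hrank (not_le.1 hp) (f v)
        rw [this, map_zero, map_zero, map_zero]
  · induction m using BiForms.induction with
    | zero => rw [map_zero, map_zero]
    | add m m' h h' => rw [map_add, map_add, h, h']
    | of q k f =>
      by_cases hp : k ≤ n
      · rw [unflat_of hrank Ω (Nat.add_sub_cancel' hp), flat_of _ (Nat.add_sub_cancel' hp)]
        congr 1
        ext v : 1
        exact (contractEquiv hrank Ω (Nat.add_sub_cancel' hp)).apply_symm_apply (f v)
      · have : f = 0 := AlternatingMap.ext fun v =>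
          AlternatingMap.eq_zero_of_rankAtStalk_lt hrank (not_le.1 hp) (f v)
        rw [this, map_zero, map_zero, map_zero]

end Bijective

theorem flat_act {n : ℕ} (Ω : ⋀[A]^n L₁ →ₗ[A] A) (a : ⨁ q : ℕ, L₂ [⋀^Fin q]→ₗ[A] A)
    (m : PolyForms A L₁ L₂) : flat Ω (BiForms.act a m) = BiForms.act a (flat Ω m) := by
  induction a using DirectSum.induction_on with
  | zero => simp only [map_zero, LinearMap.zero_apply]
  | add a a' h h' => simp only [map_add, LinearMap.add_apply, h, h']
  | of q b =>
    change flat Ω (BiForms.act (BiForms.scalar q b) m) = BiForms.act (BiForms.scalar q b) (flat Ω m)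
    induction m using BiForms.induction with
    | zero => simp only [map_zero]
    | add a a' h h' => rw [map_add, map_add, h, h', map_add, map_add]
    | of r p f =>
      have h1 := BiForms.act_of (M := fun p => ⋀[A]^p L₁) b f
      rw [h1, map_zsmul]
      by_cases hp : p ≤ n
      · rw [flat_of Ω (Nat.sub_add_cancel hp), flat_of Ω (Nat.sub_add_cancel hp),
          BiForms.act_of (M := fun k => L₁ [⋀^Fin k]→ₗ[A] A), compAlternatingMap_shuffle_lsmul]
      · rw [flat_of_lt Ω (not_le.1 hp), flat_of_lt Ω (not_le.1 hp), smul_zero, map_zero]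

end PolyForms

namespace AlmostTwilled

variable {R A L₁ L₂ : Type*} [CommRing R] [CommRing A] [Algebra R A]
  [LieRing L₁] [LieAlgebra R L₁] [Module A L₁] [LieRingModule L₁ A] [LieRinehartRing A L₁]
  [LieRinehartAlgebra R A L₁]
  [LieRing L₂] [LieAlgebra R L₂] [Module A L₂] [LieRingModule L₂ A] [LieRinehartRing A L₂]
  [LieRinehartAlgebra R A L₂]

theorem ofForm_toEnd_apply {R A L : Type*} [CommRing R] [CommRing A] [Algebra R A]
    [LieRing L] [LieAlgebra R L] [Module A L] [LieRingModule L A] [LieRinehartRing A L]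
    [LieRinehartAlgebra R A L] (α : L →ₗ[A] A) (x : L) (a : A) :
    (LRConnection.ofForm R α).toEnd x a = ⁅x, a⁆ - α x * a := rfl

theorem alt_toEnd_apply {R A L M N : Type*} [CommRing R] [CommRing A] [Algebra R A]
    [LieRing L] [LieAlgebra R L] [Module A L] [LieRingModule L A]
    [AddCommGroup M] [Module R M] [Module A M] [IsScalarTower R A M]
    [AddCommGroup N] [Module R N] [Module A N] [IsScalarTower R A N]
    (E : LRConnection R A L N) (D : LRConnection R A L M) {k : ℕ} (x : L)
    (f : N [⋀^Fin k]→ₗ[A] M) (v : Fin k → N) : (E.alt D k).toEnd x f v =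
      D.toEnd x (f v) - ∑ i, f (update v i (E.toEnd x (v i))) := rfl

/-- Invariance of Ω writes `ξ (Ω (y ∧ u))` as `Ω (ξ · (y ∧ u))`. By the derivation rule this is a
term with ξ acting on `u` plus the terms with ξ acting on the `yᵢ`, and the latter are exactly those
subtracted in the action on forms. -/
theorem contract_ext (T : AlmostTwilled R A L₁ L₂) {n p k : ℕ} (Ω : ⋀[A]^n L₁ →ₗ[A] A)
    (hΩ : ∀ (ξ : L₂) (u : ⋀[A]^n L₁), Ω ((T.act₂₁.ext n).toEnd ξ u) = ⁅ξ, Ω u⁆)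
    (h : k + p = n) (ξ : L₂) (u : ⋀[A]^p L₁) :
    PolyForms.contract Ω h ((T.act₂₁.ext p).toEnd ξ u) =
      (T.act₂₁.alt (LRConnection.ofForm R (0 : L₂ →ₗ[A] A)) k).toEnd ξ (PolyForms.contract Ω h u) := by
  ext y
  simp only [alt_toEnd_apply, ofForm_toEnd_apply, PolyForms.contract_apply, LinearMap.zero_apply,
    zero_mul, sub_zero, ← hΩ]
  rw [LRConnection.ext_exteriorWedge, map_add, LRConnection.ext_ιMulti, map_sum,
    LinearMap.sum_apply, map_sum, add_sub_cancel_left]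

theorem flat_dPoly (T : AlmostTwilled R A L₁ L₂) {n : ℕ} (Ω : ⋀[A]^n L₁ →ₗ[A] A)
    (hΩ : ∀ (ξ : L₂) (u : ⋀[A]^n L₁), Ω ((T.act₂₁.ext n).toEnd ξ u) = ⁅ξ, Ω u⁆)
    (m : PolyForms A L₁ L₂) :
    PolyForms.flat Ω (T.dPoly m) = T.dMixed (PolyForms.flat Ω m) := by
  induction m using BiForms.induction with
  | zero => simp only [map_zero]
  | add m m' h h' => simp only [map_add, h, h']
  | of q p f =>
    have h1 : T.dPoly (BiForms.of (M := fun p => ⋀[A]^p L₁) q p f) =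
      BiForms.of (M := fun p => ⋀[A]^p L₁) (q + 1) p ((T.act₂₁.ext p).ce q f) :=
        BiForms.ce_of (M := fun p => ⋀[A]^p L₁) _ f
    rw [h1]
    by_cases hp : p ≤ n
    · rw [PolyForms.flat_of Ω (Nat.sub_add_cancel hp), PolyForms.flat_of Ω (Nat.sub_add_cancel hp),
        LRConnection.ce_compAlternatingMap _ _ _ (T.contract_ext Ω hΩ (Nat.sub_add_cancel hp))]
      exact (BiForms.ce_of (M := fun k => L₁ [⋀^Fin k]→ₗ[A] A) _ _).symm
    · rw [PolyForms.flat_of_lt Ω (not_le.1 hp), PolyForms.flat_of_lt Ω (not_le.1 hp), map_zero]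

end AlmostTwilled

/-! ### Cartan's formulas for a single Lie-Rinehart algebra. -/

namespace LRConnection

variable {R A L M : Type*} [CommRing R] [CommRing A] [Algebra R A]
  [LieRing L] [LieAlgebra R L] [Module A L] [LieRingModule L A] [LieRinehartRing A L]
  [AddCommGroup M] [Module R M] [Module A M] [IsScalarTower R A M]

theorem curryLeft_ceAlt (D : LRConnection R A L M) {q : ℕ} (f : L [⋀^Fin (q + 1)]→ₗ[A] M) (x : L) :
    (D.ceAlt f).curryLeft x = D.lieD x f - D.ceAlt (f.curryLeft x) := by
  ext v
  exact D.ceFun_cons f x v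

theorem curryLeft_ceAlt_zero (D : LRConnection R A L M) (f : L [⋀^Fin 0]→ₗ[A] M) (x : L) :
    (D.ceAlt f).curryLeft x = D.lieD x f := by
  ext v
  refine (D.ceFun_degree_zero f _ v).trans ?_
  rw [lieD_apply]
  simp

theorem lieD_curryLeft (D : LRConnection R A L M) {q : ℕ} (f : L [⋀^Fin (q + 1)]→ₗ[A] M) (x y : L) :
    D.lieD x (f.curryLeft y) = (D.lieD x f).curryLeft y + f.curryLeft ⁅x, y⁆ := by
  ext v
  rw [AlternatingMap.add_apply, lieD_apply, AlternatingMap.curryLeft_apply_apply,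
    AlternatingMap.curryLeft_apply_apply, AlternatingMap.curryLeft_apply_apply, lieD_apply,
    Fin.sum_univ_succ]
  have h : ∀ i : Fin q, update (Matrix.vecCons y v) i.succ ⁅x, Matrix.vecCons y v i.succ⁆ =
      Matrix.vecCons y (update v i ⁅x, v i⁆) := fun i => (Fin.cons_update (α := fun _ => L) y v i _).symm
  have h0 : update (Matrix.vecCons y v) 0 ⁅x, Matrix.vecCons y v 0⁆ = Matrix.vecCons ⁅x, y⁆ v :=
    Fin.update_cons_zero (α := fun _ => L) y v _
  simp only [h, h0, AlternatingMap.curryLeft_apply_apply]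
  abel

end LRConnection

theorem smul_smul_eq_neg {V : Type*} [AddCommGroup V] (a b : ℤ) {u v : V} (h : u = -v) :
    a • b • u = -(a • b • v) := by
  rw [h, smul_neg, smul_neg]

/-! ### Insertions into forms on `L₂` with values in forms on `L₁`. -/

namespace MixedForms

variable {A L₁ L₂ : Type*} [CommRing A] [AddCommGroup L₁] [Module A L₁]
  [AddCommGroup L₂] [Module A L₂]

local notation "ofW" => BiForms.of (A := A) (L := L₂) (M := fun k => L₁ [⋀^Fin k]→ₗ[A] A)

theorem of_add (q k : ℕ) (f g : L₂ [⋀^Fin q]→ₗ[A] (L₁ [⋀^Fin k]→ₗ[A] A)) :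
    ofW q k (f + g) = ofW q k f + ofW q k g := BiForms.of_add (M := fun k => L₁ [⋀^Fin k]→ₗ[A] A) _ _ _ _

theorem of_sub (q k : ℕ) (f g : L₂ [⋀^Fin q]→ₗ[A] (L₁ [⋀^Fin k]→ₗ[A] A)) :
    ofW q k (f - g) = ofW q k f - ofW q k g := BiForms.of_sub (M := fun k => L₁ [⋀^Fin k]→ₗ[A] A) _ _ _ _

theorem of_zsmul (q k : ℕ) (c : ℤ) (f : L₂ [⋀^Fin q]→ₗ[A] (L₁ [⋀^Fin k]→ₗ[A] A)) :
    ofW q k (c • f) = c • ofW q k f := BiForms.of_zsmul (M := fun k => L₁ [⋀^Fin k]→ₗ[A] A) _ _ _ _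

theorem of_neg (q k : ℕ) (f : L₂ [⋀^Fin q]→ₗ[A] (L₁ [⋀^Fin k]→ₗ[A] A)) :
    ofW q k (-f) = -ofW q k f := map_neg (ofW q k) f

theorem of_apply_same (q k : ℕ) (f : L₂ [⋀^Fin q]→ₗ[A] (L₁ [⋀^Fin k]→ₗ[A] A)) :
    ofW q k f (q, k) = f :=
  DirectSum.of_eq_same (β := fun d : ℕ × ℕ => L₂ [⋀^Fin d.1]→ₗ[A] (L₁ [⋀^Fin d.2]→ₗ[A] A)) (q, k) f

theorem of_apply_ne {q k r s : ℕ} (f : L₂ [⋀^Fin q]→ₗ[A] (L₁ [⋀^Fin k]→ₗ[A] A))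
    (h : (q, k) ≠ (r, s)) : ofW q k f (r, s) = 0 :=
  DirectSum.of_eq_of_ne (β := fun d : ℕ × ℕ => L₂ [⋀^Fin d.1]→ₗ[A] (L₁ [⋀^Fin d.2]→ₗ[A] A))
    (q, k) (r, s) f h.symm

/-- Insertion of a vector of `L₁` into the values of a form. -/
def insVal {q k : ℕ} (x : L₁) (f : L₂ [⋀^Fin q]→ₗ[A] (L₁ [⋀^Fin (k + 1)]→ₗ[A] A)) :
    L₂ [⋀^Fin q]→ₗ[A] (L₁ [⋀^Fin k]→ₗ[A] A) :=
  (AlternatingMap.curryLeftLinearMap.flip x).compAlternatingMap f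

theorem insVal_apply {q k : ℕ} (x : L₁) (f : L₂ [⋀^Fin q]→ₗ[A] (L₁ [⋀^Fin (k + 1)]→ₗ[A] A))
    (v : Fin q → L₂) (y : Fin k → L₁) : insVal x f v y = f v (Matrix.vecCons x y) := rfl

/-- Insertion of `x` on the component of bidegree `d`. -/
noncomputable def insAux (x : L₁) :
    (d : ℕ × ℕ) → (L₂ [⋀^Fin d.1]→ₗ[A] (L₁ [⋀^Fin d.2]→ₗ[A] A)) →ₗ[A] MixedForms A L₁ L₂
  | (_, 0) => 0
  | (q, k + 1) => (-1 : ℤ) ^ (q + k + 1) • (ofW q k ∘ₗ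
      LinearMap.compAlternatingMapₗ A (AlternatingMap.curryLeftLinearMap.flip x))

/-- Insertion of a vector of `L₁`, an operator of bidegree `(0, -1)`. -/
noncomputable def ins (x : L₁) : MixedForms A L₁ L₂ →ₗ[A] MixedForms A L₁ L₂ :=
  DirectSum.toModule A (ℕ × ℕ) _ (insAux x)

theorem ins_of_zero (x : L₁) (q : ℕ) (f : L₂ [⋀^Fin q]→ₗ[A] (L₁ [⋀^Fin 0]→ₗ[A] A)) :
    ins x (ofW q 0 f) = 0 := by
  rw [ins, BiForms.of, DirectSum.toModule_lof]
  rfl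

theorem ins_of_succ (x : L₁) (q k : ℕ) (f : L₂ [⋀^Fin q]→ₗ[A] (L₁ [⋀^Fin (k + 1)]→ₗ[A] A)) :
    ins x (ofW q (k + 1) f) = (-1 : ℤ) ^ (q + k + 1) • ofW q k (insVal x f) := by
  rw [ins, BiForms.of, DirectSum.toModule_lof]
  rfl

theorem contr_of_zero (x : L₂) (k : ℕ) (f : L₂ [⋀^Fin 0]→ₗ[A] (L₁ [⋀^Fin k]→ₗ[A] A)) :
    BiForms.contr x (ofW 0 k f) = 0 :=
  BiForms.contr_of_zero (M := fun k => L₁ [⋀^Fin k]→ₗ[A] A) x k f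

theorem contr_of_succ (x : L₂) (q k : ℕ) (f : L₂ [⋀^Fin (q + 1)]→ₗ[A] (L₁ [⋀^Fin k]→ₗ[A] A)) :
    BiForms.contr x (ofW (q + 1) k f) = (-1 : ℤ) ^ (q + 1) • ofW q k (f.curryLeft x) :=
  BiForms.contr_of_succ (M := fun k => L₁ [⋀^Fin k]→ₗ[A] A) x q k f

theorem contr_zsmul (x : L₂) (c : ℤ) (m : MixedForms A L₁ L₂) :
    BiForms.contr x (c • m) = c • BiForms.contr x m := map_zsmul (BiForms.contr x) c m

theorem ins_zsmul (x : L₁) (c : ℤ) (m : MixedForms A L₁ L₂) :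
    ins x (c • m) = c • ins x m := map_zsmul (ins x) c m

/-- The two insertions act on separate groups of arguments. They anticommute because the sign in
`ins` counts the total degree, which an insertion from `L₂` lowers by one. -/
theorem ins_contr (x : L₁) (ξ : L₂) (m : MixedForms A L₁ L₂) :
    ins x (BiForms.contr ξ m) = - BiForms.contr ξ (ins x m) := by
  induction m using BiForms.induction with
  | zero => simp only [map_zero, neg_zero]
  | add m m' h h' => rw [map_add, map_add, h, h', map_add, map_add, neg_add]
  | of q k f =>
    rcases q with _ | q <;> rcases k with _ | k
    · rw [contr_of_zero, ins_of_zero, map_zero, map_zero, neg_zero]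
    · rw [contr_of_zero, ins_of_succ, map_zero, contr_zsmul, contr_of_zero, smul_zero, neg_zero]
    · rw [contr_of_succ, ins_of_zero, ins_zsmul, ins_of_zero, smul_zero, map_zero, neg_zero]
    · rw [contr_of_succ, ins_of_succ, ins_zsmul, contr_zsmul, contr_of_succ, ins_of_succ,
        smul_smul, smul_smul, ← neg_smul]
      have : (-1 : ℤ) ^ (q + 1) * (-1) ^ (q + k + 1) = -((-1) ^ (q + 1 + k + 1) * (-1) ^ (q + 1)) := by
        ring
      rw [this]
      rfl

theorem ins_ins (x y : L₁) (m : MixedForms A L₁ L₂) : ins x (ins y m) = - ins y (ins x m) := by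
  induction m using BiForms.induction with
  | zero => simp only [map_zero, neg_zero]
  | add m m' h h' => rw [map_add, map_add, h, h', map_add, map_add, neg_add]
  | of q k f =>
    rcases k with _ | _ | k
    · rw [ins_of_zero, ins_of_zero, map_zero, map_zero, neg_zero]
    · rw [ins_of_succ, ins_of_succ, ins_zsmul, ins_zsmul, ins_of_zero, ins_of_zero, smul_zero, neg_zero]
    · rw [ins_of_succ, ins_of_succ, ins_zsmul, ins_zsmul, ins_of_succ, ins_of_succ]
      refine smul_smul_eq_neg _ _ ?_
      rw [← of_neg]
      congr 1
      ext v w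
      rw [insVal_apply, insVal_apply, AlternatingMap.neg_apply, AlternatingMap.neg_apply,
        insVal_apply, insVal_apply]
      have h := (f v).map_swap (Matrix.vecCons x (Matrix.vecCons y w)) (i := 0) (j := 1) (by simp)
      refine Eq.trans ?_ h
      congr 1
      funext i
      refine Fin.cases ?_ (fun i => Fin.cases ?_ (fun i => ?_) i) i
      · simp
      · simp
      · simp [Equiv.swap_apply_of_ne_of_ne, Fin.ext_iff]

theorem contr_contr (x y : L₂) (m : MixedForms A L₁ L₂) :
    BiForms.contr x (BiForms.contr y m) = - BiForms.contr y (BiForms.contr x m) := by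
  induction m using BiForms.induction with
  | zero => simp only [map_zero, neg_zero]
  | add m m' h h' => rw [map_add, map_add, h, h', map_add, map_add, neg_add]
  | of q k f =>
    rcases q with _ | _ | q
    · rw [contr_of_zero, contr_of_zero, map_zero, map_zero, neg_zero]
    · rw [contr_of_succ, contr_of_succ, contr_zsmul, contr_zsmul, contr_of_zero, contr_of_zero, smul_zero, neg_zero]
    · rw [contr_of_succ, contr_of_succ, contr_zsmul, contr_zsmul, contr_of_succ, contr_of_succ]
      refine smul_smul_eq_neg _ _ ?_
      rw [← of_neg]
      congr 1
      ext1 v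
      have h := f.map_swap (Matrix.vecCons x (Matrix.vecCons y v)) (i := 0) (j := 1) (by simp)
      refine Eq.trans ?_ h
      change f _ = f _
      congr 1
      funext i
      refine Fin.cases ?_ (fun i => Fin.cases ?_ (fun i => ?_) i) i
      · simp
      · simp
      · simp [Equiv.swap_apply_of_ne_of_ne, Fin.ext_iff]


theorem ins_apply (x : L₁) (m : MixedForms A L₁ L₂) (q k : ℕ) :
    ins x m (q, k) = (-1 : ℤ) ^ (q + k + 1) • insVal x (m (q, k + 1)) := by
  induction m using BiForms.induction with
  | zero =>
    rw [map_zero]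
    exact (smul_zero _).symm
  | add m m' h h' =>
    rw [map_add]
    refine (congrArg₂ (· + ·) h h').trans ?_
    rw [← smul_add]
    rfl
  | of r s f =>
    by_cases hd : (r, s) = (q, k + 1)
    · obtain ⟨rfl, rfl⟩ := Prod.mk.inj hd
      have h1 : ofW r (k + 1) f (r, k + 1) = f := of_apply_same _ _ f
      rw [ins_of_succ, ← of_zsmul, h1]
      exact of_apply_same _ _ _
    · have h1 : ofW r s f (q, k + 1) = 0 := of_apply_ne f hd
      rw [h1]
      rcases s with _ | s
      · rw [ins_of_zero]
        exact (smul_zero _).symm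
      · rw [ins_of_succ, ← of_zsmul]
        refine (of_apply_ne _ ?_).trans (smul_zero _).symm
        intro h
        obtain ⟨rfl, rfl⟩ := Prod.mk.inj h
        exact hd rfl

theorem contr_apply (x : L₂) (m : MixedForms A L₁ L₂) (q k : ℕ) :
    BiForms.contr x m (q, k) = (-1 : ℤ) ^ (q + 1) • (m (q + 1, k)).curryLeft x := by
  induction m using BiForms.induction with
  | zero =>
    rw [map_zero]
    exact (smul_zero _).symm
  | add m m' h h' =>
    rw [map_add]
    refine (congrArg₂ (· + ·) h h').trans ?_
    rw [← smul_add]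
    rfl
  | of r s f =>
    by_cases hd : (r, s) = (q + 1, k)
    · obtain ⟨rfl, rfl⟩ := Prod.mk.inj hd
      have h1 : ofW (q + 1) s f (q + 1, s) = f := of_apply_same _ _ f
      rw [contr_of_succ, ← of_zsmul, h1]
      exact of_apply_same _ _ _
    · have h1 : ofW r s f (q + 1, k) = 0 := of_apply_ne f hd
      rw [h1]
      rcases r with _ | r
      · rw [contr_of_zero]
        exact (smul_zero _).symm
      · rw [contr_of_succ, ← of_zsmul]
        refine (of_apply_ne _ ?_).trans (smul_zero _).symm
        intro h
        obtain ⟨rfl, rfl⟩ := Prod.mk.inj h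
        exact hd rfl

theorem apply_eq_zero_of_ins (m : MixedForms A L₁ L₂) (h : ∀ x, ins x m = 0) (q k : ℕ) :
    m (q, k + 1) = 0 := by
  ext v w
  have h1 := ins_apply (w 0) m q k
  rw [h] at h1
  have h2 : insVal (w 0) (m (q, k + 1)) = 0 := by
    rw [← neg_one_pow_smul_smul (q + k + 1) (insVal (w 0) (m (q, k + 1))), ← h1]
    exact smul_zero _
  have h3 := congrFun (congrArg DFunLike.coe (congrFun (congrArg DFunLike.coe h2) v)) (Fin.tail w)
  rw [insVal_apply, show Matrix.vecCons (w 0) (Fin.tail w) = w from Fin.cons_self_tail w] at h3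
  exact h3

theorem apply_eq_zero_of_contr (m : MixedForms A L₁ L₂) (h : ∀ x, BiForms.contr x m = 0) (q k : ℕ) :
    m (q + 1, k) = 0 := by
  ext v w
  have h1 := contr_apply (v 0) m q k
  rw [h] at h1
  have h2 : (m (q + 1, k)).curryLeft (v 0) = 0 := by
    rw [← neg_one_pow_smul_smul (q + 1) ((m (q + 1, k)).curryLeft (v 0)), ← h1]
    exact smul_zero _
  have h3 := congrFun (congrArg DFunLike.coe h2) (Fin.tail v)
  rw [AlternatingMap.curryLeft_apply_apply,
    show Matrix.vecCons (v 0) (Fin.tail v) = v from Fin.cons_self_tail v] at h3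
  exact congrFun (congrArg DFunLike.coe h3) w

theorem ext_apply {m m' : MixedForms A L₁ L₂} (h : ∀ q k, m (q, k) = m' (q, k)) : m = m' :=
  DFinsupp.ext fun d => h d.1 d.2

/-- A form which is annihilated by all insertions vanishes if its component of bidegree `(0, 0)`
does. -/
theorem eq_zero_of_ins_of_contr (m : MixedForms A L₁ L₂) (h₁ : ∀ x, ins x m = 0)
    (h₂ : ∀ ξ, BiForms.contr ξ m = 0) (h₀ : m (0, 0) = 0) : m = 0 := by
  refine ext_apply fun q k => ?_
  rcases q with _ | q
  · rcases k with _ | k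
    · exact h₀
    · exact apply_eq_zero_of_ins m h₁ 0 k
  · exact apply_eq_zero_of_contr m h₂ q k

end MixedForms

/-! ### Lie derivatives of both algebras and their commutation relations. -/

theorem AlternatingMap.finset_sum_apply {A L M ι κ : Type*} [CommRing A] [AddCommGroup L]
    [Module A L] [AddCommGroup M] [Module A M] (s : Finset κ) (f : κ → L [⋀^ι]→ₗ[A] M) (v : ι → L) :
    (∑ i ∈ s, f i) v = ∑ i ∈ s, f i v :=
  map_sum (AddMonoidHom.mk' (fun f : L [⋀^ι]→ₗ[A] M => f v) fun _ _ => rfl) f s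

section AltFlip

variable {A L₁ L₂ P : Type*} [CommRing A] [AddCommGroup L₁] [Module A L₁]
  [AddCommGroup L₂] [Module A L₂]

theorem MixedForms.insVal_altFlip {q k : ℕ} (x : L₁) (g : L₁ [⋀^Fin (k + 1)]→ₗ[A] (L₂ [⋀^Fin q]→ₗ[A] A)) :
    MixedForms.insVal x (altFlip A (k + 1) q g) = altFlip A k q (g.curryLeft x) := rfl

theorem altFlip_curryLeft {q k : ℕ} (x : L₁) (f : L₂ [⋀^Fin q]→ₗ[A] (L₁ [⋀^Fin (k + 1)]→ₗ[A] A)) :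
    (altFlip A q (k + 1) f).curryLeft x = altFlip A q k (MixedForms.insVal x f) := rfl

theorem altFlip_sub [AddCommGroup P] [Module A P] {q k : ℕ} (f g : L₂ [⋀^Fin q]→ₗ[A] (L₁ [⋀^Fin k]→ₗ[A] P)) :
    altFlip A q k (f - g) = altFlip A q k f - altFlip A q k g := map_sub _ _ _

end AltFlip

namespace AlmostTwilled

variable {R A L₁ L₂ : Type*} [CommRing R] [CommRing A] [Algebra R A]
  [LieRing L₁] [LieAlgebra R L₁] [Module A L₁] [LieRingModule L₁ A] [LieRinehartRing A L₁]
  [LieRinehartAlgebra R A L₁]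
  [LieRing L₂] [LieAlgebra R L₂] [Module A L₂] [LieRingModule L₂ A] [LieRinehartRing A L₂]
  [LieRinehartAlgebra R A L₂]

local notation "ofW" => BiForms.of (A := A) (L := L₂) (M := fun k => L₁ [⋀^Fin k]→ₗ[A] A)

/-- The connection of `L₂` on `Alt^k(L₁, A)`. -/
noncomputable abbrev conn₂ (T : AlmostTwilled R A L₁ L₂) (k : ℕ) :
    LRConnection R A L₂ (L₁ [⋀^Fin k]→ₗ[A] A) :=
  T.act₂₁.alt (LRConnection.ofForm R (0 : L₂ →ₗ[A] A)) k

/-- The connection of `L₁` on `Alt^q(L₂, A)` determined by a 1-form. -/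
noncomputable abbrev conn₁ (T : AlmostTwilled R A L₁ L₂) (α : L₁ →ₗ[A] A) (q : ℕ) :
    LRConnection R A L₁ (L₂ [⋀^Fin q]→ₗ[A] A) :=
  T.act₁₂.alt (LRConnection.ofForm R α) q

theorem dMixed_of (T : AlmostTwilled R A L₁ L₂) (q k : ℕ)
    (f : L₂ [⋀^Fin q]→ₗ[A] (L₁ [⋀^Fin k]→ₗ[A] A)) :
    T.dMixed (ofW q k f) = (-1 : ℤ) ^ (q + 1) • ofW (q + 1) k ((T.conn₂ k).ceAlt f) :=
  (BiForms.ce_of (M := fun k => L₁ [⋀^Fin k]→ₗ[A] A) _ f).trans (MixedForms.of_zsmul _ _ _ _)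

/-- The Lie-Rinehart operator of `L₁`, without its sign. -/
noncomputable def ceFlip (T : AlmostTwilled R A L₁ L₂) (α : L₁ →ₗ[A] A) {q k : ℕ}
    (f : L₂ [⋀^Fin q]→ₗ[A] (L₁ [⋀^Fin k]→ₗ[A] A)) : L₂ [⋀^Fin q]→ₗ[A] (L₁ [⋀^Fin (k + 1)]→ₗ[A] A) :=
  altFlip A (k + 1) q ((T.conn₁ α q).ceAlt (altFlip A q k f))

/-- The Lie derivative along a vector of `L₁`. -/
noncomputable def lieFlip (T : AlmostTwilled R A L₁ L₂) (α : L₁ →ₗ[A] A) (x : L₁) {q k : ℕ}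
    (f : L₂ [⋀^Fin q]→ₗ[A] (L₁ [⋀^Fin k]→ₗ[A] A)) : L₂ [⋀^Fin q]→ₗ[A] (L₁ [⋀^Fin k]→ₗ[A] A) :=
  altFlip A k q ((T.conn₁ α q).lieD x (altFlip A q k f))

theorem dPrime_of (T : AlmostTwilled R A L₁ L₂) (α : L₁ →ₗ[A] A) (q k : ℕ)
    (f : L₂ [⋀^Fin q]→ₗ[A] (L₁ [⋀^Fin k]→ₗ[A] A)) :
    T.dPrime α (ofW q k f) = (-1 : ℤ) ^ (q + k + 1) • ofW q (k + 1) (T.ceFlip α f) := by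
  have h : T.dPrime α (ofW q k f) = (-1 : ℤ) ^ q • ofW q (k + 1)
      (altFlip A (k + 1) q ((T.conn₁ α q).ce k (altFlip A q k f))) := by
    rw [dPrime, BiForms.of]
    erw [DirectSum.toModule_lof]
    rfl
  rw [h, show (T.conn₁ α q).ce k (altFlip A q k f) =
    (-1 : ℤ) ^ (k + 1) • (T.conn₁ α q).ceAlt (altFlip A q k f) from rfl,
    show (-1 : ℤ) ^ (q + k + 1) = (-1) ^ q * (-1) ^ (k + 1) by ring,
    mul_smul, ← MixedForms.of_zsmul q (k + 1) ((-1) ^ (k + 1))]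
  refine congrArg (fun g => (-1 : ℤ) ^ q • ofW q (k + 1) g) ?_
  exact map_zsmul (altFlip A (k + 1) q) _ _

theorem dMixed_apply_zero (T : AlmostTwilled R A L₁ L₂) (m : MixedForms A L₁ L₂) (k : ℕ) :
    T.dMixed m (0, k) = 0 := by
  induction m using BiForms.induction with
  | zero => rw [map_zero]; rfl
  | add m m' h h' =>
    rw [map_add]
    exact (congrArg₂ (· + ·) h h').trans (add_zero _)
  | of r s f =>
    rw [dMixed_of, ← MixedForms.of_zsmul]
    exact MixedForms.of_apply_ne _ (by simp)

theorem dPrime_apply_zero (T : AlmostTwilled R A L₁ L₂) (α : L₁ →ₗ[A] A) (m : MixedForms A L₁ L₂)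
    (q : ℕ) : T.dPrime α m (q, 0) = 0 := by
  induction m using BiForms.induction with
  | zero => rw [map_zero]; rfl
  | add m m' h h' =>
    rw [map_add]
    exact (congrArg₂ (· + ·) h h').trans (add_zero _)
  | of r s f =>
    rw [dPrime_of, ← MixedForms.of_zsmul]
    exact MixedForms.of_apply_ne _ (by simp)

/-- `d''` on the component of bidegree `(q, k)` only depends on the component `(q - 1, k)`. -/
theorem dMixed_apply_succ_eq_zero (T : AlmostTwilled R A L₁ L₂) (m : MixedForms A L₁ L₂) (q k : ℕ)
    (hm : m (q, k) = 0) : T.dMixed m (q + 1, k) = 0 := by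
  have key : T.dMixed m (q + 1, k) = (T.conn₂ k).ce q (m (q, k)) := by
    clear hm
    induction m using BiForms.induction with
    | zero =>
      rw [map_zero]
      exact (map_zero ((T.conn₂ k).ce q)).symm
    | add m m' h h' =>
      rw [map_add]
      exact (congrArg₂ (· + ·) h h').trans (map_add ((T.conn₂ k).ce q) _ _).symm
    | of r s f =>
      rw [dMixed_of, ← MixedForms.of_zsmul]
      by_cases hd : (r, s) = (q, k)
      · obtain ⟨rfl, rfl⟩ := Prod.mk.inj hd
        rw [MixedForms.of_apply_same, MixedForms.of_apply_same]
        rfl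
      · rw [MixedForms.of_apply_ne f hd, MixedForms.of_apply_ne, map_zero]
        intro h
        obtain ⟨h1, rfl⟩ := Prod.mk.inj h
        obtain rfl : r = q := by omega
        exact hd rfl
  rw [key, hm, map_zero]

theorem dPrime_apply_succ_eq_zero (T : AlmostTwilled R A L₁ L₂) (α : L₁ →ₗ[A] A)
    (m : MixedForms A L₁ L₂) (q k : ℕ) (hm : m (q, k) = 0) : T.dPrime α m (q, k + 1) = 0 := by
  have key : T.dPrime α m (q, k + 1) = (-1 : ℤ) ^ q •
      (altFlip A (k + 1) q ((T.conn₁ α q).ce k (altFlip A q k (m (q, k))))) := by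
    clear hm
    induction m using BiForms.induction with
    | zero =>
      rw [map_zero, DirectSum.zero_apply, DirectSum.zero_apply, map_zero, map_zero, map_zero, smul_zero]
    | add m m' h h' =>
      rw [map_add, DirectSum.add_apply, DirectSum.add_apply, h, h', map_add, map_add, map_add, smul_add]
    | of r s f =>
      rw [dPrime_of, ← MixedForms.of_zsmul]
      by_cases hd : (r, s) = (q, k)
      · obtain ⟨rfl, rfl⟩ := Prod.mk.inj hd
        rw [MixedForms.of_apply_same, MixedForms.of_apply_same, add_assoc, pow_add, mul_smul]
        refine congrArg (fun g => (-1 : ℤ) ^ r • g) ?_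
        exact (map_zsmul (altFlip A (s + 1) r) _ _).symm
      · rw [MixedForms.of_apply_ne f hd, MixedForms.of_apply_ne, map_zero, map_zero, map_zero,
          smul_zero]
        intro h
        obtain ⟨rfl, h1⟩ := Prod.mk.inj h
        obtain rfl : s = k := by omega
        exact hd rfl
  rw [key, hm, map_zero, map_zero, map_zero, smul_zero]

/-- Insertion of a vector of `L₂`, as an `R`-linear operator. -/
noncomputable def opContr (R : Type*) [CommRing R] [Algebra R A] (ξ : L₂) :
    Module.End R (MixedForms A L₁ L₂) :=
  (BiForms.contr ξ).restrictScalars R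

/-- Insertion of a vector of `L₁`, as an `R`-linear operator. -/
noncomputable def opIns (R : Type*) [CommRing R] [Algebra R A] (x : L₁) :
    Module.End R (MixedForms A L₁ L₂) :=
  (MixedForms.ins x).restrictScalars R

/-- The operator `d''`, as an element of the ring of endomorphisms. -/
noncomputable def opD₂ (T : AlmostTwilled R A L₁ L₂) : Module.End R (MixedForms A L₁ L₂) := T.dMixed

/-- The operator `d'_α`, as an element of the ring of endomorphisms. -/
noncomputable def opD₁ (T : AlmostTwilled R A L₁ L₂) (α : L₁ →ₗ[A] A) :
    Module.End R (MixedForms A L₁ L₂) := T.dPrime α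

/-- The Lie derivative along a vector of `L₂` on the forms on `L₂`. -/
noncomputable def opLie₂ (T : AlmostTwilled R A L₁ L₂) (ξ : L₂) :
    Module.End R (MixedForms A L₁ L₂) :=
  T.opD₂ * opContr R ξ + opContr R ξ * T.opD₂

/-- The Lie derivative along a vector of `L₁` on the forms on `L₁`. -/
noncomputable def opLie₁ (T : AlmostTwilled R A L₁ L₂) (α : L₁ →ₗ[A] A) (x : L₁) :
    Module.End R (MixedForms A L₁ L₂) :=
  T.opD₁ α * opIns R x + opIns R x * T.opD₁ α

/-- Cartan's formula. The differential out of form degree `q` and the insertion back into it carry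
the same sign, so the anticommutator is the Lie derivative without any sign. -/
theorem opLie₂_of (T : AlmostTwilled R A L₁ L₂) (ξ : L₂) (q k : ℕ)
    (f : L₂ [⋀^Fin q]→ₗ[A] (L₁ [⋀^Fin k]→ₗ[A] A)) :
    T.opLie₂ ξ (ofW q k f) = ofW q k ((T.conn₂ k).lieD ξ f) := by
  change T.dMixed (BiForms.contr ξ (ofW q k f)) + BiForms.contr ξ (T.dMixed (ofW q k f)) = _
  rw [dMixed_of, MixedForms.contr_zsmul, MixedForms.contr_of_succ, neg_one_pow_smul_smul]
  rcases q with _ | q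
  · rw [MixedForms.contr_of_zero, map_zero, LRConnection.curryLeft_ceAlt_zero]
    exact zero_add _
  · rw [MixedForms.contr_of_succ, map_zsmul, dMixed_of, neg_one_pow_smul_smul,
      LRConnection.curryLeft_ceAlt, MixedForms.of_sub]
    exact add_sub_cancel _ _

/-- As for `L₂`: the Koszul signs of `d'_α` and `ins` agree, and cancel in the anticommutator. -/
theorem opLie₁_of (T : AlmostTwilled R A L₁ L₂) (α : L₁ →ₗ[A] A) (x : L₁) (q k : ℕ)
    (f : L₂ [⋀^Fin q]→ₗ[A] (L₁ [⋀^Fin k]→ₗ[A] A)) :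
    T.opLie₁ α x (ofW q k f) = ofW q k (T.lieFlip α x f) := by
  change T.dPrime α (MixedForms.ins x (ofW q k f)) + MixedForms.ins x (T.dPrime α (ofW q k f)) = _
  rw [dPrime_of, MixedForms.ins_zsmul, MixedForms.ins_of_succ, neg_one_pow_smul_smul, ceFlip,
    MixedForms.insVal_altFlip, lieFlip]
  rcases k with _ | k
  · rw [MixedForms.ins_of_zero, map_zero, LRConnection.curryLeft_ceAlt_zero]
    exact zero_add _
  · rw [MixedForms.ins_of_succ, map_zsmul, dPrime_of, neg_one_pow_smul_smul,
      LRConnection.curryLeft_ceAlt, altFlip_sub, MixedForms.of_sub]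
    exact add_sub_cancel _ _

theorem opLie₂_mul_opContr (T : AlmostTwilled R A L₁ L₂) (ξ η : L₂) :
    T.opLie₂ ξ * opContr R η = opContr R η * T.opLie₂ ξ + opContr R ⁅ξ, η⁆ := by
  refine BiForms.addHom_ext fun q k f => ?_
  change T.opLie₂ ξ (BiForms.contr η (ofW q k f)) =
    BiForms.contr η (T.opLie₂ ξ (ofW q k f)) + BiForms.contr ⁅ξ, η⁆ (ofW q k f)
  rcases q with _ | q
  · rw [opLie₂_of, MixedForms.contr_of_zero, MixedForms.contr_of_zero, MixedForms.contr_of_zero,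
      map_zero]
    exact (add_zero _).symm
  · rw [opLie₂_of, MixedForms.contr_of_succ, MixedForms.contr_of_succ, MixedForms.contr_of_succ,
      map_zsmul, opLie₂_of, LRConnection.lieD_curryLeft, MixedForms.of_add]
    exact smul_add _ _ _

theorem opLie₁_mul_opIns (T : AlmostTwilled R A L₁ L₂) (α : L₁ →ₗ[A] A) (x y : L₁) :
    T.opLie₁ α x * opIns R y = opIns R y * T.opLie₁ α x + opIns R ⁅x, y⁆ := by
  refine BiForms.addHom_ext fun q k f => ?_
  change T.opLie₁ α x (MixedForms.ins y (ofW q k f)) =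
    MixedForms.ins y (T.opLie₁ α x (ofW q k f)) + MixedForms.ins ⁅x, y⁆ (ofW q k f)
  rcases k with _ | k
  · rw [opLie₁_of, MixedForms.ins_of_zero, MixedForms.ins_of_zero, MixedForms.ins_of_zero,
      map_zero]
    exact (add_zero _).symm
  · rw [opLie₁_of, MixedForms.ins_of_succ, MixedForms.ins_of_succ, MixedForms.ins_of_succ,
      map_zsmul, opLie₁_of]
    have h : T.lieFlip α x (MixedForms.insVal y f) = MixedForms.insVal y (T.lieFlip α x f) +
        MixedForms.insVal ⁅x, y⁆ f := by
      rw [lieFlip, lieFlip, ← altFlip_curryLeft, LRConnection.lieD_curryLeft]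
      rfl
    rw [h, MixedForms.of_add]
    exact smul_add _ _ _

/-- A vector of `L₂` differentiates the values of a form, and through them the arguments from `L₁`,
by its action on `L₁`. The argument into which `y` is inserted contributes the extra term. -/
theorem opLie₂_mul_opIns (T : AlmostTwilled R A L₁ L₂) (ξ : L₂) (y : L₁) :
    T.opLie₂ ξ * opIns R y = opIns R y * T.opLie₂ ξ + opIns R (T.act₂₁.toEnd ξ y) := by
  refine BiForms.addHom_ext fun q k f => ?_
  change T.opLie₂ ξ (MixedForms.ins y (ofW q k f)) =
    MixedForms.ins y (T.opLie₂ ξ (ofW q k f)) + MixedForms.ins (T.act₂₁.toEnd ξ y) (ofW q k f)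
  rcases k with _ | k
  · rw [opLie₂_of, MixedForms.ins_of_zero, MixedForms.ins_of_zero, MixedForms.ins_of_zero,
      map_zero]
    exact (add_zero _).symm
  · rw [opLie₂_of, MixedForms.ins_of_succ, MixedForms.ins_of_succ, MixedForms.ins_of_succ,
      map_zsmul, opLie₂_of]
    have h : (T.conn₂ k).lieD ξ (MixedForms.insVal y f) =
        MixedForms.insVal y ((T.conn₂ (k + 1)).lieD ξ f) +
          MixedForms.insVal (T.act₂₁.toEnd ξ y) f := by
      ext v w
      rw [AlternatingMap.add_apply, AlternatingMap.add_apply, LRConnection.lieD_apply,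
        MixedForms.insVal_apply, MixedForms.insVal_apply, LRConnection.lieD_apply,
        AlternatingMap.sub_apply, AlternatingMap.sub_apply, alt_toEnd_apply, alt_toEnd_apply,
        Fin.sum_univ_succ, AlternatingMap.finset_sum_apply, AlternatingMap.finset_sum_apply]
      have h1 : ∀ i : Fin k, update (Matrix.vecCons y w) i.succ
          (T.act₂₁.toEnd ξ (Matrix.vecCons y w i.succ)) =
          Matrix.vecCons y (update w i (T.act₂₁.toEnd ξ (w i))) := fun i =>
        (Fin.cons_update (α := fun _ => L₁) y w i _).symm
      have h0 : update (Matrix.vecCons y w) 0 (T.act₂₁.toEnd ξ (Matrix.vecCons y w 0)) =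
          Matrix.vecCons (T.act₂₁.toEnd ξ y) w := Fin.update_cons_zero (α := fun _ => L₁) y w _
      simp only [h1, h0, MixedForms.insVal_apply]
      abel
    rw [h, MixedForms.of_add]
    exact smul_add _ _ _

theorem opLie₁_mul_opContr (T : AlmostTwilled R A L₁ L₂) (α : L₁ →ₗ[A] A) (x : L₁) (η : L₂) :
    T.opLie₁ α x * opContr R η = opContr R η * T.opLie₁ α x + opContr R (T.act₁₂.toEnd x η) := by
  refine BiForms.addHom_ext fun q k f => ?_
  change T.opLie₁ α x (BiForms.contr η (ofW q k f)) =
    BiForms.contr η (T.opLie₁ α x (ofW q k f)) + BiForms.contr (T.act₁₂.toEnd x η) (ofW q k f)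
  rcases q with _ | q
  · rw [opLie₁_of, MixedForms.contr_of_zero, MixedForms.contr_of_zero, MixedForms.contr_of_zero,
      map_zero]
    exact (add_zero _).symm
  · rw [opLie₁_of, MixedForms.contr_of_succ, MixedForms.contr_of_succ, MixedForms.contr_of_succ,
      map_zsmul, opLie₁_of]
    have h : T.lieFlip α x (f.curryLeft η) = (T.lieFlip α x f).curryLeft η +
        f.curryLeft (T.act₁₂.toEnd x η) := by
      ext v w
      change (T.conn₁ α q).lieD x (altFlip A q k (f.curryLeft η)) w v =
        (T.conn₁ α (q + 1)).lieD x (altFlip A (q + 1) k f) w (Matrix.vecCons η v) +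
          f (Matrix.vecCons (T.act₁₂.toEnd x η) v) w
      rw [LRConnection.lieD_apply, LRConnection.lieD_apply,
        AlternatingMap.sub_apply, AlternatingMap.sub_apply, alt_toEnd_apply, alt_toEnd_apply,
        Fin.sum_univ_succ, AlternatingMap.finset_sum_apply, AlternatingMap.finset_sum_apply]
      have h1 : ∀ i : Fin q, update (Matrix.vecCons η v) i.succ
          (T.act₁₂.toEnd x (Matrix.vecCons η v i.succ)) =
          Matrix.vecCons η (update v i (T.act₁₂.toEnd x (v i))) := fun i =>
        (Fin.cons_update (α := fun _ => L₂) η v i _).symm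
      have h0 : update (Matrix.vecCons η v) 0 (T.act₁₂.toEnd x (Matrix.vecCons η v 0)) =
          Matrix.vecCons (T.act₁₂.toEnd x η) v := Fin.update_cons_zero (α := fun _ => L₂) η v _
      simp only [h1, h0]
      have h2 : ∀ (w' : Fin k → L₁) (v' : Fin q → L₂), altFlip A q k (f.curryLeft η) w' v' =
        f (Matrix.vecCons η v') w' := fun _ _ => rfl
      have h3 : ∀ (w' : Fin k → L₁) (v' : Fin (q + 1) → L₂), altFlip A (q + 1) k f w' v' =
        f v' w' := fun _ _ => rfl
      simp only [h2, h3]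
      abel
    rw [h, MixedForms.of_add]
    exact smul_add _ _ _

end AlmostTwilled

/-! ### Abstract Cartan calculus: why the total operator has square zero. -/

section RingIdentities

variable {E : Type*} [Ring E]

/-- The bracketed expression is `[[d, i], j]`. Since `e` anticommutes with `i` and `j`, moving it
across replaces `d` by `L = [d, e]` and produces `[[L, i], j]`, which is the anticommutator of `i'`
and `j` and therefore zero. -/
theorem mul_secondOrder_eq_neg {d e i j L i' : E} (h : e * d + d * e = L)
    (hei : e * i + i * e = 0) (hej : e * j + j * e = 0) (hi : L * i = i * L + i')
    (hij : i' * j + j * i' = 0) :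
    e * (d * i * j + i * d * j - j * d * i - j * i * d) =
      -((d * i * j + i * d * j - j * d * i - j * i * d) * e) := by
  linear_combination (norm := noncomm_ring) h * i * j - d * hei * j + d * i * hej + hei * d * j -
    i * h * j + i * d * hej - hej * d * i + j * h * i - j * d * hei - hej * i * d + j * hei * d -
    j * i * h + hi * j + j * hi + hij

/-- The double commutator has eight terms. In `[[d₂, e], j']` and `[[d₁, j], e']` the inner
commutator is not a Lie derivative; as the insertions anticommute, they equal `-[[d₂, j'], e]` and
`-[[d₁, e'], j]`, which accounts for the subtracted `e₂` and `j₂`. -/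
theorem secondOrder_total {d₂ d₁ j e j' e' jb eb j₁ j₂ e₁ e₂ : E}
    (F1 : (d₂ * j + j * d₂) * j' = j' * (d₂ * j + j * d₂) + jb)
    (F2 : (d₂ * j + j * d₂) * e' = e' * (d₂ * j + j * d₂) + e₁)
    (F4 : (d₂ * j' + j' * d₂) * e = e * (d₂ * j' + j' * d₂) + e₂)
    (F3 : d₂ * e * e' + e * d₂ * e' - e' * d₂ * e - e' * e * d₂ = 0)
    (G1 : (d₁ * e + e * d₁) * e' = e' * (d₁ * e + e * d₁) + eb)
    (G2 : (d₁ * e + e * d₁) * j' = j' * (d₁ * e + e * d₁) + j₁)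
    (G4 : (d₁ * e' + e' * d₁) * j = j * (d₁ * e' + e' * d₁) + j₂)
    (G3 : d₁ * j * j' + j * d₁ * j' - j' * d₁ * j - j' * j * d₁ = 0)
    (a1 : e * j' + j' * e = 0) (a2 : e' * j + j * e' = 0) :
    ((d₂ + d₁) * (j + e) + (j + e) * (d₂ + d₁)) * (j' + e') =
      (j' + e') * ((d₂ + d₁) * (j + e) + (j + e) * (d₂ + d₁)) +
        (jb + j₁ - j₂ + (eb + e₁ - e₂)) := by
  linear_combination (norm := noncomm_ring) F1 + F2 - F4 + F3 + G1 + G2 - G4 + G3 + d₂ * a1 -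
    a1 * d₂ + d₁ * a2 - a2 * d₁

theorem commutator_mul_eq {Lu Lv Lb i ivw iuw iuvw ivuw ibw : E} (hv : Lv * i = i * Lv + ivw)
    (hu : Lu * i = i * Lu + iuw) (huv : Lu * ivw = ivw * Lu + iuvw)
    (hvu : Lv * iuw = iuw * Lv + ivuw) (hb : Lb * i = i * Lb + ibw) (hJ : iuvw = ibw + ivuw) :
    (Lu * Lv - Lv * Lu - Lb) * i = i * (Lu * Lv - Lv * Lu - Lb) := by
  linear_combination (norm := noncomm_ring) Lu * hv - Lv * hu + hu * Lv - hv * Lu + huv - hvu - hb + hJ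

theorem anticommutator_lie_eq_zero {d Lu Lv Lb iv ib : E} (hLv : d * iv + iv * d = Lv)
    (hLb : d * ib + ib * d = Lb)
    (h : Lu * iv = iv * Lu + ib) (hc : Lu * Lv - Lv * Lu - Lb = 0) :
    (d * Lu - Lu * d) * iv = -(iv * (d * Lu - Lu * d)) := by
  linear_combination (norm := noncomm_ring) d * h - Lu * hLv + hLv * Lu + h * d + hLb - hc

theorem square_mul_eq {d L i : E} (hL : d * i + i * d = L) (h : d * L - L * d = 0) :
    d * d * i = i * (d * d) := by
  linear_combination (norm := noncomm_ring) d * hL - hL * d + h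

end RingIdentities

/-- Operators `d₁`, `d₂` on an abelian group together with insertion operators `I x`, `J ξ` which
satisfy the Cartan relations of a twilled Lie-Rinehart algebra; `P₁`, `P₂` and `P₀` stand for the
elements without components of bidegree `(*, 0)`, `(0, *)` and `(0, 0)`. -/
structure IsInsertionCalculus {V L₁ L₂ : Type*} [AddCommGroup V] [LieRing L₁] [LieRing L₂]
    (a₁₂ : L₁ → L₂ → L₂) (a₂₁ : L₂ → L₁ → L₁) (d₁ d₂ : AddMonoid.End V) (I : L₁ → AddMonoid.End V)
    (J : L₂ → AddMonoid.End V) (P₁ P₂ P₀ : AddSubgroup V) : Prop where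
  ins_add : ∀ x y, I (x + y) = I x + I y
  contr_add : ∀ x y, J (x + y) = J x + J y
  ins_contr : ∀ x ξ, I x * J ξ + J ξ * I x = 0
  ins_ins : ∀ x y, I x * I y + I y * I x = 0
  contr_contr : ∀ x y, J x * J y + J y * J x = 0
  lie₂_contr : ∀ ξ η, (d₂ * J ξ + J ξ * d₂) * J η = J η * (d₂ * J ξ + J ξ * d₂) + J ⁅ξ, η⁆
  lie₂_ins : ∀ ξ y, (d₂ * J ξ + J ξ * d₂) * I y = I y * (d₂ * J ξ + J ξ * d₂) + I (a₂₁ ξ y)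
  lie₁_ins : ∀ x y, (d₁ * I x + I x * d₁) * I y = I y * (d₁ * I x + I x * d₁) + I ⁅x, y⁆
  lie₁_contr : ∀ x η, (d₁ * I x + I x * d₁) * J η = J η * (d₁ * I x + I x * d₁) + J (a₁₂ x η)
  d₁_mem : ∀ m, d₁ m ∈ P₁
  contr_mem : ∀ ξ, ∀ m ∈ P₁, J ξ m ∈ P₁
  d₂_mem : ∀ m, d₂ m ∈ P₂
  ins_mem : ∀ x, ∀ m ∈ P₂, I x m ∈ P₂
  vanish₁ : ∀ Z : AddMonoid.End V, (∀ x m, Z (I x m) = 0 → I x (Z m) = 0) → (∀ m, Z m ∈ P₁) → Z = 0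
  vanish₂ : ∀ Z : AddMonoid.End V, (∀ x m, Z (J x m) = 0 → J x (Z m) = 0) → (∀ m, Z m ∈ P₂) → Z = 0
  vanish : ∀ Z : AddMonoid.End V, (∀ (u : L₂ × L₁) m, Z ((J u.1 + I u.2) m) = 0 →
    (J u.1 + I u.2) (Z m) = 0) → (∀ m, Z m ∈ P₀) → Z = 0

namespace IsInsertionCalculus

variable {V L₁ L₂ : Type*} [AddCommGroup V] [LieRing L₁] [LieRing L₂]
    {a₁₂ : L₁ → L₂ → L₂} {a₂₁ : L₂ → L₁ → L₁} {d₁ d₂ : AddMonoid.End V} {I : L₁ → AddMonoid.End V}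
    {J : L₂ → AddMonoid.End V} {P₁ P₂ P₀ : AddSubgroup V}
    (h : IsInsertionCalculus a₁₂ a₂₁ d₁ d₂ I J P₁ P₂ P₀)

include h

theorem contr_sub (x y : L₂) : J (x - y) = J x - J y := by
  rw [eq_sub_iff_add_eq, ← h.contr_add, sub_add_cancel]

theorem ins_sub (x y : L₁) : I (x - y) = I x - I y := by
  rw [eq_sub_iff_add_eq, ← h.ins_add, sub_add_cancel]

/-- `d₁` has order at most one in the arguments from `L₂`. Indeed its double commutator with two
insertions from `L₂` anticommutes with insertions from `L₁`, and its values have no component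
without arguments from `L₁`. -/
theorem contr_contr_d₁ (ξ η : L₂) :
    d₁ * J ξ * J η + J ξ * d₁ * J η - J η * d₁ * J ξ - J η * J ξ * d₁ = 0 := by
  refine h.vanish₁ _ (fun x m hm => ?_) fun m => ?_
  · have := DFunLike.congr_fun (mul_secondOrder_eq_neg (add_comm _ _) (h.ins_contr x ξ) (h.ins_contr x η)
      (h.lie₁_contr x ξ) (h.contr_contr _ _)) m
    refine this.trans ?_
    exact neg_eq_zero.2 hm
  · exact sub_mem (sub_mem (add_mem (h.d₁_mem _) (h.contr_mem _ _ (h.d₁_mem _)))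
      (h.contr_mem _ _ (h.d₁_mem _))) (h.contr_mem _ _ (h.contr_mem _ _ (h.d₁_mem _)))

theorem ins_ins_d₂ (ξ η : L₁) :
    d₂ * I ξ * I η + I ξ * d₂ * I η - I η * d₂ * I ξ - I η * I ξ * d₂ = 0 := by
  refine h.vanish₂ _ (fun x m hm => ?_) fun m => ?_
  · have := DFunLike.congr_fun (mul_secondOrder_eq_neg (add_comm _ _)
      ((add_comm _ _).trans (h.ins_contr ξ x)) ((add_comm _ _).trans (h.ins_contr η x))
      (h.lie₂_ins x ξ) (h.ins_ins _ _)) m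
    refine this.trans ?_
    exact neg_eq_zero.2 hm
  · exact sub_mem (sub_mem (add_mem (h.d₂_mem _) (h.ins_mem _ _ (h.d₂_mem _)))
      (h.ins_mem _ _ (h.d₂_mem _))) (h.ins_mem _ _ (h.ins_mem _ _ (h.d₂_mem _)))

/-- The total bracket enters here, as a derived bracket: the iterated commutator of `d₂ + d₁` with
two insertions is again an insertion. -/
theorem lie_iota (u v : L₂ × L₁) :
    ((d₂ + d₁) * (J u.1 + I u.2) + (J u.1 + I u.2) * (d₂ + d₁)) * (J v.1 + I v.2) =
      (J v.1 + I v.2) * ((d₂ + d₁) * (J u.1 + I u.2) + (J u.1 + I u.2) * (d₂ + d₁)) +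
        (J (⁅u.1, v.1⁆ + a₁₂ u.2 v.1 - a₁₂ v.2 u.1) +
          I (⁅u.2, v.2⁆ + a₂₁ u.1 v.2 - a₂₁ v.1 u.2)) := by
  rw [h.contr_sub, h.contr_add, h.ins_sub, h.ins_add]
  exact secondOrder_total (h.lie₂_contr u.1 v.1) (h.lie₂_ins u.1 v.2)
    (h.lie₂_ins v.1 u.2) (h.ins_ins_d₂ u.2 v.2) (h.lie₁_ins u.2 v.2)
    (h.lie₁_contr u.2 v.1) (h.lie₁_contr v.2 u.1)
    (h.contr_contr_d₁ u.1 v.1) (h.ins_contr _ _) (h.ins_contr _ _)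

/-- If the brackets satisfy the Jacobi identity then `d₁ + d₂` has square zero, up to conditions in
bidegree `(0, 0)`. -/
theorem square_eq_zero (br : L₂ × L₁ → L₂ × L₁ → L₂ × L₁)
    (hbr : ∀ u v, br u v = (⁅u.1, v.1⁆ + a₁₂ u.2 v.1 - a₁₂ v.2 u.1,
      ⁅u.2, v.2⁆ + a₂₁ u.1 v.2 - a₂₁ v.1 u.2))
    (hJ : ∀ u v w, br u (br v w) = br (br u v) w + br v (br u w))
    (Lie : L₂ × L₁ → AddMonoid.End V)
    (hLie : ∀ u, (d₂ + d₁) * (J u.1 + I u.2) + (J u.1 + I u.2) * (d₂ + d₁) = Lie u)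
    (h₀ : ∀ u v m, (Lie u * Lie v - Lie v * Lie u - Lie (br u v)) m ∈ P₀)
    (h₁ : ∀ u m, ((d₂ + d₁) * Lie u - Lie u * (d₂ + d₁)) m ∈ P₀)
    (h₂ : ∀ m, ((d₂ + d₁) * (d₂ + d₁)) m ∈ P₀) :
    (d₂ + d₁) * (d₂ + d₁) = 0 := by
  have hl : ∀ u v, Lie u * (J v.1 + I v.2) = (J v.1 + I v.2) * Lie u +
      (J (br u v).1 + I (br u v).2) := by
    intro u v
    rw [← hLie, hbr]
    exact h.lie_iota u v
  -- Three applications of the vanishing principle, each feeding the next. The Jacobi identity makes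
  -- the curvature commute with insertions; its vanishing makes `[d, Lie u]` anticommute with them;
  -- the vanishing of that makes `d²` commute with them.
  have hc : ∀ u v, Lie u * Lie v - Lie v * Lie u - Lie (br u v) = 0 := by
    intro u v
    refine h.vanish _ (fun w m hm => ?_) (h₀ u v)
    rw [← hm]
    refine (DFunLike.congr_fun (commutator_mul_eq (hl v w) (hl u w) (hl u (br v w))
      (hl v (br u w)) (hl (br u v) w) ?_) m).symm
    rw [hJ u v w, Prod.fst_add, Prod.snd_add, h.contr_add, h.ins_add]
    abel
  have hd : ∀ u, (d₂ + d₁) * Lie u - Lie u * (d₂ + d₁) = 0 := by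
    intro u
    refine h.vanish _ (fun w m hm => ?_) (h₁ u)
    have := DFunLike.congr_fun (anticommutator_lie_eq_zero (hLie w) (hLie _) (hl u w) (hc u w)) m
    exact neg_eq_zero.1 (this.symm.trans hm)
  refine h.vanish _ (fun w m hm => ?_) h₂
  rw [← hm]
  exact (DFunLike.congr_fun (square_mul_eq (hLie w) (hd w)) m).symm

end IsInsertionCalculus

namespace IsInsertionCalculus

variable {V L₁ L₂ : Type*} [AddCommGroup V] [LieRing L₁] [LieRing L₂]
  {a₁₂ : L₁ → L₂ → L₂} {a₂₁ : L₂ → L₁ → L₁} {d₁ d₂ : AddMonoid.End V}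
  {I : L₁ → AddMonoid.End V} {J : L₂ → AddMonoid.End V} {P₁ P₂ P₀ : AddSubgroup V}

/-- `square_eq_zero`, expressed through maps rather than through the endomorphism ring. -/
theorem square_apply_eq_zero (h : IsInsertionCalculus a₁₂ a₂₁ d₁ d₂ I J P₁ P₂ P₀)
    (br : L₂ × L₁ → L₂ × L₁ → L₂ × L₁)
    (hbr : ∀ u v, br u v = (⁅u.1, v.1⁆ + a₁₂ u.2 v.1 - a₁₂ v.2 u.1,
      ⁅u.2, v.2⁆ + a₂₁ u.1 v.2 - a₂₁ v.1 u.2))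
    (hJ : ∀ u v w, br u (br v w) = br (br u v) w + br v (br u w))
    (d : V → V) (hd : ∀ m, d m = d₂ m + d₁ m)
    (i : L₂ × L₁ → V → V) (hi : ∀ u m, i u m = J u.1 m + I u.2 m)
    (lie : L₂ × L₁ → V → V) (hlie : ∀ u m, lie u m = d (i u m) + i u (d m))
    (h₀ : ∀ u v m, lie u (lie v m) - lie v (lie u m) - lie (br u v) m ∈ P₀)
    (h₁ : ∀ u m, d (lie u m) - lie u (d m) ∈ P₀)
    (h₂ : ∀ m, d (d m) ∈ P₀) (m : V) : d (d m) = 0 := by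
  let Lie : L₂ × L₁ → AddMonoid.End V := fun u =>
    (d₂ + d₁) * (J u.1 + I u.2) + (J u.1 + I u.2) * (d₂ + d₁)
  obtain rfl : d = fun m => (d₂ + d₁) m := funext hd
  obtain rfl : i = fun u m => (J u.1 + I u.2) m := funext fun u => funext (hi u)
  obtain rfl : lie = fun u m => Lie u m := funext fun u => funext (hlie u)
  exact DFunLike.congr_fun (h.square_eq_zero br hbr hJ Lie (fun _ => rfl) h₀ h₁ h₂) m

end IsInsertionCalculus

/-! ### The calculus of a twilled algebra, and the square of the total operator. -/

namespace MixedForms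

variable {A L₁ L₂ : Type*} [CommRing A] [AddCommGroup L₁] [Module A L₁]
  [AddCommGroup L₂] [Module A L₂]

theorem contr_add_left (ξ η : L₂) (m : MixedForms A L₁ L₂) :
    BiForms.contr (ξ + η) m = BiForms.contr ξ m + BiForms.contr η m := by
  refine ext_apply fun q k => ?_
  rw [DirectSum.add_apply, contr_apply, contr_apply, contr_apply]
  refine Eq.trans ?_ (smul_add _ _ _)
  congr 1
  exact (m (q + 1, k)).curryLeftLinearMap.map_add ξ η

theorem ins_add_left (x y : L₁) (m : MixedForms A L₁ L₂) :
    ins (x + y) m = ins x m + ins y m := by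
  refine ext_apply fun q k => ?_
  rw [DirectSum.add_apply, ins_apply, ins_apply, ins_apply]
  refine Eq.trans ?_ (smul_add _ _ _)
  congr 1
  ext v w
  exact (congrFun (congrArg DFunLike.coe ((m (q, k + 1) v).curryLeftLinearMap.map_add x y)) w)

theorem contr_zero_left (m : MixedForms A L₁ L₂) : BiForms.contr 0 m = 0 := by
  have h := contr_add_left 0 0 m
  rw [add_zero] at h
  exact left_eq_add.1 h

theorem ins_zero_left (m : MixedForms A L₁ L₂) : ins 0 m = 0 := by
  have h := ins_add_left 0 0 m
  rw [add_zero] at h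
  exact left_eq_add.1 h

theorem insVal_zero {q k : ℕ} (x : L₁) :
    insVal x (0 : L₂ [⋀^Fin q]→ₗ[A] (L₁ [⋀^Fin (k + 1)]→ₗ[A] A)) = 0 := rfl

/-- The forms whose components with index in `S` vanish. -/
def vanishing (A L₁ L₂ : Type*) [CommRing A] [AddCommGroup L₁] [Module A L₁]
    [AddCommGroup L₂] [Module A L₂] (S : Set (ℕ × ℕ)) : AddSubgroup (MixedForms A L₁ L₂) where
  carrier := {m | ∀ d ∈ S, m d = 0}
  add_mem' := fun {a b} ha hb d hd => by rw [DirectSum.add_apply, ha d hd, hb d hd, add_zero]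
  zero_mem' := fun _ _ => rfl
  neg_mem' := fun {a} ha d hd => by
    have h : (-a) d = -(a d) := rfl
    refine h.trans ?_
    rw [ha d hd]
    exact neg_zero (G := L₂ [⋀^Fin d.1]→ₗ[A] (L₁ [⋀^Fin d.2]→ₗ[A] A))

theorem mem_vanishing_singleton {d : ℕ × ℕ} {m : MixedForms A L₁ L₂} (h : m d = 0) :
    m ∈ vanishing A L₁ L₂ {d} := by
  rintro _ rfl
  exact h

end MixedForms

namespace AlmostTwilled

variable {R A L₁ L₂ : Type*} [CommRing R] [CommRing A] [Algebra R A]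
  [LieRing L₁] [LieAlgebra R L₁] [Module A L₁] [LieRingModule L₁ A] [LieRinehartRing A L₁]
  [LieRinehartAlgebra R A L₁]
  [LieRing L₂] [LieAlgebra R L₂] [Module A L₂] [LieRingModule L₂ A] [LieRinehartRing A L₂]
  [LieRinehartAlgebra R A L₂]

local notation "ofW" => BiForms.of (A := A) (L := L₂) (M := fun k => L₁ [⋀^Fin k]→ₗ[A] A)

/-- The vanishing axioms are inductions on the degree of the argument of `Z`: insertions into the
value of `Z` are controlled by values of `Z` in lower degree, or by `Z 0` at the start, and a form
is determined by its insertions together with the component that they do not see. -/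
theorem isInsertionCalculus (T : AlmostTwilled R A L₁ L₂) (α : L₁ →ₗ[A] A) :
    IsInsertionCalculus (V := MixedForms A L₁ L₂) (fun x ξ => T.act₁₂.toEnd x ξ)
      (fun ξ x => T.act₂₁.toEnd ξ x) (T.dPrime α).toAddMonoidHom T.dMixed.toAddMonoidHom
      (fun x => (MixedForms.ins x).toAddMonoidHom) (fun ξ => (BiForms.contr ξ).toAddMonoidHom)
      (MixedForms.vanishing A L₁ L₂ {d | d.2 = 0}) (MixedForms.vanishing A L₁ L₂ {d | d.1 = 0})
      (MixedForms.vanishing A L₁ L₂ {(0, 0)}) where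
  ins_add x y := AddMonoidHom.ext fun m => MixedForms.ins_add_left x y m
  contr_add x y := AddMonoidHom.ext fun m => MixedForms.contr_add_left x y m
  ins_contr x ξ := AddMonoidHom.ext fun m => add_eq_zero_iff_eq_neg.2 (MixedForms.ins_contr x ξ m)
  ins_ins x y := AddMonoidHom.ext fun m => add_eq_zero_iff_eq_neg.2 (MixedForms.ins_ins x y m)
  contr_contr x y := AddMonoidHom.ext fun m =>
    add_eq_zero_iff_eq_neg.2 (MixedForms.contr_contr x y m)
  lie₂_contr ξ η := AddMonoidHom.ext fun m => LinearMap.congr_fun (T.opLie₂_mul_opContr ξ η) m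
  lie₂_ins ξ y := AddMonoidHom.ext fun m => LinearMap.congr_fun (T.opLie₂_mul_opIns ξ y) m
  lie₁_ins x y := AddMonoidHom.ext fun m => LinearMap.congr_fun (T.opLie₁_mul_opIns α x y) m
  lie₁_contr x η := AddMonoidHom.ext fun m => LinearMap.congr_fun (T.opLie₁_mul_opContr α x η) m
  d₁_mem m := by
    rintro ⟨q, _⟩ rfl
    exact T.dPrime_apply_zero α m q
  contr_mem ξ m hm := by
    rintro ⟨q, _⟩ rfl
    refine (MixedForms.contr_apply ξ m q 0).trans ?_
    rw [hm (q + 1, 0) rfl, AlternatingMap.curryLeft_zero, LinearMap.zero_apply, smul_zero]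
  d₂_mem m := by
    rintro ⟨_, k⟩ rfl
    exact T.dMixed_apply_zero m k
  ins_mem x m hm := by
    rintro ⟨_, k⟩ rfl
    refine (MixedForms.ins_apply x m 0 k).trans ?_
    rw [hm (0, k + 1) rfl, MixedForms.insVal_zero, smul_zero]
  vanish₁ Z h h₀ := by
    have key : ∀ k q (f : L₂ [⋀^Fin q]→ₗ[A] (L₁ [⋀^Fin k]→ₗ[A] A)), Z (ofW q k f) = 0 := by
      intro k
      induction k with
      | zero =>
        intro q f
        refine MixedForms.ext_apply fun r s => ?_
        rcases s with _ | s
        · exact h₀ _ (r, 0) rfl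
        · refine MixedForms.apply_eq_zero_of_ins _ (fun x => h x _ ?_) r s
          change Z (MixedForms.ins x (ofW q 0 f)) = 0
          rw [MixedForms.ins_of_zero, map_zero]
      | succ k ih =>
        intro q f
        refine MixedForms.ext_apply fun r s => ?_
        rcases s with _ | s
        · exact h₀ _ (r, 0) rfl
        · refine MixedForms.apply_eq_zero_of_ins _ (fun x => h x _ ?_) r s
          change Z (MixedForms.ins x (ofW q (k + 1) f)) = 0
          rw [MixedForms.ins_of_succ, map_zsmul, ih, smul_zero]
    exact BiForms.addHom_ext fun q k f => key k q f
  vanish₂ Z h h₀ := by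
    have key : ∀ q k (f : L₂ [⋀^Fin q]→ₗ[A] (L₁ [⋀^Fin k]→ₗ[A] A)), Z (ofW q k f) = 0 := by
      intro q
      induction q with
      | zero =>
        intro k f
        refine MixedForms.ext_apply fun r s => ?_
        rcases r with _ | r
        · exact h₀ _ (0, s) rfl
        · refine MixedForms.apply_eq_zero_of_contr _ (fun x => h x _ ?_) r s
          change Z (BiForms.contr x (ofW 0 k f)) = 0
          rw [MixedForms.contr_of_zero, map_zero]
      | succ q ih =>
        intro k f
        refine MixedForms.ext_apply fun r s => ?_
        rcases r with _ | r
        · exact h₀ _ (0, s) rfl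
        · refine MixedForms.apply_eq_zero_of_contr _ (fun x => h x _ ?_) r s
          change Z (BiForms.contr x (ofW (q + 1) k f)) = 0
          rw [MixedForms.contr_of_succ, map_zsmul, ih, smul_zero]
    exact BiForms.addHom_ext fun q k f => key q k f
  vanish Z h h₀ := by
    have h₁ : ∀ (x : L₁) m, Z (MixedForms.ins x m) = 0 → MixedForms.ins x (Z m) = 0 := by
      intro x m hm
      have e : ∀ m : MixedForms A L₁ L₂, BiForms.contr (0 : L₂) m + MixedForms.ins x m =
        MixedForms.ins x m := fun m => by rw [MixedForms.contr_zero_left, zero_add]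
      rw [← e]
      refine h (0, x) m ?_
      change Z (BiForms.contr (0 : L₂) m + MixedForms.ins x m) = 0
      rw [e, hm]
    have h₂ : ∀ (ξ : L₂) m, Z (BiForms.contr ξ m) = 0 → BiForms.contr ξ (Z m) = 0 := by
      intro ξ m hm
      have e : ∀ m : MixedForms A L₁ L₂, BiForms.contr ξ m + MixedForms.ins (0 : L₁) m =
        BiForms.contr ξ m := fun m => by rw [MixedForms.ins_zero_left, add_zero]
      rw [← e]
      refine h (ξ, 0) m ?_
      change Z (BiForms.contr ξ m + MixedForms.ins (0 : L₁) m) = 0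
      rw [e, hm]
    have key : ∀ N q k (f : L₂ [⋀^Fin q]→ₗ[A] (L₁ [⋀^Fin k]→ₗ[A] A)), q + k = N →
        Z (ofW q k f) = 0 := by
      intro N
      induction N with
      | zero =>
        intro q k f hN
        obtain rfl : q = 0 := by omega
        obtain rfl : k = 0 := by omega
        refine MixedForms.eq_zero_of_ins_of_contr _ (fun x => h₁ _ _ ?_) (fun ξ => h₂ _ _ ?_)
          (h₀ _ (0, 0) rfl)
        · rw [MixedForms.ins_of_zero, map_zero]
        · rw [MixedForms.contr_of_zero, map_zero]
      | succ N ih =>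
        intro q k f hN
        refine MixedForms.eq_zero_of_ins_of_contr _ (fun x => h₁ _ _ ?_) (fun ξ => h₂ _ _ ?_)
          (h₀ _ (0, 0) rfl)
        · rcases k with _ | k
          · rw [MixedForms.ins_of_zero, map_zero]
          · rw [MixedForms.ins_of_succ, map_zsmul, ih _ _ _ (by omega), smul_zero]
        · rcases q with _ | q
          · rw [MixedForms.contr_of_zero, map_zero]
          · rw [MixedForms.contr_of_succ, map_zsmul, ih _ _ _ (by omega), smul_zero]
    exact BiForms.addHom_ext fun q k f => key _ q k f rfl

theorem opLie₂_apply_zero (T : AlmostTwilled R A L₁ L₂) (ξ : L₂) (m : MixedForms A L₁ L₂) :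
    T.opLie₂ ξ m (0, 0) ![] ![] = ⁅ξ, m (0, 0) ![] ![]⁆ := by
  induction m using BiForms.induction with
  | zero => rw [map_zero]; exact (lie_zero ξ).symm
  | add m m' h h' =>
    rw [map_add]
    exact (congrArg₂ (· + ·) h h').trans (lie_add ξ _ _).symm
  | of q k f =>
    rw [opLie₂_of]
    by_cases hd : (q, k) = (0, 0)
    · obtain ⟨rfl, rfl⟩ := Prod.mk.inj hd
      rw [MixedForms.of_apply_same, MixedForms.of_apply_same, LRConnection.lieD_apply,
        AlternatingMap.sub_apply, alt_toEnd_apply]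
      simp [ofForm_toEnd_apply]
    · rw [MixedForms.of_apply_ne _ hd, MixedForms.of_apply_ne _ hd]
      exact (lie_zero ξ).symm

theorem opLie₁_apply_zero (T : AlmostTwilled R A L₁ L₂) (α : L₁ →ₗ[A] A) (x : L₁)
    (m : MixedForms A L₁ L₂) : T.opLie₁ α x m (0, 0) ![] ![] =
      ⁅x, m (0, 0) ![] ![]⁆ - α x * m (0, 0) ![] ![] := by
  induction m using BiForms.induction with
  | zero =>
    rw [map_zero]
    change (0 : A) = ⁅x, (0 : A)⁆ - α x * (0 : A)
    rw [lie_zero, mul_zero, sub_zero]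
  | add m m' h h' =>
    rw [map_add, DirectSum.add_apply, DirectSum.add_apply]
    refine (congrArg₂ (· + ·) h h').trans ?_
    change _ = ⁅x, m (0, 0) ![] ![] + m' (0, 0) ![] ![]⁆ - α x * (m (0, 0) ![] ![] + m' (0, 0) ![] ![])
    rw [lie_add]
    ring
  | of q k f =>
    rw [opLie₁_of]
    by_cases hd : (q, k) = (0, 0)
    · obtain ⟨rfl, rfl⟩ := Prod.mk.inj hd
      rw [MixedForms.of_apply_same, MixedForms.of_apply_same]
      change (T.conn₁ α 0).lieD x (altFlip A 0 0 f) ![] ![] = _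
      rw [LRConnection.lieD_apply,
        AlternatingMap.sub_apply, alt_toEnd_apply]
      simp [ofForm_toEnd_apply, altFlip]
    · rw [MixedForms.of_apply_ne _ hd, MixedForms.of_apply_ne _ hd]
      change (0 : A) = ⁅x, (0 : A)⁆ - α x * (0 : A)
      rw [lie_zero, mul_zero, sub_zero]


/-- The total operator `d'' + d'_α`. -/
noncomputable def dTotal (T : AlmostTwilled R A L₁ L₂) (α : L₁ →ₗ[A] A) (m : MixedForms A L₁ L₂) :
    MixedForms A L₁ L₂ := T.dMixed m + T.dPrime α m

/-- Insertion of an element of `L₂ ⊕ L₁`. -/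
noncomputable def iota (_T : AlmostTwilled R A L₁ L₂) (u : L₂ × L₁) (m : MixedForms A L₁ L₂) :
    MixedForms A L₁ L₂ := BiForms.contr u.1 m + MixedForms.ins u.2 m

theorem dTotal_apply_zero (T : AlmostTwilled R A L₁ L₂) (α : L₁ →ₗ[A] A) (m : MixedForms A L₁ L₂) :
    T.dTotal α m (0, 0) = 0 := by
  rw [dTotal, DirectSum.add_apply, dMixed_apply_zero, dPrime_apply_zero, add_zero]

/-- Only the components of bidegree `(1, 0)` and `(0, 1)` can be inserted into. For the square they
arise from the component `(0, 0)` of a value of the total operator, which is zero. -/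
theorem iota_dTotal_dTotal_apply_zero (T : AlmostTwilled R A L₁ L₂) (α : L₁ →ₗ[A] A) (u : L₂ × L₁)
    (m : MixedForms A L₁ L₂) : T.iota u (T.dTotal α (T.dTotal α m)) (0, 0) = 0 := by
  have h1 : T.dTotal α (T.dTotal α m) (0 + 1, 0) = 0 := by
    rw [dTotal, DirectSum.add_apply, dMixed_apply_succ_eq_zero _ _ _ _ (T.dTotal_apply_zero α m),
      dPrime_apply_zero, add_zero]
  have h2 : T.dTotal α (T.dTotal α m) (0, 0 + 1) = 0 := by
    rw [dTotal, DirectSum.add_apply, dMixed_apply_zero,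
      dPrime_apply_succ_eq_zero _ _ _ _ _ (T.dTotal_apply_zero α m), add_zero]
  rw [iota, DirectSum.add_apply, MixedForms.contr_apply, MixedForms.ins_apply, h1, h2,
    AlternatingMap.curryLeft_zero, LinearMap.zero_apply, smul_zero, zero_add,
    MixedForms.insVal_zero, smul_zero]

/-- The mixed anticommutators, `d''` with an insertion from `L₁` and `d'_α` with one from `L₂`, have
no component in bidegree `(0, 0)`. What remains is the action of the connection on `A`. -/
theorem lie_apply_zero (T : AlmostTwilled R A L₁ L₂) (α : L₁ →ₗ[A] A) (u : L₂ × L₁)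
    (m : MixedForms A L₁ L₂) :
    (T.dTotal α (T.iota u m) + T.iota u (T.dTotal α m)) (0, 0) ![] ![] =
      T.sumAnchor u (m (0, 0) ![] ![]) - α u.2 * m (0, 0) ![] ![] := by
  have h : T.dTotal α (T.iota u m) + T.iota u (T.dTotal α m) = T.opLie₂ u.1 m + T.opLie₁ α u.2 m +
      (T.dMixed (MixedForms.ins u.2 m) + MixedForms.ins u.2 (T.dMixed m)) +
      (T.dPrime α (BiForms.contr u.1 m) + BiForms.contr u.1 (T.dPrime α m)) := by
    change _ = (T.dMixed (BiForms.contr u.1 m) + BiForms.contr u.1 (T.dMixed m)) +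
      (T.dPrime α (MixedForms.ins u.2 m) + MixedForms.ins u.2 (T.dPrime α m)) + _ + _
    rw [dTotal, iota, iota, dTotal, map_add, map_add, map_add, map_add]
    abel
  have h1 : (T.dMixed (MixedForms.ins u.2 m) + MixedForms.ins u.2 (T.dMixed m)) (0, 0) = 0 := by
    rw [DirectSum.add_apply, dMixed_apply_zero, MixedForms.ins_apply, dMixed_apply_zero,
      MixedForms.insVal_zero, smul_zero, add_zero]
  have h2 : (T.dPrime α (BiForms.contr u.1 m) + BiForms.contr u.1 (T.dPrime α m)) (0, 0) = 0 := by
    rw [DirectSum.add_apply, dPrime_apply_zero, MixedForms.contr_apply, dPrime_apply_zero,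
      AlternatingMap.curryLeft_zero, LinearMap.zero_apply, smul_zero, add_zero]
  rw [h, DirectSum.add_apply, DirectSum.add_apply, DirectSum.add_apply, h1, h2, add_zero, add_zero]
  refine (congrArg₂ (· + ·) (T.opLie₂_apply_zero u.1 m) (T.opLie₁_apply_zero α u.2 m)).trans ?_
  rw [sumAnchor, add_sub_assoc]

/-- The Lie derivative with respect to an element of `L₂ ⊕ L₁`. -/
noncomputable def dLie (T : AlmostTwilled R A L₁ L₂) (α : L₁ →ₗ[A] A) (u : L₂ × L₁)
    (m : MixedForms A L₁ L₂) : MixedForms A L₁ L₂ :=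
  T.dTotal α (T.iota u m) + T.iota u (T.dTotal α m)

/-- Flatness of the connection on `A` over `L₂ ⊕ L₁`. Expanding, the terms in α form the exterior
derivative of α extended by zero to `L₂`: closedness handles two arguments from `L₁`, invariance the
mixed ones. -/
theorem sumAnchor_sub_commutator (T : AlmostTwilled R A L₁ L₂) (hT : T.IsTwilled) {α : L₁ →ₗ[A] A}
    (hα : T.IsClosedForm α) (hα' : T.IsInvariantForm α) (u v : L₂ × L₁) (a : A) :
    (T.sumAnchor u (T.sumAnchor v a - α v.2 * a) - α u.2 * (T.sumAnchor v a - α v.2 * a)) -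
      (T.sumAnchor v (T.sumAnchor u a - α u.2 * a) - α v.2 * (T.sumAnchor u a - α u.2 * a)) -
      (T.sumAnchor (T.sumBracket u v) a - α (T.sumBracket u v).2 * a) = 0 := by
  rw [hT.anchor_lie]
  obtain ⟨ξ, x⟩ := u
  obtain ⟨η, y⟩ := v
  have h1 := hα x y
  have h2 := hα' ξ y
  have h3 := hα' η x
  simp only [sumAnchor, sumBracket, lie_sub, lie_add, map_sub, map_add,
    LieRinehartRing.leibniz_mul_right, ← h2, ← h3, smul_eq_mul]
  linear_combination (-a) * h1

theorem dLie_commutator_apply_zero (T : AlmostTwilled R A L₁ L₂) (hT : T.IsTwilled)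
    {α : L₁ →ₗ[A] A} (hα : T.IsClosedForm α) (hα' : T.IsInvariantForm α) (u v : L₂ × L₁)
    (m : MixedForms A L₁ L₂) :
    (T.dLie α u (T.dLie α v m) - T.dLie α v (T.dLie α u m) -
      T.dLie α (T.sumBracket u v) m) (0, 0) = 0 := by
  ext v₀ w₀
  obtain rfl : v₀ = ![] := Subsingleton.elim _ _
  obtain rfl : w₀ = ![] := Subsingleton.elim _ _
  have e : ∀ u m, T.dLie α u m (0, 0) ![] ![] =
    T.sumAnchor u (m (0, 0) ![] ![]) - α u.2 * m (0, 0) ![] ![] := T.lie_apply_zero α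
  have h := T.sumAnchor_sub_commutator hT hα hα' u v (m (0, 0) ![] ![])
  rw [← e, ← e, ← e, ← e, ← e] at h
  exact h

theorem dTotal_dTotal (T : AlmostTwilled R A L₁ L₂) (hT : T.IsTwilled) {α : L₁ →ₗ[A] A}
    (hα : T.IsClosedForm α) (hα' : T.IsInvariantForm α) (m : MixedForms A L₁ L₂) :
    T.dTotal α (T.dTotal α m) = 0 := by
  refine (T.isInsertionCalculus α).square_apply_eq_zero T.sumBracket (fun _ _ => rfl) hT.jacobi
    (T.dTotal α) (fun _ => rfl) T.iota (fun _ _ => rfl) (T.dLie α) (fun _ _ => rfl)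
    (fun u v m => MixedForms.mem_vanishing_singleton (T.dLie_commutator_apply_zero hT hα hα' u v m))
    (fun u m => MixedForms.mem_vanishing_singleton ?_)
    (fun m => MixedForms.mem_vanishing_singleton (T.dTotal_apply_zero α _)) m
  -- Every term except the last is a value of the total operator, so its component in bidegree `(0,
  -- 0)` is zero; the last one is covered by `iota_dTotal_dTotal_apply_zero`.
  change (T.dTotal α (T.dTotal α (T.iota u m) + T.iota u (T.dTotal α m)) -
    (T.dTotal α (T.iota u (T.dTotal α m)) + T.iota u (T.dTotal α (T.dTotal α m)))) (0, 0) = 0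
  rw [DirectSum.sub_apply, DirectSum.add_apply, dTotal_apply_zero, dTotal_apply_zero,
    iota_dTotal_dTotal_apply_zero, add_zero]
  exact sub_self (0 : L₂ [⋀^Fin 0]→ₗ[A] (L₁ [⋀^Fin 0]→ₗ[A] A))

/-- On a component of bidegree `(q, k)` the square of the total operator splits into parts of the
distinct bidegrees `(q + 2, k)`, `(q + 1, k + 1)` and `(q, k + 2)`, so each part vanishes. -/
theorem dPrime_dPrime_and_dMixed_dPrime (T : AlmostTwilled R A L₁ L₂) (hT : T.IsTwilled) {α : L₁ →ₗ[A] A}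
    (hα : T.IsClosedForm α) (hα' : T.IsInvariantForm α) (m : MixedForms A L₁ L₂) :
    T.dPrime α (T.dPrime α m) = 0 ∧ T.dMixed (T.dPrime α m) + T.dPrime α (T.dMixed m) = 0 := by
  induction m using BiForms.induction with
  | zero => simp only [map_zero, add_zero, and_self]
  | add m m' h h' =>
    refine ⟨by rw [map_add, map_add, h.1, h'.1, add_zero], ?_⟩
    rw [map_add, map_add, map_add, map_add, add_add_add_comm, h.2, h'.2, add_zero]
  | of q k f =>
    have h := T.dTotal_dTotal hT hα hα' (ofW q k f)
    replace h : T.dMixed (T.dMixed (ofW q k f) + T.dPrime α (ofW q k f)) +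
      T.dPrime α (T.dMixed (ofW q k f) + T.dPrime α (ofW q k f)) = 0 := h
    obtain ⟨a, ha⟩ : ∃ a, T.dPrime α (T.dPrime α (ofW q k f)) = ofW q (k + 1 + 1) a := by
      rw [dPrime_of, map_zsmul, dPrime_of, ← MixedForms.of_zsmul, ← MixedForms.of_zsmul]
      exact ⟨_, rfl⟩
    obtain ⟨b, hb⟩ : ∃ b, T.dMixed (T.dMixed (ofW q k f)) = ofW (q + 1 + 1) k b := by
      rw [dMixed_of, map_zsmul, dMixed_of, ← MixedForms.of_zsmul, ← MixedForms.of_zsmul]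
      exact ⟨_, rfl⟩
    obtain ⟨c, hc⟩ : ∃ c, T.dMixed (T.dPrime α (ofW q k f)) + T.dPrime α (T.dMixed (ofW q k f)) =
        ofW (q + 1) (k + 1) c := by
      rw [dMixed_of, map_zsmul, dPrime_of, dPrime_of, map_zsmul, dMixed_of,
        ← MixedForms.of_zsmul, ← MixedForms.of_zsmul, ← MixedForms.of_zsmul, ← MixedForms.of_zsmul,
        ← MixedForms.of_add]
      exact ⟨_, rfl⟩
    have h' : ofW (q + 1 + 1) k b + ofW (q + 1) (k + 1) c + ofW q (k + 1 + 1) a = 0 := by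
      rw [← ha, ← hb, ← hc, ← h, map_add, map_add]
      abel
    constructor
    · have h1 : a = 0 := by
        have := congrArg (fun m : MixedForms A L₁ L₂ => m (q, k + 1 + 1)) h'
        simp only [DirectSum.add_apply] at this
        rwa [MixedForms.of_apply_same, MixedForms.of_apply_ne b (by simp only [ne_eq, Prod.mk.injEq]; omega),
          MixedForms.of_apply_ne c (by simp only [ne_eq, Prod.mk.injEq]; omega), zero_add, zero_add] at this
      rw [ha, h1, map_zero]
    · have h1 : c = 0 := by
        have := congrArg (fun m : MixedForms A L₁ L₂ => m (q + 1, k + 1)) h'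
        simp only [DirectSum.add_apply] at this
        rwa [MixedForms.of_apply_same, MixedForms.of_apply_ne b (by simp only [ne_eq, Prod.mk.injEq]; omega),
          MixedForms.of_apply_ne a (by simp only [ne_eq, Prod.mk.injEq]; omega), zero_add, add_zero] at this
      rw [hc, h1, map_zero]

end AlmostTwilled

/-! ### Multiplications and Lie derivatives seen through `flat`. -/

namespace PolyForms

variable {A L₁ L₂ : Type*} [CommRing A] [AddCommGroup L₁] [Module A L₁]
  [AddCommGroup L₂] [Module A L₂]

local notation "of₁₂" => BiForms.of (A := A) (L := L₂) (M := fun p => ⋀[A]^p L₁)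
local notation "ofW" => BiForms.of (A := A) (L := L₂) (M := fun k => L₁ [⋀^Fin k]→ₗ[A] A)

theorem shuffle_exteriorWedge_zero {p p' : ℕ} (h : 0 + p = p') (h' : p = p') {q r : ℕ}
    (b : L₂ [⋀^Fin r]→ₗ[A] A) (f : L₂ [⋀^Fin q]→ₗ[A] ⋀[A]^p L₁) :
    of₁₂ (r + q) p' (shuffle (exteriorWedge A L₁ h) r q ((LinearMap.toSpanSingleton A (⋀[A]^0 L₁)
      (exteriorPower.ιMulti A 0 ![])).compAlternatingMap b) f) =
    of₁₂ (r + q) p (shuffle (LinearMap.lsmul A (⋀[A]^p L₁)) r q b f) := by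
  subst h'
  congr 1
  ext v : 1
  simp only [shuffle_apply, domCoprod_apply_eq_sum, map_sum]
  refine Finset.sum_congr rfl fun c _ => ?_
  induction c using Quotient.inductionOn' with | _ σ
  simp only [summand_mk_apply, map_zsmul, TensorProduct.lift.tmul, LinearMap.lsmul_apply,
    LinearMap.compAlternatingMap_apply, LinearMap.toSpanSingleton_apply, map_smul,
    LinearMap.smul_apply]
  congr 2
  refine Subtype.ext ?_
  rw [coe_exteriorWedge]
  change ExteriorAlgebra.ιMulti A 0 (![] : Fin 0 → L₁) * _ = _
  rw [ExteriorAlgebra.ιMulti_zero_apply, one_mul]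

theorem ofForm_mul {r : ℕ} (b : L₂ [⋀^Fin r]→ₗ[A] A) (m : PolyForms A L₁ L₂) :
    mul (ofForm L₁ b) m = BiForms.act (BiForms.scalar r b) m := by
  induction m using BiForms.induction with
  | zero => rw [mul_zero', map_zero]
  | add a a' h h' => rw [mul_add, h, h', map_add]
  | of q p f =>
    rw [BiForms.act_of (M := fun p => ⋀[A]^p L₁), ofForm, mul_of_of, add_zero,
      shuffle_exteriorWedge_zero rfl (zero_add p).symm]

/-- The factor `x` is moved to the front past the `k` vectors `yᵢ`. -/
theorem contract_exteriorWedge {n p k : ℕ} (Ω : ⋀[A]^n L₁ →ₗ[A] A) (h : k + (1 + p) = n)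
    (h' : k + 1 + p = n) (x : L₁) (u : ⋀[A]^p L₁) :
    contract Ω h (exteriorWedge A L₁ rfl (exteriorPower.ιMulti A 1 ![x]) u) =
      (-1 : ℤ) ^ k • (contract Ω h' u).curryLeft x := by
  ext y
  rw [AlternatingMap.smul_apply, AlternatingMap.curryLeft_apply_apply, contract_apply,
    contract_apply, ← map_zsmul]
  congr 1
  refine Subtype.ext ?_
  have h1 := exteriorPower.coe_mul_comm (exteriorPower.ιMulti A k y) (exteriorPower.ιMulti A 1 ![x])
  rw [mul_one] at h1
  have h2 : (exteriorPower.ιMulti A (k + 1) (Matrix.vecCons x y) : ExteriorAlgebra A L₁) =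
      exteriorPower.ιMulti A 1 ![x] * exteriorPower.ιMulti A k y := by
    simp only [exteriorPower.ιMulti_apply_coe]
    rw [ExteriorAlgebra.ιMulti_succ_apply, ExteriorAlgebra.ιMulti_succ_apply]
    simp
  rw [coe_exteriorWedge, coe_exteriorWedge, ← mul_assoc, h1]
  change _ = (-1 : ℤ) ^ k • ((exteriorWedge A L₁ h' (exteriorPower.ιMulti A (k + 1)
    (Matrix.vecCons x y)) u : ⋀[A]^n L₁) : ExteriorAlgebra A L₁)
  rw [coe_exteriorWedge, h2, ← smul_mul_assoc]
  simp [mul_assoc]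

theorem ofVector_mul_of {q p : ℕ} (x : L₁) (f : L₂ [⋀^Fin q]→ₗ[A] ⋀[A]^p L₁) :
    mul (ofVector L₂ x) (of₁₂ q p f) = (-1 : ℤ) ^ q • of₁₂ q (1 + p)
      ((exteriorWedge A L₁ rfl (exteriorPower.ιMulti A 1 ![x])).compAlternatingMap f) := by
  rw [ofVector, mul_of_of, shuffle_zero_left, zero_add, one_mul]
  congr 1
  exact (BiForms.of_congr (M := fun p => ⋀[A]^p L₁) (1 + p) (Nat.zero_add q).symm _).symm

/-- This is `contract_exteriorWedge` with the signs of `mul` and `ins`, which differ by exactly one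
factor `-1`. For exterior degree `n` or more both sides vanish. -/
theorem flat_ofVector_mul {n : ℕ} (Ω : ⋀[A]^n L₁ →ₗ[A] A) (x : L₁) (m : PolyForms A L₁ L₂) :
    flat Ω (mul (ofVector L₂ x) m) = -MixedForms.ins x (flat Ω m) := by
  induction m using BiForms.induction with
  | zero => rw [mul_zero', map_zero, map_zero, neg_zero]
  | add a a' h h' => rw [mul_add, map_add, h, h', map_add, map_add, neg_add]
  | of q p f =>
    rw [ofVector_mul_of, map_zsmul]
    rcases lt_trichotomy p n with hp | rfl | hp
    · obtain ⟨k, rfl⟩ : ∃ k, n = k + 1 + p := ⟨n - p - 1, by omega⟩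
      rw [flat_of Ω (show k + (1 + p) = k + 1 + p by ring), flat_of Ω rfl, MixedForms.ins_of_succ]
      have h : (contract Ω (show k + (1 + p) = k + 1 + p by ring)).compAlternatingMap
          ((exteriorWedge A L₁ rfl (exteriorPower.ιMulti A 1 ![x])).compAlternatingMap f) =
          (-1 : ℤ) ^ k • MixedForms.insVal x ((contract Ω rfl).compAlternatingMap f) := by
        ext v : 1
        exact contract_exteriorWedge Ω _ rfl x (f v)
      rw [h, MixedForms.of_zsmul, smul_smul, ← neg_smul]
      congr 1
      ring
    · rw [flat_of_lt Ω (by omega), flat_of Ω (zero_add _), MixedForms.ins_of_zero, neg_zero,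
        smul_zero]
    · rw [flat_of_lt Ω (by omega), flat_of_lt Ω hp, smul_zero, map_zero, neg_zero]

end PolyForms

namespace AlmostTwilled

variable {R A L₁ L₂ : Type*} [CommRing R] [CommRing A] [Algebra R A]
  [LieRing L₁] [LieAlgebra R L₁] [Module A L₁] [LieRingModule L₁ A] [LieRinehartRing A L₁]
  [LieRinehartAlgebra R A L₁]
  [LieRing L₂] [LieAlgebra R L₂] [Module A L₂] [LieRingModule L₂ A] [LieRinehartRing A L₂]
  [LieRinehartAlgebra R A L₂]

local notation "ofW" => BiForms.of (A := A) (L := L₂) (M := fun k => L₁ [⋀^Fin k]→ₗ[A] A)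

/-- The action of `L₁` on `Alt^r(L₂, A)`. -/
noncomputable def actForm (T : AlmostTwilled R A L₁ L₂) {r : ℕ} (x : L₁)
    (b : L₂ [⋀^Fin r]→ₗ[A] A) : L₂ [⋀^Fin r]→ₗ[A] A :=
  (T.act₁₂.alt (LRConnection.ofForm R (0 : L₁ →ₗ[A] A)) r).toEnd x b

theorem actForm_eq (T : AlmostTwilled R A L₁ L₂) {r : ℕ} (x : L₁) (b : L₂ [⋀^Fin r]→ₗ[A] A) :
    T.actForm x b = altDerivation (fun a => ⁅x, a⁆)
      ((LRConnection.ofForm R (0 : L₁ →ₗ[A] A)).toEnd x).toAddMonoidHom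
      (T.act₁₂.toEnd x).toAddMonoidHom ((LRConnection.ofForm R (0 : L₁ →ₗ[A] A)).leibniz x)
      (T.act₁₂.leibniz x) b := rfl

theorem lieD_add {L M : Type*} [LieRing L] [LieAlgebra R L] [Module A L] [LieRingModule L A]
    [LieRinehartRing A L]
    [AddCommGroup M] [Module R M] [Module A M] [IsScalarTower R A M] (D : LRConnection R A L M)
    {q : ℕ} (x : L) (f g : L [⋀^Fin q]→ₗ[A] M) : D.lieD x (f + g) = D.lieD x f + D.lieD x g := by
  ext v
  simp only [LRConnection.lieD_apply, AlternatingMap.add_apply, map_add, Finset.sum_add_distrib]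
  abel

theorem lieD_smul {L M : Type*} [LieRing L] [LieAlgebra R L] [Module A L] [LieRingModule L A]
    [LieRinehartRing A L]
    [AddCommGroup M] [Module R M] [Module A M] [IsScalarTower R A M] (D : LRConnection R A L M)
    {q : ℕ} (x : L) (a : A) (f : L [⋀^Fin q]→ₗ[A] M) :
    D.lieD x (a • f) = a • D.lieD x f + ⁅x, a⁆ • f := by
  ext v
  simp only [LRConnection.lieD_apply, AlternatingMap.add_apply, AlternatingMap.smul_apply,
    D.leibniz, smul_sub, Finset.smul_sum]
  abel

/-- The Lie derivative on `Alt^k(L₁, A)`, as an additive map. -/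
noncomputable def lieHom (α : L₁ →ₗ[A] A) (x : L₁) (k : ℕ) :
    (L₁ [⋀^Fin k]→ₗ[A] A) →+ (L₁ [⋀^Fin k]→ₗ[A] A) :=
  AddMonoidHom.mk' ((LRConnection.ofForm R α).lieD x) (lieD_add _ x)

theorem lieHom_smul (α : L₁ →ₗ[A] A) (x : L₁) {k : ℕ} (a : A) (f : L₁ [⋀^Fin k]→ₗ[A] A) :
    lieHom (R := R) α x k (a • f) = a • lieHom (R := R) α x k f + ⁅x, a⁆ • f :=
  lieD_smul (LRConnection.ofForm R α) x a f

/-- The Lie derivative acts on both groups of arguments, and the groups may be treated in either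
order. Taking the Lie derivative on `Alt^k(L₁, A)` as the action on values leaves an `altDerivation`
in the arguments from `L₂`, to which `altDerivation_shuffle` applies. -/
theorem lieFlip_eq (T : AlmostTwilled R A L₁ L₂) (α : L₁ →ₗ[A] A) (x : L₁) {q k : ℕ}
    (f : L₂ [⋀^Fin q]→ₗ[A] (L₁ [⋀^Fin k]→ₗ[A] A)) : T.lieFlip α x f =
      altDerivation (fun a => ⁅x, a⁆) (lieHom (R := R) α x k) (T.act₁₂.toEnd x).toAddMonoidHom
        (lieHom_smul α x) (T.act₁₂.leibniz x) f := by
  ext v w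
  change ((T.conn₁ α q).toEnd x (altFlip A q k f w) -
    ∑ i, altFlip A q k f (update w i ⁅x, w i⁆)) v =
    ((LRConnection.ofForm R α).lieD x (f v) - ∑ i, f (update v i (T.act₁₂.toEnd x (v i)))) w
  rw [AlternatingMap.sub_apply, AlternatingMap.sub_apply, LRConnection.lieD_apply,
    AlternatingMap.finset_sum_apply, AlternatingMap.finset_sum_apply, alt_toEnd_apply]
  exact sub_right_comm _ _ _

theorem lieFlip_shuffle (T : AlmostTwilled R A L₁ L₂) (α : L₁ →ₗ[A] A) (x : L₁) {r q k : ℕ}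
    (b : L₂ [⋀^Fin r]→ₗ[A] A) (f : L₂ [⋀^Fin q]→ₗ[A] (L₁ [⋀^Fin k]→ₗ[A] A)) :
    T.lieFlip α x (shuffle (LinearMap.lsmul A (L₁ [⋀^Fin k]→ₗ[A] A)) r q b f) =
      shuffle (LinearMap.lsmul A (L₁ [⋀^Fin k]→ₗ[A] A)) r q (T.actForm x b) f +
      shuffle (LinearMap.lsmul A (L₁ [⋀^Fin k]→ₗ[A] A)) r q b (T.lieFlip α x f) := by
  rw [lieFlip_eq, lieFlip_eq, actForm_eq]
  refine altDerivation_shuffle _ _ _ _ _ _ _ _ _ _ (fun a g => ?_) b f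
  refine (lieD_smul (LRConnection.ofForm R α) x a g).trans ?_
  rw [add_comm]
  congr 2
  change _ = (LRConnection.ofForm R (0 : L₁ →ₗ[A] A)).toEnd x a
  rw [ofForm_toEnd_apply, LinearMap.zero_apply, zero_mul, sub_zero]

theorem opLie₁_act (T : AlmostTwilled R A L₁ L₂) (α : L₁ →ₗ[A] A) (x : L₁) {r : ℕ}
    (b : L₂ [⋀^Fin r]→ₗ[A] A) (m : MixedForms A L₁ L₂) :
    T.opLie₁ α x (BiForms.act (BiForms.scalar r b) m) =
      BiForms.act (BiForms.scalar r (T.actForm x b)) m +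
      BiForms.act (BiForms.scalar r b) (T.opLie₁ α x m) := by
  induction m using BiForms.induction with
  | zero => simp only [map_zero, add_zero]
  | add a a' h h' => simp only [map_add, h, h']; abel
  | of q k f =>
    rw [opLie₁_of, BiForms.act_of (M := fun k => L₁ [⋀^Fin k]→ₗ[A] A),
      BiForms.act_of (M := fun k => L₁ [⋀^Fin k]→ₗ[A] A),
      BiForms.act_of (M := fun k => L₁ [⋀^Fin k]→ₗ[A] A), map_zsmul, opLie₁_of, lieFlip_shuffle,
      MixedForms.of_add]
    exact smul_add _ _ _

end AlmostTwilled

/-! ### Generation of `Alt(L₂, Λ L₁)` by vectors and scalar forms. -/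

namespace PolyForms

variable {A L₁ L₂ : Type*} [CommRing A] [AddCommGroup L₁] [Module A L₁]
  [AddCommGroup L₂] [Module A L₂]

local notation "of₁₂" => BiForms.of (A := A) (L := L₂) (M := fun p => ⋀[A]^p L₁)

theorem one_eq_ofForm : (one : PolyForms A L₁ L₂) =
    ofForm L₁ (AlternatingMap.constOfIsEmpty A L₂ (Fin 0) (1 : A)) := by
  rw [one, ofForm]
  congr 1
  ext v : 1
  simp

theorem ofVector_mul_const {p : ℕ} (x : Fin (p + 1) → L₁) :
    mul (ofVector L₂ (x 0)) (of₁₂ 0 p (AlternatingMap.constOfIsEmpty A L₂ (Fin 0)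
      (exteriorPower.ιMulti A p (Fin.tail x)))) =
    of₁₂ 0 (p + 1) (AlternatingMap.constOfIsEmpty A L₂ (Fin 0) (exteriorPower.ιMulti A (p + 1) x)) := by
  rw [ofVector, mul_of_zero_of_zero]
  refine of_zero_eq (add_comm 1 p) _ _ ?_
  change ((exteriorWedge A L₁ rfl (exteriorPower.ιMulti A 1 ![x 0]) (exteriorPower.ιMulti A p
    (Fin.tail x)) : ⋀[A]^(1 + p) L₁) : ExteriorAlgebra A L₁) = exteriorPower.ιMulti A (p + 1) x
  rw [coe_exteriorWedge]
  simp only [exteriorPower.ιMulti_apply_coe]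
  rw [ExteriorAlgebra.ιMulti_succ_apply, ExteriorAlgebra.ιMulti_succ_apply]
  simp [Matrix.vecTail, Function.comp_def]
  rfl

theorem const_mul_ofForm {q p : ℕ} (u : ⋀[A]^p L₁) (b : L₂ [⋀^Fin q]→ₗ[A] A) :
    mul (of₁₂ 0 p (AlternatingMap.constOfIsEmpty A L₂ (Fin 0) u)) (ofForm L₁ b) =
      (-1 : ℤ) ^ (p * q) •
        of₁₂ q p ((LinearMap.toSpanSingleton A (⋀[A]^p L₁) u).compAlternatingMap b) := by
  rw [ofForm, mul_of_of, shuffle_zero_left, zero_add]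
  congr 1
  refine (BiForms.of_congr (M := fun p => ⋀[A]^p L₁) (p + 0) (Nat.zero_add q).symm _).symm.trans ?_
  change of₁₂ q p _ = _
  congr 1
  ext v : 1
  refine Subtype.ext ?_
  change (u : ExteriorAlgebra A L₁) * ((b v • exteriorPower.ιMulti A 0 (![] : Fin 0 → L₁) :
    ⋀[A]^0 L₁) : ExteriorAlgebra A L₁) = ((b v • u : ⋀[A]^p L₁) : ExteriorAlgebra A L₁)
  rw [Submodule.coe_smul, Submodule.coe_smul, exteriorPower.ιMulti_apply_coe,
    ExteriorAlgebra.ιMulti_zero_apply, mul_smul_comm, mul_one]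

/-- Λ^p of a retract of a free module is a retract of a free module: coordinates are taken after the
section, and the basis is pushed forward to decomposable elements by the retraction. -/
theorem exists_dual_basis [Module.Finite A L₁] [Module.Projective A L₁] (p : ℕ) :
    ∃ (m : ℕ) (c : Set.powersetCard (Fin m) p → ⋀[A]^p L₁ →ₗ[A] A)
      (x : Set.powersetCard (Fin m) p → Fin p → L₁),
      ∀ u, u = ∑ s, c s u • exteriorPower.ιMulti A p (x s) := by
  obtain ⟨m, π, σ, -, -, hπσ⟩ := Module.Finite.exists_comp_eq_id_of_projective A L₁
  let b := (Pi.basisFun A (Fin m)).exteriorPower p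
  refine ⟨m, fun s => b.coord s ∘ₗ exteriorPower.map p σ, fun s i => π (Pi.basisFun A (Fin m)
    (Set.powersetCard.ofFinEmbEquiv.symm s i)), fun u => ?_⟩
  have h1 : u = exteriorPower.map p π (exteriorPower.map p σ u) := by
    rw [← LinearMap.comp_apply, ← exteriorPower.map_comp, hπσ, exteriorPower.map_id]
    rfl
  nth_rw 1 [h1, ← b.sum_repr (exteriorPower.map p σ u)]
  rw [map_sum]
  refine Finset.sum_congr rfl fun s _ => ?_
  rw [map_smul, exteriorPower.basis_apply, exteriorPower.map_apply_ιMulti_family]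
  rfl

/-- An induction principle: the bihomogeneous elements are generated by the scalar forms and by the
elements of `L₁`. -/
theorem of_induction [Module.Finite A L₁] [Module.Projective A L₁]
    {motive : ℕ → PolyForms A L₁ L₂ → Prop}
    (form : ∀ r (b : L₂ [⋀^Fin r]→ₗ[A] A), motive r (ofForm L₁ b))
    (vector : ∀ x : L₁, motive 1 (ofVector L₂ x))
    (mul : ∀ (q p r s : ℕ) (f : L₂ [⋀^Fin q]→ₗ[A] ⋀[A]^p L₁) (g : L₂ [⋀^Fin r]→ₗ[A] ⋀[A]^s L₁),
      motive (q + p) (of₁₂ q p f) → motive (r + s) (of₁₂ r s g) →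
      motive (q + p + (r + s)) (mul (of₁₂ q p f) (of₁₂ r s g)))
    (add : ∀ i a b, motive i a → motive i b → motive i (a + b))
    (q p : ℕ) (f : L₂ [⋀^Fin q]→ₗ[A] ⋀[A]^p L₁) : motive (q + p) (of₁₂ q p f) := by
  have hm : ∀ (p : ℕ) (x : Fin p → L₁), motive (0 + p) (of₁₂ 0 p (AlternatingMap.constOfIsEmpty A L₂
      (Fin 0) (exteriorPower.ιMulti A p x))) := by
    intro p
    induction p with
    | zero =>
      intro x
      rw [Subsingleton.elim x ![]]
      have h := form 0 (AlternatingMap.constOfIsEmpty A L₂ (Fin 0) (1 : A))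
      rwa [← one_eq_ofForm] at h
    | succ p ih =>
      intro x
      have h : motive (0 + 1 + (0 + p)) (PolyForms.mul (ofVector L₂ (x 0)) (of₁₂ 0 p
          (AlternatingMap.constOfIsEmpty A L₂ (Fin 0) (exteriorPower.ιMulti A p (Fin.tail x))))) :=
        mul 0 1 0 p _ _ (vector (x 0)) (ih (Fin.tail x))
      rwa [ofVector_mul_const, show (0 + 1 + (0 + p)) = 0 + (p + 1) by ring] at h
  have hs : ∀ (b : L₂ [⋀^Fin q]→ₗ[A] A) (x : Fin p → L₁), motive (q + p) (of₁₂ q p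
      ((LinearMap.toSpanSingleton A (⋀[A]^p L₁) (exteriorPower.ιMulti A p x)).compAlternatingMap b)) := by
    intro b x
    -- The Koszul sign for exchanging the multivector and the form is absorbed into the form, since
    -- the motive is not assumed to be stable under negation.
    have h := const_mul_ofForm (exteriorPower.ιMulti A p x) ((-1 : ℤ) ^ (p * q) • b)
    have h' : (LinearMap.toSpanSingleton A (⋀[A]^p L₁) (exteriorPower.ιMulti A p x)).compAlternatingMap
        ((-1 : ℤ) ^ (p * q) • b) = (-1 : ℤ) ^ (p * q) • (LinearMap.toSpanSingleton A (⋀[A]^p L₁)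
          (exteriorPower.ιMulti A p x)).compAlternatingMap b := by
      ext v : 1
      exact map_zsmul (LinearMap.toSpanSingleton A (⋀[A]^p L₁) _) _ _
    rw [h', BiForms.of_zsmul (M := fun p => ⋀[A]^p L₁), neg_one_pow_smul_smul] at h
    rw [← h, show q + p = 0 + p + (q + 0) by ring]
    exact mul 0 p q 0 _ _ (hm p x) (form q _)
  obtain ⟨m, c, x, hu⟩ := exists_dual_basis (A := A) (L₁ := L₁) p
  have hf : f = ∑ s, (LinearMap.toSpanSingleton A (⋀[A]^p L₁)
      (exteriorPower.ιMulti A p (x s))).compAlternatingMap ((c s).compAlternatingMap f) := by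
    ext v : 1
    rw [AlternatingMap.finset_sum_apply]
    exact hu (f v)
  have h0 : motive (q + p) (of₁₂ q p 0) := by
    have := hs 0 0
    rwa [show (LinearMap.toSpanSingleton A (⋀[A]^p L₁)
      (exteriorPower.ιMulti A p 0)).compAlternatingMap (0 : L₂ [⋀^Fin q]→ₗ[A] A) = 0 by
        ext v : 1
        exact map_zero (LinearMap.toSpanSingleton A (⋀[A]^p L₁) _)] at this
  have key : ∀ S : Finset (Set.powersetCard (Fin m) p), motive (q + p) (of₁₂ q p
      (∑ s ∈ S, (LinearMap.toSpanSingleton A (⋀[A]^p L₁)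
      (exteriorPower.ιMulti A p (x s))).compAlternatingMap ((c s).compAlternatingMap f))) := by
    classical
    intro S
    induction S using Finset.induction_on with
    | empty => exact h0
    | insert s S hs' ih =>
      rw [Finset.sum_insert hs', BiForms.of_add (M := fun p => ⋀[A]^p L₁)]
      exact add _ _ _ (hs _ _) ih
  rw [hf]
  exact key Finset.univ

end PolyForms

/-! ### Second-order operators and the brackets which they generate. -/

section Ring

variable {E : Type*} [Ring E]

/-- The graded commutator `[[d, a], b]` of operators of parities `1`, `i` and `j`. -/
def gradedCommutator₂ (d a b : E) (i j : ℕ) : E :=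
  (d * a - (-1 : ℤ) ^ i • (a * d)) * b -
    (-1 : ℤ) ^ ((i + 1) * j) • (b * (d * a - (-1 : ℤ) ^ i • (a * d)))

/-- The operator `[[d, a], ·]` is a graded derivation of the endomorphism ring. -/
theorem gradedCommutator₂_mul (d a b b' : E) (i j j' : ℕ) :
    gradedCommutator₂ d a (b * b') i (j + j') = gradedCommutator₂ d a b i j * b' +
      (-1 : ℤ) ^ ((i + 1) * j) • (b * gradedCommutator₂ d a b' i j') := by
  rw [gradedCommutator₂, gradedCommutator₂, gradedCommutator₂, _root_.mul_add, pow_add]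
  generalize d * a - (-1 : ℤ) ^ i • (a * d) = δ
  rcases neg_one_pow_eq_or ℤ ((i + 1) * j) with h | h <;>
  rcases neg_one_pow_eq_or ℤ ((i + 1) * j') with h' | h' <;> rw [h, h'] <;> noncomm_ring

theorem gradedCommutator₂_add (d a b b' : E) (i j : ℕ) :
    gradedCommutator₂ d a (b + b') i j =
      gradedCommutator₂ d a b i j + gradedCommutator₂ d a b' i j := by
  rw [gradedCommutator₂, gradedCommutator₂, gradedCommutator₂]
  generalize d * a - (-1 : ℤ) ^ i • (a * d) = δ
  rcases neg_one_pow_eq_or ℤ ((i + 1) * j) with h | h <;> rw [h] <;> noncomm_ring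

/-- The graded Jacobi identity; the term with `[a, b]` is absent because `a` and `b` commute in the
graded sense. -/
theorem gradedCommutator₂_symm (d a b : E) (i j : ℕ) (h : a * b = (-1 : ℤ) ^ (i * j) • (b * a)) :
    gradedCommutator₂ d b a j i = (-1 : ℤ) ^ (i * j) • gradedCommutator₂ d a b i j := by
  rw [gradedCommutator₂, gradedCommutator₂, show (i + 1) * j = i * j + j by ring,
    show (j + 1) * i = i * j + i by ring, pow_add, pow_add]
  rcases neg_one_pow_eq_or ℤ (i * j) with hg | hg <;> rw [hg] at h ⊢ <;>
  rcases neg_one_pow_eq_or ℤ i with hi | hi <;> rw [hi] <;>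
  rcases neg_one_pow_eq_or ℤ j with hj | hj <;> rw [hj]
  · linear_combination (norm := noncomm_ring) (-1 : ℤ) • (d * h) + h * d
  · linear_combination (norm := noncomm_ring) (-1 : ℤ) • (d * h) - h * d
  · linear_combination (norm := noncomm_ring) (-1 : ℤ) • (d * h) - h * d
  · linear_combination (norm := noncomm_ring) (-1 : ℤ) • (d * h) + h * d
  · linear_combination (norm := noncomm_ring) d * h - h * d
  · linear_combination (norm := noncomm_ring) d * h + h * d
  · linear_combination (norm := noncomm_ring) d * h + h * d
  · linear_combination (norm := noncomm_ring) d * h - h * d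

/-- The Jacobi identity as a statement about operators. Here `A`, `B`, `A'`, `B'` are
multiplications by `a`, `b`, `D a`, `D b`, the letters `P`, `P'` are multiplications by the
deviation of `a`, `b` and by its image under `D`, and `s`, `t`, `g` are the signs `(-1)^i`,
`(-1)^j`, `(-1)^(i j)`. The operator `d A - s A d - A'` sends `c` to the deviation of `a` and `c`.
-/
theorem gradedCommutator₂_jacobi_aux (d A B A' B' P P' : E) (s t g : ℤ) (hs : s = 1 ∨ s = -1)
    (ht : t = 1 ∨ t = -1) (hg : g = 1 ∨ g = -1) (hd : d * d = 0)
    (hA'B : A' * B = (g * t) • (B * A')) (hA'B' : A' * B' = (-(g * s * t)) • (B' * A'))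
    (hP : (d * A - s • (A * d)) * B - (g * t) • (B * (d * A - s • (A * d))) = P)
    (hP' : P' = -((d * A' + s • (A' * d)) * B - g • (B * (d * A' + s • (A' * d)))) -
      s • ((d * A - s • (A * d)) * B' + (g * s * t) • (B' * (d * A - s • (A * d))))) :
    (s * t) • ((d * A - s • (A * d) - A') * (d * B - t • (B * d) - B')) =
      (-t) • (d * P + (s * t) • (P * d) - P') -
        g • ((d * B - t • (B * d) - B') * (d * A - s • (A * d) - A')) := by
  subst hP hP'
  rcases hs with rfl | rfl <;> rcases ht with rfl | rfl <;> rcases hg with rfl | rfl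
  · linear_combination (norm := noncomm_ring) hA'B * d + d * hA'B + hA'B' + hd * A * B
      + B * A * hd - A * hd * B - B * hd * A
  · linear_combination (norm := noncomm_ring) hA'B * d + d * hA'B + hA'B' + hd * A * B
      + B * hd * A - A * hd * B - B * A * hd
  · linear_combination (norm := noncomm_ring) hA'B * d + A * hd * B + B * hd * A - d * hA'B
      - hA'B' - hd * A * B - B * A * hd
  · linear_combination (norm := noncomm_ring) hA'B * d + A * hd * B + B * A * hd - d * hA'B
      - hA'B' - hd * A * B - B * hd * A
  · linear_combination (norm := noncomm_ring) d * hA'B + hd * A * B + B * A * hd - hA'B * d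
      - hA'B' - A * hd * B - B * hd * A
  · linear_combination (norm := noncomm_ring) d * hA'B + hd * A * B + B * hd * A - hA'B * d
      - hA'B' - A * hd * B - B * A * hd
  · linear_combination (norm := noncomm_ring) hA'B' + A * hd * B + B * hd * A - hA'B * d
      - d * hA'B - hd * A * B - B * A * hd
  · linear_combination (norm := noncomm_ring) hA'B' + A * hd * B + B * A * hd - hA'B * d
      - d * hA'B - hd * A * B - B * hd * A

end Ring

/-- The product and the unit of a graded commutative algebra; `H i` are the elements of degree `i`. -/
structure IsGradedCommMul {V : Type*} [AddCommGroup V] (μ : V →+ V →+ V) (u : V)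
    (H : ℕ → V → Prop) : Prop where
  assoc : ∀ a b c, μ (μ a b) c = μ a (μ b c)
  mul_unit : ∀ a, μ a u = a
  comm : ∀ i j a b, H i a → H j b → μ a b = (-1 : ℤ) ^ (i * j) • μ b a

section Operators

variable {V : Type*} [AddCommGroup V]

/-- Multiplication by an element, as an element of the ring of endomorphisms. -/
def mulEnd (μ : V →+ V →+ V) (a : V) : AddMonoid.End V := μ a

/-- The deviation of `D` from being a derivation. -/
def deviation (μ : V →+ V →+ V) (D : AddMonoid.End V) (i : ℕ) (a b : V) : V :=
  D (μ a b) - μ (D a) b - (-1 : ℤ) ^ i • μ a (D b)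

/-- The second commutator of `D` with multiplications by `a` and `b` is the multiplication by an
element. -/
def IsSecondOrderAt (μ : V →+ V →+ V) (D : AddMonoid.End V) (i : ℕ) (a : V) (j : ℕ) (b : V) : Prop :=
  ∃ c, gradedCommutator₂ D (mulEnd μ a) (mulEnd μ b) i j = mulEnd μ c

variable {μ : V →+ V →+ V} {u : V} {H : ℕ → V → Prop} {D : AddMonoid.End V}

theorem mulEnd_mul (h : IsGradedCommMul μ u H) (a b : V) :
    mulEnd μ (μ a b) = mulEnd μ a * mulEnd μ b := AddMonoidHom.ext (h.assoc a b)

theorem mulEnd_comm (h : IsGradedCommMul μ u H) {i j : ℕ} {a b : V} (ha : H i a) (hb : H j b) :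
    mulEnd μ a * mulEnd μ b = (-1 : ℤ) ^ (i * j) • (mulEnd μ b * mulEnd μ a) := by
  rw [← mulEnd_mul h, ← mulEnd_mul h, h.comm i j a b ha hb]
  exact map_zsmul μ _ _

theorem mulEnd_add (a b : V) : mulEnd μ (a + b) = mulEnd μ a + mulEnd μ b := map_add μ a b

theorem mulEnd_sub (a b : V) : mulEnd μ (a - b) = mulEnd μ a - mulEnd μ b := map_sub μ a b

theorem mulEnd_neg (a : V) : mulEnd μ (-a) = -mulEnd μ a := map_neg μ a

theorem mulEnd_zsmul (c : ℤ) (a : V) : mulEnd μ (c • a) = c • mulEnd μ a := map_zsmul μ c a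

theorem IsSecondOrderAt.mul (h : IsGradedCommMul μ u H) {i j j' : ℕ} {a b b' : V}
    (hb : IsSecondOrderAt μ D i a j b) (hb' : IsSecondOrderAt μ D i a j' b') :
    IsSecondOrderAt μ D i a (j + j') (μ b b') := by
  obtain ⟨c, hc⟩ := hb
  obtain ⟨c', hc'⟩ := hb'
  refine ⟨μ c b' + (-1 : ℤ) ^ ((i + 1) * j) • μ b c', ?_⟩
  rw [mulEnd_mul h, gradedCommutator₂_mul, hc, hc', mulEnd_add, mulEnd_zsmul, mulEnd_mul h,
    mulEnd_mul h]

theorem IsSecondOrderAt.add {i j : ℕ} {a b b' : V}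
    (hb : IsSecondOrderAt μ D i a j b) (hb' : IsSecondOrderAt μ D i a j b') :
    IsSecondOrderAt μ D i a j (b + b') := by
  obtain ⟨c, hc⟩ := hb
  obtain ⟨c', hc'⟩ := hb'
  exact ⟨c + c', by rw [mulEnd_add, gradedCommutator₂_add, hc, hc', mulEnd_add]⟩

theorem IsSecondOrderAt.symm (h : IsGradedCommMul μ u H) {i j : ℕ} {a b : V} (ha : H i a)
    (hb : H j b) (hab : IsSecondOrderAt μ D i a j b) : IsSecondOrderAt μ D j b i a := by
  obtain ⟨c, hc⟩ := hab
  refine ⟨(-1 : ℤ) ^ (i * j) • c, ?_⟩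
  rw [gradedCommutator₂_symm D _ _ i j (mulEnd_comm h ha hb), hc, mulEnd_zsmul]

theorem zsmul_apply (c : ℤ) (X : AddMonoid.End V) (m : V) : (c • X) m = c • X m := rfl

theorem gradedCommutator₂_apply (i j : ℕ) (a b m : V) :
    gradedCommutator₂ D (mulEnd μ a) (mulEnd μ b) i j m =
      D (μ a (μ b m)) - (-1 : ℤ) ^ i • μ a (D (μ b m)) -
        (-1 : ℤ) ^ ((i + 1) * j) • μ b (D (μ a m) - (-1 : ℤ) ^ i • μ a (D m)) := rfl

/-- If the second commutator is the multiplication by some element, evaluation at the unit finds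
that element. -/
theorem IsSecondOrderAt.eq_deviation (h : IsGradedCommMul μ u H) (hu : D u = 0)
    (hDH : ∀ i a, H i a → H (i + 1) (D a)) {i j : ℕ} {a b : V} (ha : H i a) (hb : H j b)
    (hab : IsSecondOrderAt μ D i a j b) :
    gradedCommutator₂ D (mulEnd μ a) (mulEnd μ b) i j = mulEnd μ (deviation μ D i a b) := by
  obtain ⟨c, hc⟩ := hab
  have h1 := DFunLike.congr_fun hc u
  rw [gradedCommutator₂_apply, h.mul_unit, h.mul_unit, hu, map_zero, smul_zero, sub_zero] at h1
  change _ = μ c u at h1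
  rw [h.mul_unit] at h1
  rw [hc, ← h1, deviation, h.comm (i + 1) j (D a) b (hDH i a ha) hb]
  congr 1
  abel

/-- Order at most two, evaluated at an arbitrary `c` instead of the unit, is exactly the derivation
property of the deviation. -/
theorem deviation_mul (h : IsGradedCommMul μ u H) (hu : D u = 0)
    (hDH : ∀ i a, H i a → H (i + 1) (D a)) {i j : ℕ} {a b : V} (ha : H i a) (hb : H j b)
    (hab : IsSecondOrderAt μ D i a j b) (c : V) :
    deviation μ D i a (μ b c) = μ (deviation μ D i a b) c +
      (-1 : ℤ) ^ ((i + 1) * j) • μ b (deviation μ D i a c) := by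
  have h1 := DFunLike.congr_fun (hab.eq_deviation h hu hDH ha hb) c
  rw [gradedCommutator₂_apply] at h1
  change _ = μ (deviation μ D i a b) c at h1
  have h2 : μ (D a) (μ b c) = (-1 : ℤ) ^ ((i + 1) * j) • μ b (μ (D a) c) := by
    rw [← h.assoc, h.comm (i + 1) j (D a) b (hDH i a ha) hb, ← h.assoc]
    exact DFunLike.congr_fun (map_zsmul μ _ _) c
  rw [← h1, deviation, deviation, h2]
  simp only [map_sub, smul_sub]
  abel

theorem deviation_symm (h : IsGradedCommMul μ u H)
    (hDH : ∀ i a, H i a → H (i + 1) (D a)) {i j : ℕ} {a b : V} (ha : H i a) (hb : H j b) :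
    deviation μ D j b a = (-1 : ℤ) ^ (i * j) • deviation μ D i a b := by
  rw [deviation, deviation, h.comm j i b a hb ha, h.comm (j + 1) i _ a (hDH j b hb) ha,
    h.comm j (i + 1) b _ hb (hDH i a ha), map_zsmul, show (j + 1) * i = i * j + i by ring,
    show j * (i + 1) = i * j + j by ring, pow_add, pow_add, mul_comm j i]
  rcases neg_one_pow_eq_or ℤ (i * j) with hg | hg <;>
  rcases neg_one_pow_eq_or ℤ i with hi | hi <;>
  rcases neg_one_pow_eq_or ℤ j with hj | hj <;> rw [hg, hi, hj] <;> simp <;> abel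

/-- All second commutators involved are multiplications by deviations, so the operator identity
`gradedCommutator₂_jacobi_aux` can be evaluated at `c`. -/
theorem deviation_jacobi (h : IsGradedCommMul μ u H) (hu : D u = 0) (hDD : ∀ m, D (D m) = 0)
    (hDH : ∀ i a, H i a → H (i + 1) (D a))
    (hso : ∀ i j a b, H i a → H j b → IsSecondOrderAt μ D i a j b)
    {i j : ℕ} {a b : V} (ha : H i a) (hb : H j b) (c : V) :
    ((-1 : ℤ) ^ i * (-1) ^ j) • deviation μ D i a (deviation μ D j b c) =
      (-(-1 : ℤ) ^ j) • deviation μ D (i + j + 1) (deviation μ D i a b) c -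
        (-1 : ℤ) ^ (i * j) • deviation μ D j b (deviation μ D i a c) := by
  have e1 := (hso i j a b ha hb).eq_deviation h hu hDH ha hb
  have e2 := (hso (i + 1) j _ b (hDH i a ha) hb).eq_deviation h hu hDH (hDH i a ha) hb
  have e3 := (hso i (j + 1) a _ ha (hDH j b hb)).eq_deviation h hu hDH ha (hDH j b hb)
  -- Since `D² = 0`, applying `D` to the deviation leaves only deviations in which `D` has acted on
  -- one of the two arguments.
  have e4 : D (deviation μ D i a b) =
      -deviation μ D (i + 1) (D a) b - (-1 : ℤ) ^ i • deviation μ D i a (D b) := by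
    simp only [deviation, hDD, map_sub, map_zsmul, map_zero, AddMonoidHom.zero_apply, pow_succ]
    rcases neg_one_pow_eq_or ℤ i with hi | hi <;> rw [hi] <;> simp <;> abel
  have hA'B := mulEnd_comm h (hDH i a ha) hb
  have hA'B' := mulEnd_comm h (hDH i a ha) (hDH j b hb)
  have hd : D * D = 0 := AddMonoidHom.ext hDD
  have hP' : mulEnd μ (D (deviation μ D i a b)) =
      -gradedCommutator₂ D (mulEnd μ (D a)) (mulEnd μ b) (i + 1) j -
        (-1 : ℤ) ^ i • gradedCommutator₂ D (mulEnd μ a) (mulEnd μ (D b)) i (j + 1) := by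
    rw [e2, e3, e4, mulEnd_sub, mulEnd_neg, mulEnd_zsmul]
  have s1 : (-1 : ℤ) ^ ((i + 1) * j) = (-1) ^ (i * j) * (-1) ^ j := by ring
  have s2 : (-1 : ℤ) ^ ((i + 1) * (j + 1)) = -((-1) ^ (i * j) * (-1) ^ i * (-1) ^ j) := by ring
  have s3 : (-1 : ℤ) ^ ((i + 1 + 1) * j) = (-1) ^ (i * j) := by
    rw [show (i + 1 + 1) * j = i * j + 2 * j by ring, pow_add, pow_mul (-1) 2 j]; simp
  have s4 : (-1 : ℤ) ^ (i + 1) = -(-1) ^ i := by ring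
  have s5 : (-1 : ℤ) ^ (i + j + 1) = -((-1) ^ i * (-1) ^ j) := by ring
  rw [gradedCommutator₂, s1] at e1
  rw [gradedCommutator₂, gradedCommutator₂, s2, s3, s4] at hP'
  simp only [neg_smul, sub_neg_eq_add] at hP'
  rw [s1] at hA'B
  rw [s2] at hA'B'
  have key := gradedCommutator₂_jacobi_aux D (mulEnd μ a) (mulEnd μ b) (mulEnd μ (D a))
    (mulEnd μ (D b)) _ _ ((-1) ^ i) ((-1) ^ j) ((-1) ^ (i * j)) (neg_one_pow_eq_or ℤ i)
    (neg_one_pow_eq_or ℤ j) (neg_one_pow_eq_or ℤ (i * j)) hd hA'B hA'B' e1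
    hP'
  have d1 : ∀ i a c, (D * mulEnd μ a - (-1 : ℤ) ^ i • (mulEnd μ a * D) - mulEnd μ (D a)) c =
      deviation μ D i a c := fun i a c => sub_right_comm _ _ _
  have d2 : ∀ y, (D * mulEnd μ y + ((-1) ^ i * (-1) ^ j : ℤ) • (mulEnd μ y * D) -
      mulEnd μ (D y)) c = deviation μ D (i + j + 1) y c := fun y => by
    have := d1 (i + j + 1) y c
    rwa [s5, neg_smul, sub_neg_eq_add] at this
  have e : ((-1 : ℤ) ^ i * (-1) ^ j) • (D * mulEnd μ a - (-1 : ℤ) ^ i • (mulEnd μ a * D) -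
      mulEnd μ (D a)) ((D * mulEnd μ b - (-1 : ℤ) ^ j • (mulEnd μ b * D) - mulEnd μ (D b)) c) =
      (-(-1 : ℤ) ^ j) • (D * mulEnd μ (deviation μ D i a b) + ((-1) ^ i * (-1) ^ j : ℤ) •
      (mulEnd μ (deviation μ D i a b) * D) - mulEnd μ (D (deviation μ D i a b))) c -
      (-1 : ℤ) ^ (i * j) • (D * mulEnd μ b - (-1 : ℤ) ^ j • (mulEnd μ b * D) -
      mulEnd μ (D b)) ((D * mulEnd μ a - (-1 : ℤ) ^ i • (mulEnd μ a * D) - mulEnd μ (D a)) c) :=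
    DFunLike.congr_fun key c
  rwa [d1, d1, d1, d1, d2] at e

end Operators

/-! ### The operator `d'_α` has order at most one over the scalar forms. -/

/-- `I` stands for an insertion. Commuting it past `[d, b]` produces `c`, the commutator of the Lie
derivative `[d, I]` with `b`; as `c` commutes with `b'` in the graded sense, nothing survives in the
second commutator. -/
theorem gradedCommutator₂_mul_comm {E : Type*} [Ring E] (d b b' c I : E) (r r' : ℕ)
    (hb : I * b = (-1 : ℤ) ^ r • (b * I)) (hb' : I * b' = (-1 : ℤ) ^ r' • (b' * I))
    (hc : (d * I + I * d) * b = c + b * (d * I + I * d))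
    (hcb : c * b' = (-1 : ℤ) ^ (r * r') • (b' * c)) :
    I * gradedCommutator₂ d b b' r r' =
      (-(-1 : ℤ) ^ (r + r')) • (gradedCommutator₂ d b b' r r' * I) := by
  have h1 : I * (d * b - (-1 : ℤ) ^ r • (b * d)) =
      c - (-1 : ℤ) ^ r • ((d * b - (-1 : ℤ) ^ r • (b * d)) * I) := by
    rcases neg_one_pow_eq_or ℤ r with hi | hi <;> rw [hi] at hb ⊢
    · linear_combination (norm := noncomm_ring) hc - d * hb - hb * d
    · linear_combination (norm := noncomm_ring) hc - d * hb + hb * d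
  rw [gradedCommutator₂, show (r + 1) * r' = r * r' + r' by ring, pow_add, pow_add]
  generalize d * b - (-1 : ℤ) ^ r • (b * d) = δ at h1 ⊢
  clear hb hc
  rcases neg_one_pow_eq_or ℤ (r * r') with hg | hg <;> rw [hg] at hcb ⊢ <;>
  rcases neg_one_pow_eq_or ℤ r with hi | hi <;> rw [hi] at h1 ⊢ <;>
  rcases neg_one_pow_eq_or ℤ r' with hj | hj <;> rw [hj] at hb' ⊢
  · linear_combination (norm := noncomm_ring) h1 * b' - δ * hb' - hb' * δ - b' * h1 + hcb
  · linear_combination (norm := noncomm_ring) h1 * b' - δ * hb' + hb' * δ - b' * h1 + hcb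
  · linear_combination (norm := noncomm_ring) h1 * b' + δ * hb' - hb' * δ - b' * h1 + hcb
  · linear_combination (norm := noncomm_ring) h1 * b' + δ * hb' + hb' * δ - b' * h1 + hcb
  · linear_combination (norm := noncomm_ring) h1 * b' - δ * hb' + hb' * δ + b' * h1 + hcb
  · linear_combination (norm := noncomm_ring) h1 * b' - δ * hb' - hb' * δ + b' * h1 + hcb
  · linear_combination (norm := noncomm_ring) h1 * b' + δ * hb' + hb' * δ + b' * h1 + hcb
  · linear_combination (norm := noncomm_ring) h1 * b' + δ * hb' - hb' * δ + b' * h1 + hcb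

section
variable {V L₁ L₂ : Type*} [AddCommGroup V] [LieRing L₁] [LieRing L₂]
  {a₁₂ : L₁ → L₂ → L₂} {a₂₁ : L₂ → L₁ → L₁} {d₁ d₂ : AddMonoid.End V}
  {I : L₁ → AddMonoid.End V} {J : L₂ → AddMonoid.End V} {P₁ P₂ P₀ : AddSubgroup V}

/-- The second commutator of `d₁` with multiplications by scalar forms vanishes. -/
theorem IsInsertionCalculus.gradedCommutator₂_apply_eq_zero
    (h : IsInsertionCalculus a₁₂ a₂₁ d₁ d₂ I J P₁ P₂ P₀) (b b' : AddMonoid.End V)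
    (c : L₁ → AddMonoid.End V) (r r' : ℕ)
    (hb : ∀ x m, I x (b m) = (-1 : ℤ) ^ r • b (I x m))
    (hb' : ∀ x m, I x (b' m) = (-1 : ℤ) ^ r' • b' (I x m))
    (hc : ∀ x m, d₁ (I x (b m)) + I x (d₁ (b m)) = c x m + b (d₁ (I x m) + I x (d₁ m)))
    (hcb : ∀ x m, c x (b' m) = (-1 : ℤ) ^ (r * r') • b' (c x m))
    (h₁ : ∀ m, b (d₁ m) ∈ P₁) (h₁' : ∀ m, b' (d₁ m) ∈ P₁) (h₂ : ∀ m, b' (b (d₁ m)) ∈ P₁) (m : V) :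
    d₁ (b (b' m)) - (-1 : ℤ) ^ r • b (d₁ (b' m)) -
      (-1 : ℤ) ^ ((r + 1) * r') • b' (d₁ (b m) - (-1 : ℤ) ^ r • b (d₁ m)) = 0 := by
  refine DFunLike.congr_fun (h.vanish₁ (gradedCommutator₂ d₁ b b' r r') (fun x m hm => ?_)
    (fun m => ?_)) m
  · have e := DFunLike.congr_fun (gradedCommutator₂_mul_comm d₁ b b' (c x) (I x) r r'
      (AddMonoidHom.ext (hb x)) (AddMonoidHom.ext (hb' x)) (AddMonoidHom.ext (hc x))
      (AddMonoidHom.ext (hcb x))) m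
    refine e.trans ?_
    rw [zsmul_apply]
    change _ • gradedCommutator₂ d₁ b b' r r' (I x m) = 0
    rw [hm, smul_zero]
  · change d₁ (b (b' m)) - (-1 : ℤ) ^ r • b (d₁ (b' m)) -
      (-1 : ℤ) ^ ((r + 1) * r') • b' (d₁ (b m) - (-1 : ℤ) ^ r • b (d₁ m)) ∈ P₁
    rw [map_sub, map_zsmul]
    exact P₁.sub_mem (P₁.sub_mem (h.d₁_mem _) (P₁.zsmul_mem (h₁ _) _))
      (P₁.zsmul_mem (P₁.sub_mem (h₁' _) (P₁.zsmul_mem (h₂ _) _)) _)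

end

namespace MixedForms

variable {A L₁ L₂ : Type*} [CommRing A] [AddCommGroup L₁] [Module A L₁]
  [AddCommGroup L₂] [Module A L₂]

local notation "ofW" => BiForms.of (A := A) (L := L₂) (M := fun k => L₁ [⋀^Fin k]→ₗ[A] A)

theorem act_of' {q r k : ℕ} (b : L₂ [⋀^Fin q]→ₗ[A] A) (f : L₂ [⋀^Fin r]→ₗ[A] (L₁ [⋀^Fin k]→ₗ[A] A)) :
    BiForms.act (BiForms.scalar q b) (ofW r k f) = (-1 : ℤ) ^ (q * r) •
      ofW (q + r) k (shuffle (LinearMap.lsmul A (L₁ [⋀^Fin k]→ₗ[A] A)) q r b f) :=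
  BiForms.act_of (M := fun k => L₁ [⋀^Fin k]→ₗ[A] A) b f

theorem ins_act {r : ℕ} (x : L₁) (b : L₂ [⋀^Fin r]→ₗ[A] A) (m : MixedForms A L₁ L₂) :
    ins x (BiForms.act (BiForms.scalar r b) m) =
      (-1 : ℤ) ^ r • BiForms.act (BiForms.scalar r b) (ins x m) := by
  induction m using BiForms.induction with
  | zero => simp only [map_zero, smul_zero]
  | add a a' h h' => rw [map_add, map_add, h, h', map_add, map_add, smul_add]
  | of q k f =>
    rw [act_of', ins_zsmul]
    rcases k with _ | k
    · rw [ins_of_zero, ins_of_zero, smul_zero, map_zero, smul_zero]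
    · have h := compAlternatingMap_shuffle_lsmul (AlternatingMap.curryLeftLinearMap.flip x :
        (L₁ [⋀^Fin (k + 1)]→ₗ[A] A) →ₗ[A] (L₁ [⋀^Fin k]→ₗ[A] A)) b f
      have h' : insVal x (shuffle (LinearMap.lsmul A (L₁ [⋀^Fin (k + 1)]→ₗ[A] A)) r q b f) =
        shuffle (LinearMap.lsmul A (L₁ [⋀^Fin k]→ₗ[A] A)) r q b (insVal x f) := h
      rw [ins_of_succ, ins_of_succ, map_zsmul, act_of', h', smul_smul, smul_smul, smul_smul]
      congr 1
      ring

/-- The forms generated by those of positive degree in `L₁`. -/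
theorem act_mem_vanishing {r : ℕ} (b : L₂ [⋀^Fin r]→ₗ[A] A) {m : MixedForms A L₁ L₂}
    (hm : m ∈ AddSubgroup.closure {m | ∃ q k f, m = ofW q (k + 1) f}) :
    BiForms.act (BiForms.scalar r b) m ∈
      AddSubgroup.closure {m | ∃ q k f, m = ofW q (k + 1) f} := by
  induction hm using AddSubgroup.closure_induction with
  | mem m hm =>
    obtain ⟨q, k, f, rfl⟩ := hm
    rw [act_of', ← of_zsmul]
    exact AddSubgroup.subset_closure ⟨_, _, _, rfl⟩
  | zero => rw [map_zero]; exact zero_mem _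
  | add a b _ _ h h' => rw [map_add]; exact add_mem h h'
  | neg a _ h => rw [map_neg]; exact neg_mem h

/-- Stability under the action of scalar forms is immediate on homogeneous generators, so it is
proved for the closure and transferred to the condition on components. -/
theorem closure_le_vanishing : AddSubgroup.closure {m | ∃ q k f, m = ofW q (k + 1) f} ≤
    vanishing A L₁ L₂ {d | d.2 = 0} := by
  rw [AddSubgroup.closure_le]
  rintro _ ⟨q, k, f, rfl⟩ ⟨s, _⟩ rfl
  exact of_apply_ne f (by simp)

end MixedForms

namespace AlmostTwilled

variable {R A L₁ L₂ : Type*} [CommRing R] [CommRing A] [Algebra R A]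
  [LieRing L₁] [LieAlgebra R L₁] [Module A L₁] [LieRingModule L₁ A] [LieRinehartRing A L₁]
  [LieRinehartAlgebra R A L₁]
  [LieRing L₂] [LieAlgebra R L₂] [Module A L₂] [LieRingModule L₂ A] [LieRinehartRing A L₂]
  [LieRinehartAlgebra R A L₂]

local notation "ofW" => BiForms.of (A := A) (L := L₂) (M := fun k => L₁ [⋀^Fin k]→ₗ[A] A)

theorem dPrime_mem_closure (T : AlmostTwilled R A L₁ L₂) (α : L₁ →ₗ[A] A) (m : MixedForms A L₁ L₂) :
    T.dPrime α m ∈ AddSubgroup.closure {m | ∃ q k f, m = ofW q (k + 1) f} := by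
  induction m using BiForms.induction with
  | zero => rw [map_zero]; exact zero_mem _
  | add a b h h' => rw [map_add]; exact add_mem h h'
  | of q k f =>
    rw [dPrime_of, ← MixedForms.of_zsmul]
    exact AddSubgroup.subset_closure ⟨_, _, _, rfl⟩

/-- Graded commutativity of the action is a hypothesis here. It is supplied afterwards from the
commutativity of `PolyForms.mul` through `flat`. -/
theorem dPrime_act_act (T : AlmostTwilled R A L₁ L₂) (α : L₁ →ₗ[A] A) {r r' : ℕ}
    (b : L₂ [⋀^Fin r]→ₗ[A] A) (b' : L₂ [⋀^Fin r']→ₗ[A] A)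
    (hcomm : ∀ (c : L₂ [⋀^Fin r]→ₗ[A] A) (m : MixedForms A L₁ L₂),
      BiForms.act (BiForms.scalar r c) (BiForms.act (BiForms.scalar r' b') m) =
      (-1 : ℤ) ^ (r * r') •
        BiForms.act (BiForms.scalar r' b') (BiForms.act (BiForms.scalar r c) m))
    (m : MixedForms A L₁ L₂) :
    T.dPrime α (BiForms.act (BiForms.scalar r b) (BiForms.act (BiForms.scalar r' b') m)) -
      (-1 : ℤ) ^ r • BiForms.act (BiForms.scalar r b)
        (T.dPrime α (BiForms.act (BiForms.scalar r' b') m)) -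
      (-1 : ℤ) ^ ((r + 1) * r') • BiForms.act (BiForms.scalar r' b')
        (T.dPrime α (BiForms.act (BiForms.scalar r b) m) -
          (-1 : ℤ) ^ r • BiForms.act (BiForms.scalar r b) (T.dPrime α m)) = 0 :=
  (T.isInsertionCalculus α).gradedCommutator₂_apply_eq_zero
    (BiForms.act (BiForms.scalar r b)).toAddMonoidHom
    (BiForms.act (BiForms.scalar r' b')).toAddMonoidHom
    (fun x => (BiForms.act (BiForms.scalar r (T.actForm x b))).toAddMonoidHom) r r'
    (fun x m => MixedForms.ins_act x b m) (fun x m => MixedForms.ins_act x b' m)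
    (fun x m => T.opLie₁_act α x b m) (fun _ m => hcomm _ m)
    (fun m => MixedForms.closure_le_vanishing
      (MixedForms.act_mem_vanishing b (T.dPrime_mem_closure α m)))
    (fun m => MixedForms.closure_le_vanishing
      (MixedForms.act_mem_vanishing b' (T.dPrime_mem_closure α m)))
    (fun m => MixedForms.closure_le_vanishing
      (MixedForms.act_mem_vanishing b' (MixedForms.act_mem_vanishing b
        (T.dPrime_mem_closure α m)))) m

end AlmostTwilled

/-! ### Parity of degrees, and `PolyForms` as an instance of the abstract setting. -/

section Operators

variable {V : Type*} [AddCommGroup V] {μ : V →+ V →+ V} {u : V} {H : ℕ → V → Prop}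
  {D : AddMonoid.End V}

theorem deviation_eq (h : IsGradedCommMul μ u H) (hu : D u = 0)
    (hDH : ∀ i a, H i a → H (i + 1) (D a)) {i j : ℕ} {a b c : V} (ha : H i a) (hb : H j b)
    (hc : gradedCommutator₂ D (mulEnd μ a) (mulEnd μ b) i j = mulEnd μ c) :
    deviation μ D i a b = c := by
  have h1 := IsSecondOrderAt.eq_deviation h hu hDH ha hb ⟨c, hc⟩
  rw [hc] at h1
  have h2 : μ c u = μ (deviation μ D i a b) u := DFunLike.congr_fun h1 u
  rw [h.mul_unit, h.mul_unit] at h2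
  exact h2.symm

theorem neg_one_pow_eq_of_even_iff {i j : ℕ} (h : Even i ↔ Even j) : (-1 : ℤ) ^ i = (-1) ^ j :=
  neg_one_pow_congr h

theorem IsSecondOrderAt.congr {i i' j j' : ℕ} {a b : V} (hi : Even i ↔ Even i')
    (hj : Even j ↔ Even j') (h : IsSecondOrderAt μ D i a j b) : IsSecondOrderAt μ D i' a j' b := by
  obtain ⟨c, hc⟩ := h
  refine ⟨c, ?_⟩
  rw [← hc, gradedCommutator₂, gradedCommutator₂, neg_one_pow_eq_of_even_iff hi,
    neg_one_pow_eq_of_even_iff (i := (i + 1) * j) (j := (i' + 1) * j')]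
  rw [Nat.even_mul, Nat.even_mul, Nat.even_add_one, Nat.even_add_one, hi, hj]

theorem gradedCommutator₂_eq_mulEnd {i j : ℕ} {a b c : V}
    (h : ∀ m, D (μ a (μ b m)) - (-1 : ℤ) ^ i • μ a (D (μ b m)) -
      (-1 : ℤ) ^ ((i + 1) * j) • μ b (D (μ a m) - (-1 : ℤ) ^ i • μ a (D m)) = μ c m) :
    gradedCommutator₂ D (mulEnd μ a) (mulEnd μ b) i j = mulEnd μ c := AddMonoidHom.ext h

end Operators

namespace PolyForms

variable {A L₁ L₂ : Type*} [CommRing A] [AddCommGroup L₁] [Module A L₁]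
  [AddCommGroup L₂] [Module A L₂]

local notation "of₁₂" => BiForms.of (A := A) (L := L₂) (M := fun p => ⋀[A]^p L₁)

/-- The product as a biadditive map. -/
noncomputable def mulHom (A L₁ L₂ : Type*) [CommRing A] [AddCommGroup L₁] [Module A L₁]
    [AddCommGroup L₂] [Module A L₂] :
    PolyForms A L₁ L₂ →+ PolyForms A L₁ L₂ →+ PolyForms A L₁ L₂ :=
  AddMonoidHom.mk' (fun a => (mul a).toAddMonoidHom) fun a b => AddMonoidHom.ext fun c =>
    add_mul a b c

theorem mulHom_apply (a b : PolyForms A L₁ L₂) : mulHom A L₁ L₂ a b = mul a b := rfl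

/-- The bihomogeneous elements whose total degree has the parity of `i`. -/
def IsHomogeneous (i : ℕ) (a : PolyForms A L₁ L₂) : Prop :=
  ∃ (q p : ℕ) (f : L₂ [⋀^Fin q]→ₗ[A] ⋀[A]^p L₁), (Even (q + p) ↔ Even i) ∧ a = of₁₂ q p f

theorem isHomogeneous_of (q p : ℕ) (f : L₂ [⋀^Fin q]→ₗ[A] ⋀[A]^p L₁) :
    IsHomogeneous (q + p) (of₁₂ q p f) := ⟨q, p, f, Iff.rfl, rfl⟩

theorem isHomogeneous_ofVector (x : L₁) : IsHomogeneous (A := A) 1 (ofVector L₂ x) :=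
  isHomogeneous_of (A := A) (L₁ := L₁) 0 1 _

theorem isHomogeneous_ofForm {r : ℕ} (b : L₂ [⋀^Fin r]→ₗ[A] A) :
    IsHomogeneous r (ofForm L₁ b) :=
  isHomogeneous_of (A := A) (L₂ := L₂) r 0 _

theorem isGradedCommMul : IsGradedCommMul (mulHom A L₁ L₂) one IsHomogeneous where
  assoc := mul_assoc'
  mul_unit := mul_one'
  comm := by
    rintro i j _ _ ⟨q, p, f, hi, rfl⟩ ⟨r, s, g, hj, rfl⟩
    refine (mul_comm_of_of f g).trans ?_
    rw [neg_one_pow_eq_of_even_iff (i := (q + p) * (r + s)) (j := i * j)]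
    · rfl
    · rw [Nat.even_mul, Nat.even_mul, hi, hj]

theorem neg_mul' (a b : PolyForms A L₁ L₂) : mul (-a) b = -mul a b := map_neg (mul.flip b) a

theorem flat_eq_imp_eq [Module.Finite A L₁] [Module.Projective A L₁] {n : ℕ}
    (hrank : ∀ P : PrimeSpectrum A, Module.rankAtStalk L₁ P = n) (Ω : ⋀[A]^n L₁ ≃ₗ[A] A)
    {a b : PolyForms A L₁ L₂}
    (h : flat (Ω : ⋀[A]^n L₁ →ₗ[A] A) a = flat (Ω : ⋀[A]^n L₁ →ₗ[A] A) b) : a = b :=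
  (flat_bijective hrank Ω).1 h

theorem flat_ofForm_mul {n : ℕ} (Ω : ⋀[A]^n L₁ →ₗ[A] A) {r : ℕ} (b : L₂ [⋀^Fin r]→ₗ[A] A)
    (m : PolyForms A L₁ L₂) :
    flat Ω (mul (ofForm L₁ b) m) = BiForms.act (BiForms.scalar r b) (flat Ω m) := by
  rw [ofForm_mul, flat_act]

end PolyForms

/-! ### The divergence operator and its second commutators. -/

namespace AlmostTwilled

variable {R A L₁ L₂ : Type*} [CommRing R] [CommRing A] [Algebra R A]
  [LieRing L₁] [LieAlgebra R L₁] [Module A L₁] [LieRingModule L₁ A] [LieRinehartRing A L₁]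
  [LieRinehartAlgebra R A L₁]
  [LieRing L₂] [LieAlgebra R L₂] [Module A L₂] [LieRingModule L₂ A] [LieRinehartRing A L₂]
  [LieRinehartAlgebra R A L₂] [Module.Finite A L₁] [Module.Projective A L₁] {n : ℕ}

local notation "of₁₂" => BiForms.of (A := A) (L := L₂) (M := fun p => ⋀[A]^p L₁)
local notation "ofW" => BiForms.of (A := A) (L := L₂) (M := fun k => L₁ [⋀^Fin k]→ₗ[A] A)

/-- The operator on `Alt^*(L₂, Λ^* L₁)` which corresponds to `d'_α` under `flat Ω`. -/
noncomputable def divergence (T : AlmostTwilled R A L₁ L₂)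
    (hrank : ∀ P : PrimeSpectrum A, Module.rankAtStalk L₁ P = n) (Ω : ⋀[A]^n L₁ ≃ₗ[A] A)
    (α : L₁ →ₗ[A] A) : PolyForms A L₁ L₂ →ₗ[R] PolyForms A L₁ L₂ :=
  ((LinearEquiv.ofBijective _ (PolyForms.flat_bijective (L₂ := L₂) hrank Ω)).symm.toLinearMap.restrictScalars R) ∘ₗ
    T.dPrime α ∘ₗ (PolyForms.flat (Ω : ⋀[A]^n L₁ →ₗ[A] A)).restrictScalars R

variable (T : AlmostTwilled R A L₁ L₂)
    (hrank : ∀ P : PrimeSpectrum A, Module.rankAtStalk L₁ P = n) (Ω : ⋀[A]^n L₁ ≃ₗ[A] A)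
    (α : L₁ →ₗ[A] A)

theorem flat_divergence (m : PolyForms A L₁ L₂) :
    PolyForms.flat (Ω : ⋀[A]^n L₁ →ₗ[A] A) (T.divergence hrank Ω α m) =
      T.dPrime α (PolyForms.flat (Ω : ⋀[A]^n L₁ →ₗ[A] A) m) :=
  (LinearEquiv.ofBijective _ (PolyForms.flat_bijective (L₂ := L₂) hrank Ω)).apply_symm_apply _

/-- Under `flat`, exterior degree zero corresponds to `n`-forms on `L₁`, and there are no nonzero
`(n + 1)`-forms. -/
theorem divergence_of_zero {q : ℕ} (f : L₂ [⋀^Fin q]→ₗ[A] ⋀[A]^0 L₁) :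
    T.divergence hrank Ω α (of₁₂ q 0 f) = 0 := by
  apply PolyForms.flat_eq_imp_eq hrank Ω
  rw [flat_divergence, map_zero, PolyForms.flat_of _ (add_zero n), dPrime_of]
  have h : ∀ g : L₂ [⋀^Fin q]→ₗ[A] (L₁ [⋀^Fin (n + 1)]→ₗ[A] A), g = 0 := fun g => by
    ext v : 1
    exact AlternatingMap.eq_zero_of_rankAtStalk_lt hrank (Nat.lt_succ_self n) (g v)
  rw [h (T.ceFlip α _), map_zero, smul_zero]

theorem exists_divergence_of_succ {q p : ℕ} (f : L₂ [⋀^Fin q]→ₗ[A] ⋀[A]^(p + 1) L₁) :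
    ∃ g : L₂ [⋀^Fin q]→ₗ[A] ⋀[A]^p L₁, T.divergence hrank Ω α (of₁₂ q (p + 1) f) = of₁₂ q p g := by
  by_cases hp : p + 1 ≤ n
  · obtain ⟨k, rfl⟩ : ∃ k, n = k + (p + 1) := ⟨n - (p + 1), by omega⟩
    refine ⟨(-1 : ℤ) ^ (q + k + 1) • (PolyForms.contractEquiv hrank Ω
      (show k + 1 + p = k + (p + 1) by ring)).symm.toLinearMap.compAlternatingMap (T.ceFlip α
        ((PolyForms.contract (Ω : ⋀[A]^(k + (p + 1)) L₁ →ₗ[A] A) rfl).compAlternatingMap f)), ?_⟩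
    apply PolyForms.flat_eq_imp_eq hrank Ω
    rw [flat_divergence, PolyForms.flat_of _ rfl, dPrime_of,
      BiForms.of_zsmul (M := fun p => ⋀[A]^p L₁), map_zsmul,
      PolyForms.flat_of _ (show k + 1 + p = k + (p + 1) by ring)]
    congr 2
    ext v : 1
    exact ((PolyForms.contractEquiv hrank Ω _).apply_symm_apply _).symm
  · refine ⟨0, ?_⟩
    apply PolyForms.flat_eq_imp_eq hrank Ω
    rw [flat_divergence, PolyForms.flat_of_lt _ (not_le.1 hp), map_zero, map_zero, map_zero]

/-- `divergence` as an additive endomorphism. -/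
noncomputable def divergenceEnd : AddMonoid.End (PolyForms A L₁ L₂) :=
  (T.divergence hrank Ω α).toAddMonoidHom

theorem divergenceEnd_apply (m : PolyForms A L₁ L₂) :
    T.divergenceEnd hrank Ω α m = T.divergence hrank Ω α m := rfl

theorem divergenceEnd_one : T.divergenceEnd hrank Ω α PolyForms.one = 0 :=
  T.divergence_of_zero hrank Ω α _

theorem isHomogeneous_divergenceEnd (i : ℕ) (a : PolyForms A L₁ L₂)
    (ha : PolyForms.IsHomogeneous i a) :
    PolyForms.IsHomogeneous (i + 1) (T.divergenceEnd hrank Ω α a) := by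
  obtain ⟨q, p, f, hi, rfl⟩ := ha
  rcases p with _ | p
  -- Here the value is zero, which counts as homogeneous of either parity; bidegree `(q + 1, 0)` has
  -- the one required.
  · refine ⟨q + 1, 0, 0, ?_, ?_⟩
    · rw [add_zero, Nat.even_add_one, Nat.even_add_one, ← hi, add_zero]
    · rw [divergenceEnd_apply, divergence_of_zero, map_zero]
  · obtain ⟨g, hg⟩ := T.exists_divergence_of_succ hrank Ω α f
    refine ⟨q, p, g, ?_, hg⟩
    rw [Nat.even_add_one, ← hi, ← add_assoc, Nat.even_add_one, not_not]

/-- Multiplication by `x` becomes minus an insertion, so its anticommutator with `divergence`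
becomes minus the anticommutator of `d'_α` with that insertion, which is a Lie derivative. -/
theorem flat_divergence_ofVector_mul (x : L₁) (m : PolyForms A L₁ L₂) :
    PolyForms.flat (Ω : ⋀[A]^n L₁ →ₗ[A] A)
      (T.divergence hrank Ω α (PolyForms.mul (PolyForms.ofVector L₂ x) m) -
        (-1 : ℤ) ^ 1 • PolyForms.mul (PolyForms.ofVector L₂ x) (T.divergence hrank Ω α m)) =
      -T.opLie₁ α x (PolyForms.flat (Ω : ⋀[A]^n L₁ →ₗ[A] A) m) := by
  rw [pow_one, neg_one_smul, sub_neg_eq_add, map_add, flat_divergence,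
    PolyForms.flat_ofVector_mul, PolyForms.flat_ofVector_mul, flat_divergence, map_neg, ← neg_add]
  rfl

/-- The transported form of the Cartan relation between a Lie derivative and an insertion. -/
theorem secondCommutator_ofVector_ofVector (x y : L₁) :
    gradedCommutator₂ (T.divergenceEnd hrank Ω α)
      (mulEnd (PolyForms.mulHom A L₁ L₂) (PolyForms.ofVector L₂ x))
      (mulEnd (PolyForms.mulHom A L₁ L₂) (PolyForms.ofVector L₂ y)) 1 1 =
      mulEnd (PolyForms.mulHom A L₁ L₂) (-PolyForms.ofVector L₂ ⁅x, y⁆) := by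
  refine gradedCommutator₂_eq_mulEnd fun m => PolyForms.flat_eq_imp_eq hrank Ω ?_
  simp only [PolyForms.mulHom_apply, divergenceEnd_apply]
  rw [map_sub, map_zsmul, flat_divergence_ofVector_mul, PolyForms.flat_ofVector_mul,
    PolyForms.flat_ofVector_mul, flat_divergence_ofVector_mul]
  rw [PolyForms.neg_mul', map_neg (PolyForms.flat (Ω : ⋀[A]^n L₁ →ₗ[A] A)), PolyForms.flat_ofVector_mul, neg_neg, map_neg, map_neg, neg_neg, neg_neg]
  have h : T.opLie₁ α x (MixedForms.ins y (PolyForms.flat (Ω : ⋀[A]^n L₁ →ₗ[A] A) m)) =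
      MixedForms.ins y (T.opLie₁ α x (PolyForms.flat (Ω : ⋀[A]^n L₁ →ₗ[A] A) m)) +
      MixedForms.ins ⁅x, y⁆ (PolyForms.flat (Ω : ⋀[A]^n L₁ →ₗ[A] A) m) :=
    LinearMap.congr_fun (T.opLie₁_mul_opIns α x y) _
  rw [h]
  norm_num

/-- Lie derivatives are derivations of the action of scalar forms. -/
theorem secondCommutator_ofVector_ofForm (x : L₁) {r : ℕ} (b : L₂ [⋀^Fin r]→ₗ[A] A) :
    gradedCommutator₂ (T.divergenceEnd hrank Ω α)
      (mulEnd (PolyForms.mulHom A L₁ L₂) (PolyForms.ofVector L₂ x))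
      (mulEnd (PolyForms.mulHom A L₁ L₂) (PolyForms.ofForm L₁ b)) 1 r =
      mulEnd (PolyForms.mulHom A L₁ L₂) (-PolyForms.ofForm L₁ (T.actForm x b)) := by
  refine gradedCommutator₂_eq_mulEnd fun m => PolyForms.flat_eq_imp_eq hrank Ω ?_
  simp only [PolyForms.mulHom_apply, divergenceEnd_apply]
  rw [map_sub, map_zsmul, flat_divergence_ofVector_mul, PolyForms.flat_ofForm_mul, PolyForms.flat_ofForm_mul,
    flat_divergence_ofVector_mul]
  rw [PolyForms.neg_mul', map_neg (PolyForms.flat (Ω : ⋀[A]^n L₁ →ₗ[A] A)), PolyForms.flat_ofForm_mul, opLie₁_act, map_neg, pow_mul]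
  norm_num

theorem secondCommutator_ofForm_ofForm {r r' : ℕ} (b : L₂ [⋀^Fin r]→ₗ[A] A)
    (b' : L₂ [⋀^Fin r']→ₗ[A] A) :
    gradedCommutator₂ (T.divergenceEnd hrank Ω α)
      (mulEnd (PolyForms.mulHom A L₁ L₂) (PolyForms.ofForm L₁ b))
      (mulEnd (PolyForms.mulHom A L₁ L₂) (PolyForms.ofForm L₁ b')) r r' =
      mulEnd (PolyForms.mulHom A L₁ L₂) 0 := by
  refine gradedCommutator₂_eq_mulEnd fun m => PolyForms.flat_eq_imp_eq hrank Ω ?_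
  simp only [PolyForms.mulHom_apply, divergenceEnd_apply]
  rw [map_sub, map_sub, map_zsmul, map_zsmul, flat_divergence, PolyForms.flat_ofForm_mul, PolyForms.flat_ofForm_mul,
    PolyForms.flat_ofForm_mul, flat_divergence, PolyForms.flat_ofForm_mul, PolyForms.flat_ofForm_mul, map_sub, map_zsmul,
    flat_divergence, PolyForms.flat_ofForm_mul, PolyForms.flat_ofForm_mul, flat_divergence]
  refine (T.dPrime_act_act α b b' (fun c m => ?_) _).trans ?_
  -- Every mixed form is in the image of `flat`, where the action of scalar forms is multiplication
  -- in a graded commutative algebra.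
  · obtain ⟨m, rfl⟩ := (PolyForms.flat_bijective hrank Ω).2 m
    rw [← PolyForms.flat_ofForm_mul, ← PolyForms.flat_ofForm_mul, ← PolyForms.flat_ofForm_mul, ← PolyForms.flat_ofForm_mul, ← map_zsmul]
    congr 1
    exact DFunLike.congr_fun (mulEnd_comm PolyForms.isGradedCommMul
      (PolyForms.isHomogeneous_ofForm c) (PolyForms.isHomogeneous_ofForm b')) m
  · change 0 = PolyForms.flat (Ω : ⋀[A]^n L₁ →ₗ[A] A) (PolyForms.mul 0 m)
    rw [PolyForms.zero_mul', map_zero]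

/-- The condition is symmetric, and stable under products and sums in the second argument. It
therefore spreads from pairs of generators, first with one generator fixed on the left, then with an
arbitrary element there. -/
theorem isSecondOrderAt_divergenceEnd (i j : ℕ) (a b : PolyForms A L₁ L₂)
    (ha : PolyForms.IsHomogeneous i a) (hb : PolyForms.IsHomogeneous j b) :
    IsSecondOrderAt (PolyForms.mulHom A L₁ L₂) (T.divergenceEnd hrank Ω α) i a j b := by
  obtain ⟨q, p, f, hi, rfl⟩ := ha
  obtain ⟨r, s, g, hj, rfl⟩ := hb
  refine IsSecondOrderAt.congr hi hj ?_
  have hc := PolyForms.isGradedCommMul (A := A) (L₁ := L₁) (L₂ := L₂)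
  have h1 : ∀ (x : L₁) (q p : ℕ) (f : L₂ [⋀^Fin q]→ₗ[A] ⋀[A]^p L₁),
      IsSecondOrderAt (PolyForms.mulHom A L₁ L₂) (T.divergenceEnd hrank Ω α) 1
        (PolyForms.ofVector L₂ x) (q + p) (of₁₂ q p f) := fun x =>
    PolyForms.of_induction (fun r b => ⟨_, T.secondCommutator_ofVector_ofForm hrank Ω α x b⟩)
      (fun y => ⟨_, T.secondCommutator_ofVector_ofVector hrank Ω α x y⟩)
      (fun _ _ _ _ _ _ h h' => h.mul hc h') (fun _ _ _ h h' => h.add h')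
  have h2 : ∀ (k : ℕ) (b : L₂ [⋀^Fin k]→ₗ[A] A) (q p : ℕ) (f : L₂ [⋀^Fin q]→ₗ[A] ⋀[A]^p L₁),
      IsSecondOrderAt (PolyForms.mulHom A L₁ L₂) (T.divergenceEnd hrank Ω α) k
        (PolyForms.ofForm L₁ b) (q + p) (of₁₂ q p f) := fun k b =>
    PolyForms.of_induction (fun r b' => ⟨_, T.secondCommutator_ofForm_ofForm hrank Ω α b b'⟩)
      (fun y => IsSecondOrderAt.symm hc (PolyForms.isHomogeneous_ofVector y)
        (PolyForms.isHomogeneous_ofForm b) ⟨_, T.secondCommutator_ofVector_ofForm hrank Ω α y b⟩)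
      (fun _ _ _ _ _ _ h h' => h.mul hc h') (fun _ _ _ h h' => h.add h')
  exact PolyForms.of_induction (fun r b => IsSecondOrderAt.symm hc
      (PolyForms.isHomogeneous_ofForm b) (PolyForms.isHomogeneous_of q p f) (h2 r b q p f))
    (fun x => IsSecondOrderAt.symm hc
      (PolyForms.isHomogeneous_ofVector x) (PolyForms.isHomogeneous_of q p f) (h1 x q p f))
    (fun _ _ _ _ _ _ h h' => h.mul hc h') (fun _ _ _ h h' => h.add h') r s g

end AlmostTwilled

/-! ### From deviations to Gerstenhaber brackets. -/

section Operators

variable {V : Type*} [AddCommGroup V] {μ : V →+ V →+ V} {u : V} {H : ℕ → V → Prop}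
  {D : AddMonoid.End V}

theorem deviation_zsmul_right (i : ℕ) (a b : V) (c : ℤ) :
    deviation μ D i a (c • b) = c • deviation μ D i a b := by
  simp only [deviation, map_zsmul, smul_sub, smul_comm c]

theorem deviation_zsmul_left (i : ℕ) (a b : V) (c : ℤ) :
    deviation μ D i (c • a) b = c • deviation μ D i a b := by
  simp only [deviation, map_zsmul, smul_sub, smul_comm c, AddMonoidHom.coe_smul, Pi.smul_apply]

/-- The factor `(-1)^i` turns the graded symmetry of the deviation into antisymmetry for degrees
lowered by one. -/
theorem bracket_antisymm (h : IsGradedCommMul μ u H) (hDH : ∀ i a, H i a → H (i + 1) (D a))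
    {B : V → V → V} (hB : ∀ i a b, H i a → B a b = (-1 : ℤ) ^ i • deviation μ D i a b)
    {i j : ℕ} {a b : V} (ha : H i a) (hb : H j b) :
    B a b = -((-1 : ℤ) ^ ((i + 1) * (j + 1)) • B b a) := by
  rw [hB i a b ha, hB j b a hb, deviation_symm h hDH ha hb, smul_smul, smul_smul, ← neg_smul]
  congr 1
  rw [show (i + 1) * (j + 1) = i * j + i + j + 1 by ring]
  simp only [pow_add, pow_one]
  rcases neg_one_pow_eq_or ℤ (i * j) with hg | hg <;>
  rcases neg_one_pow_eq_or ℤ j with hj | hj <;> rw [hg, hj] <;> simp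

theorem bracket_mul (h : IsGradedCommMul μ u H) (hu : D u = 0)
    (hDH : ∀ i a, H i a → H (i + 1) (D a))
    (hso : ∀ i j a b, H i a → H j b → IsSecondOrderAt μ D i a j b)
    {B : V → V → V} (hB : ∀ i a b, H i a → B a b = (-1 : ℤ) ^ i • deviation μ D i a b)
    {i j : ℕ} {a b : V} (ha : H i a) (hb : H j b) (c : V) :
    B a (μ b c) = μ (B a b) c + (-1 : ℤ) ^ ((i + 1) * j) • μ b (B a c) := by
  rw [hB i _ _ ha, hB i _ _ ha, hB i _ _ ha, deviation_mul h hu hDH ha hb (hso i j a b ha hb),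
    smul_add, map_zsmul, map_zsmul, smul_comm]
  rfl

theorem bracket_jacobi (h : IsGradedCommMul μ u H) (hu : D u = 0) (hDD : ∀ m, D (D m) = 0)
    (hDH : ∀ i a, H i a → H (i + 1) (D a))
    (hso : ∀ i j a b, H i a → H j b → IsSecondOrderAt μ D i a j b)
    {B : V → V → V} (hB : ∀ i a b, H i a → B a b = (-1 : ℤ) ^ i • deviation μ D i a b)
    {i j : ℕ} {a b : V} (ha : H i a) (hb : H j b) (hab : H (i + j + 1) (B a b)) (c : V) :
    B a (B b c) = B (B a b) c + (-1 : ℤ) ^ ((i + 1) * (j + 1)) • B b (B a c) := by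
  rw [hB _ _ c hab, hB i a _ ha, hB j b c hb, hB j b _ hb, hB i a c ha, hB i a b ha,
    deviation_zsmul_right, deviation_zsmul_right, deviation_zsmul_left, smul_smul,
    deviation_jacobi h hu hDD hDH hso ha hb, smul_smul, smul_smul, smul_smul, sub_eq_add_neg,
    ← neg_smul]
  congr 2
  · rw [pow_add, pow_add]
    rcases neg_one_pow_eq_or ℤ i with hg | hg <;> rw [hg] <;> simp
  · rw [show (i + 1) * (j + 1) = i * j + i + j + 1 by ring]
    simp only [pow_add, pow_one]
    rcases neg_one_pow_eq_or ℤ i with hg | hg <;>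
    rcases neg_one_pow_eq_or ℤ j with hj | hj <;> rw [hg, hj] <;> simp

end Operators

namespace PolyForms

variable {R A L₁ L₂ : Type*} [CommRing R] [CommRing A] [Algebra R A]
  [AddCommGroup L₁] [Module R L₁] [Module A L₁] [IsScalarTower R A L₁]
  [AddCommGroup L₂] [Module A L₂]

local notation "of₁₂" => BiForms.of (A := A) (L := L₂) (M := fun p => ⋀[A]^p L₁)

variable (R A L₁ L₂) in
/-- The operator which multiplies elements of total degree `i` by `(-1)^i`. -/
noncomputable def sgn : PolyForms A L₁ L₂ →ₗ[R] PolyForms A L₁ L₂ :=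
  DirectSum.toModule R (ℕ × ℕ) _ fun d =>
    (-1 : ℤ) ^ (d.1 + d.2) • (of₁₂ d.1 d.2).restrictScalars R

theorem sgn_of (q p : ℕ) (f : L₂ [⋀^Fin q]→ₗ[A] ⋀[A]^p L₁) :
    sgn R A L₁ L₂ (of₁₂ q p f) = (-1 : ℤ) ^ (q + p) • of₁₂ q p f := by
  rw [sgn, BiForms.of]
  erw [DirectSum.toModule_lof]
  rfl

theorem mul_rsmul (r : R) (a b : PolyForms A L₁ L₂) : mul a (r • b) = r • mul a b :=
  map_smul ((mul a).restrictScalars R) r b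

theorem rsmul_mul (r : R) (a b : PolyForms A L₁ L₂) : mul (r • a) b = r • mul a b :=
  map_smul ((mul.flip b).restrictScalars R) r a

/-- The bracket generated by an operator. -/
noncomputable def bracketOf (D : PolyForms A L₁ L₂ →ₗ[R] PolyForms A L₁ L₂) :
    PolyForms A L₁ L₂ →ₗ[R] PolyForms A L₁ L₂ →ₗ[R] PolyForms A L₁ L₂ :=
  -- The operator `sgn` supplies the sign `(-1)^|a|` linearly in `a`. In the last term the two
  -- factors `(-1)^|a|` of the defining formula have cancelled.
  LinearMap.mk₂ R (fun a b => D (mul (sgn R A L₁ L₂ a) b) - mul (D (sgn R A L₁ L₂ a)) b - mul a (D b))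
    (fun a a' b => by
      rw [map_add (sgn R A L₁ L₂), map_add D, add_mul, add_mul, add_mul, map_add D]
      abel)
    (fun r a b => by simp only [map_smul, rsmul_mul, smul_sub])
    (fun a b b' => by simp only [map_add]; abel)
    (fun r a b => by simp only [map_smul, mul_rsmul, smul_sub])

theorem bracketOf_apply (D : PolyForms A L₁ L₂ →ₗ[R] PolyForms A L₁ L₂) (a b : PolyForms A L₁ L₂) :
    bracketOf D a b = D (mul (sgn R A L₁ L₂ a) b) - mul (D (sgn R A L₁ L₂ a)) b - mul a (D b) := rfl

theorem bracketOf_of (D : PolyForms A L₁ L₂ →ₗ[R] PolyForms A L₁ L₂) (q p : ℕ)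
    (f : L₂ [⋀^Fin q]→ₗ[A] ⋀[A]^p L₁) (b : PolyForms A L₁ L₂) :
    bracketOf D (of₁₂ q p f) b = (-1 : ℤ) ^ (q + p) • (D (mul (of₁₂ q p f) b) -
      mul (D (of₁₂ q p f)) b - (-1 : ℤ) ^ (q + p) • mul (of₁₂ q p f) (D b)) := by
  rw [bracketOf_apply, sgn_of, zsmul_mul, map_zsmul, map_zsmul, zsmul_mul, smul_sub, smul_sub,
    neg_one_pow_smul_smul]

theorem bracketOf_eq (D : PolyForms A L₁ L₂ →ₗ[R] PolyForms A L₁ L₂) (i : ℕ)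
    (a b : PolyForms A L₁ L₂) (ha : IsHomogeneous i a) : bracketOf D a b =
      (-1 : ℤ) ^ i • deviation (mulHom A L₁ L₂) D.toAddMonoidHom i a b := by
  obtain ⟨q, p, f, hi, rfl⟩ := ha
  rw [bracketOf_of, neg_one_pow_eq_of_even_iff hi]
  rfl

variable (A L₁ L₂) in
/-- The elements of bidegree `(q, p)`. -/
noncomputable def component (q p : ℕ) : Submodule A (PolyForms A L₁ L₂) :=
  LinearMap.range (of₁₂ q p)

theorem of_mem_component (q p : ℕ) (f : L₂ [⋀^Fin q]→ₗ[A] ⋀[A]^p L₁) :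
    of₁₂ q p f ∈ component A L₁ L₂ q p := ⟨f, rfl⟩

theorem zsmul_mem_component {q p : ℕ} {a : PolyForms A L₁ L₂} (c : ℤ)
    (ha : a ∈ component A L₁ L₂ q p) : c • a ∈ component A L₁ L₂ q p :=
  (component A L₁ L₂ q p).toAddSubgroup.zsmul_mem ha c

theorem mul_mem_component {q p r s : ℕ} {a b : PolyForms A L₁ L₂}
    (ha : a ∈ component A L₁ L₂ q p) (hb : b ∈ component A L₁ L₂ r s) :
    mul a b ∈ component A L₁ L₂ (q + r) (p + s) := by
  obtain ⟨f, rfl⟩ := ha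
  obtain ⟨g, rfl⟩ := hb
  rw [mul_of_of]
  exact zsmul_mem_component _ (of_mem_component _ _ _)

end PolyForms

/-! ### The crossed product bracket, generated by a divergence operator. -/

namespace AlmostTwilled

variable {R A L₁ L₂ : Type*} [CommRing R] [CommRing A] [Algebra R A]
  [LieRing L₁] [LieAlgebra R L₁] [Module A L₁] [LieRingModule L₁ A] [LieRinehartRing A L₁]
  [LieRinehartAlgebra R A L₁]
  [LieRing L₂] [LieAlgebra R L₂] [Module A L₂] [LieRingModule L₂ A] [LieRinehartRing A L₂]
  [LieRinehartAlgebra R A L₂] [Module.Finite A L₁] [Module.Projective A L₁] {n : ℕ}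
  (T : AlmostTwilled R A L₁ L₂)
  (hrank : ∀ P : PrimeSpectrum A, Module.rankAtStalk L₁ P = n) (Ω : ⋀[A]^n L₁ ≃ₗ[A] A)
  (α : L₁ →ₗ[A] A)

local notation "of₁₂" => BiForms.of (A := A) (L := L₂) (M := fun p => ⋀[A]^p L₁)

theorem divergence_eq_zero {q : ℕ} {a : PolyForms A L₁ L₂}
    (ha : a ∈ PolyForms.component A L₁ L₂ q 0) : T.divergence hrank Ω α a = 0 := by
  obtain ⟨f, rfl⟩ := ha
  exact T.divergence_of_zero hrank Ω α f

theorem divergence_mem_component {q p : ℕ} {a : PolyForms A L₁ L₂}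
    (ha : a ∈ PolyForms.component A L₁ L₂ q (p + 1)) :
    T.divergence hrank Ω α a ∈ PolyForms.component A L₁ L₂ q p := by
  obtain ⟨f, rfl⟩ := ha
  obtain ⟨g, hg⟩ := T.exists_divergence_of_succ hrank Ω α f
  exact ⟨g, hg.symm⟩

/-- The bracket generated by `divergence`. -/
noncomputable def divergenceBracket :
    PolyForms A L₁ L₂ →ₗ[R] PolyForms A L₁ L₂ →ₗ[R] PolyForms A L₁ L₂ :=
  PolyForms.bracketOf (T.divergence hrank Ω α)

theorem divergenceBracket_eq (i : ℕ) (a b : PolyForms A L₁ L₂) (ha : PolyForms.IsHomogeneous i a) :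
    T.divergenceBracket hrank Ω α a b = (-1 : ℤ) ^ i •
      deviation (PolyForms.mulHom A L₁ L₂) (T.divergenceEnd hrank Ω α) i a b :=
  PolyForms.bracketOf_eq _ i a b ha

theorem divergenceBracket_mem_component {q p r s m : ℕ} (h : p + s = m + 1)
    (f : L₂ [⋀^Fin q]→ₗ[A] ⋀[A]^p L₁) (g : L₂ [⋀^Fin r]→ₗ[A] ⋀[A]^s L₁) :
    T.divergenceBracket hrank Ω α (of₁₂ q p f) (of₁₂ r s g) ∈
      PolyForms.component A L₁ L₂ (q + r) m := by
  rw [divergenceBracket, PolyForms.bracketOf_of]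
  refine PolyForms.zsmul_mem_component _ (sub_mem (sub_mem ?_ ?_)
    (PolyForms.zsmul_mem_component _ ?_))
  · refine T.divergence_mem_component hrank Ω α ?_
    rw [← h]
    exact PolyForms.mul_mem_component (PolyForms.of_mem_component _ _ _)
      (PolyForms.of_mem_component _ _ _)
  · rcases p with _ | p
    · rw [divergence_of_zero, PolyForms.zero_mul']
      exact zero_mem _
    · obtain rfl : m = p + s := by omega
      exact PolyForms.mul_mem_component (T.divergence_mem_component hrank Ω α
        (PolyForms.of_mem_component _ _ _)) (PolyForms.of_mem_component _ _ _)
  · rcases s with _ | s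
    · rw [divergence_of_zero, PolyForms.mul_zero']
      exact zero_mem _
    · obtain rfl : m = p + s := by omega
      exact PolyForms.mul_mem_component (PolyForms.of_mem_component _ _ _)
        (T.divergence_mem_component hrank Ω α (PolyForms.of_mem_component _ _ _))

theorem divergenceBracket_eq_zero {q r : ℕ}
    (f : L₂ [⋀^Fin q]→ₗ[A] ⋀[A]^0 L₁) (g : L₂ [⋀^Fin r]→ₗ[A] ⋀[A]^0 L₁) :
    T.divergenceBracket hrank Ω α (of₁₂ q 0 f) (of₁₂ r 0 g) = 0 := by
  have hm := PolyForms.mul_mem_component (PolyForms.of_mem_component q 0 f)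
    (PolyForms.of_mem_component r 0 g)
  rw [Nat.add_zero 0] at hm
  rw [divergenceBracket, PolyForms.bracketOf_of, divergence_of_zero, divergence_of_zero,
    PolyForms.zero_mul', PolyForms.mul_zero', smul_zero, sub_zero, sub_zero,
    divergence_eq_zero T hrank Ω α hm, smul_zero]

theorem isHomogeneous_divergenceBracket {q p r s : ℕ}
    (f : L₂ [⋀^Fin q]→ₗ[A] ⋀[A]^p L₁) (g : L₂ [⋀^Fin r]→ₗ[A] ⋀[A]^s L₁) :
    PolyForms.IsHomogeneous (q + p + (r + s) + 1)
      (T.divergenceBracket hrank Ω α (of₁₂ q p f) (of₁₂ r s g)) := by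
  rcases h : p + s with _ | m
  · obtain rfl : p = 0 := by omega
    obtain rfl : s = 0 := by omega
    exact ⟨_, 0, 0, Iff.rfl, by rw [divergenceBracket_eq_zero, map_zero]⟩
  · obtain ⟨k, hk⟩ := T.divergenceBracket_mem_component hrank Ω α h f g
    refine ⟨q + r, m, k, ?_, hk.symm⟩
    rw [show q + p + (r + s) + 1 = q + r + m + 1 + 1 by omega, Nat.even_add_one, Nat.even_add_one,
      not_not]

theorem divergenceBracket_ofVector_ofVector (x y : L₁) :
    T.divergenceBracket hrank Ω α (PolyForms.ofVector L₂ x) (PolyForms.ofVector L₂ y) =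
      PolyForms.ofVector L₂ ⁅x, y⁆ := by
  rw [divergenceBracket_eq _ _ _ _ 1 _ _ (PolyForms.isHomogeneous_ofVector x),
    deviation_eq PolyForms.isGradedCommMul (T.divergenceEnd_one hrank Ω α)
      (T.isHomogeneous_divergenceEnd hrank Ω α) (PolyForms.isHomogeneous_ofVector x)
      (PolyForms.isHomogeneous_ofVector y) (T.secondCommutator_ofVector_ofVector hrank Ω α x y),
    pow_one, neg_one_smul, neg_neg]

theorem divergenceBracket_ofVector_ofForm (x : L₁) {r : ℕ} (b : L₂ [⋀^Fin r]→ₗ[A] A) :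
    T.divergenceBracket hrank Ω α (PolyForms.ofVector L₂ x) (PolyForms.ofForm L₁ b) =
      PolyForms.ofForm L₁ (T.actForm x b) := by
  rw [divergenceBracket_eq _ _ _ _ 1 _ _ (PolyForms.isHomogeneous_ofVector x),
    deviation_eq PolyForms.isGradedCommMul (T.divergenceEnd_one hrank Ω α)
      (T.isHomogeneous_divergenceEnd hrank Ω α) (PolyForms.isHomogeneous_ofVector x)
      (PolyForms.isHomogeneous_ofForm b) (T.secondCommutator_ofVector_ofForm hrank Ω α x b),
    pow_one, neg_one_smul, neg_neg]

theorem divergenceBracket_antisymm {q p r s : ℕ}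
    (f : L₂ [⋀^Fin q]→ₗ[A] ⋀[A]^p L₁) (g : L₂ [⋀^Fin r]→ₗ[A] ⋀[A]^s L₁) :
    T.divergenceBracket hrank Ω α (of₁₂ q p f) (of₁₂ r s g) =
      -((-1 : ℤ) ^ ((q + p + 1) * (r + s + 1)) •
        T.divergenceBracket hrank Ω α (of₁₂ r s g) (of₁₂ q p f)) :=
  bracket_antisymm PolyForms.isGradedCommMul (T.isHomogeneous_divergenceEnd hrank Ω α)
    (T.divergenceBracket_eq hrank Ω α) (PolyForms.isHomogeneous_of q p f)
    (PolyForms.isHomogeneous_of r s g)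

theorem divergenceBracket_mul {q p r s : ℕ}
    (f : L₂ [⋀^Fin q]→ₗ[A] ⋀[A]^p L₁) (g : L₂ [⋀^Fin r]→ₗ[A] ⋀[A]^s L₁) (c : PolyForms A L₁ L₂) :
    T.divergenceBracket hrank Ω α (of₁₂ q p f) (PolyForms.mul (of₁₂ r s g) c) =
      PolyForms.mul (T.divergenceBracket hrank Ω α (of₁₂ q p f) (of₁₂ r s g)) c +
      (-1 : ℤ) ^ ((q + p + 1) * (r + s)) •
        PolyForms.mul (of₁₂ r s g) (T.divergenceBracket hrank Ω α (of₁₂ q p f) c) :=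
  bracket_mul PolyForms.isGradedCommMul (T.divergenceEnd_one hrank Ω α)
    (T.isHomogeneous_divergenceEnd hrank Ω α) (T.isSecondOrderAt_divergenceEnd hrank Ω α)
    (T.divergenceBracket_eq hrank Ω α) (PolyForms.isHomogeneous_of q p f)
    (PolyForms.isHomogeneous_of r s g) c

theorem divergenceBracket_jacobi (h : ∀ m, T.divergence hrank Ω α (T.divergence hrank Ω α m) = 0)
    {q p r s : ℕ}
    (f : L₂ [⋀^Fin q]→ₗ[A] ⋀[A]^p L₁) (g : L₂ [⋀^Fin r]→ₗ[A] ⋀[A]^s L₁) (c : PolyForms A L₁ L₂) :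
    T.divergenceBracket hrank Ω α (of₁₂ q p f) (T.divergenceBracket hrank Ω α (of₁₂ r s g) c) =
      T.divergenceBracket hrank Ω α (T.divergenceBracket hrank Ω α (of₁₂ q p f) (of₁₂ r s g)) c +
      (-1 : ℤ) ^ ((q + p + 1) * (r + s + 1)) •
        T.divergenceBracket hrank Ω α (of₁₂ r s g) (T.divergenceBracket hrank Ω α (of₁₂ q p f) c) :=
  bracket_jacobi PolyForms.isGradedCommMul (T.divergenceEnd_one hrank Ω α) h
    (T.isHomogeneous_divergenceEnd hrank Ω α) (T.isSecondOrderAt_divergenceEnd hrank Ω α)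
    (T.divergenceBracket_eq hrank Ω α) (PolyForms.isHomogeneous_of q p f)
    (PolyForms.isHomogeneous_of r s g) (T.isHomogeneous_divergenceBracket hrank Ω α f g) c

/-- The bracket generated by `divergence` is the crossed product bracket. -/
theorem isCrossedProductBracket_divergenceBracket
    (h : ∀ m, T.divergence hrank Ω α (T.divergence hrank Ω α m) = 0) :
    T.IsCrossedProductBracket (T.divergenceBracket hrank Ω α) where
  gerstenhaber :=
    { bidegree := fun _ _ _ _ _ f g hm => by
        obtain ⟨k, hk⟩ := T.divergenceBracket_mem_component hrank Ω α hm f g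
        exact ⟨k, hk.symm⟩
      bidegree_zero := fun _ _ f g => T.divergenceBracket_eq_zero hrank Ω α f g
      antisymm := fun _ _ _ _ f g => T.divergenceBracket_antisymm hrank Ω α f g
      jacobi := fun _ _ _ _ f g c => T.divergenceBracket_jacobi hrank Ω α h f g c
      derivation := fun _ _ _ _ f g c => T.divergenceBracket_mul hrank Ω α f g c }
  lie := T.divergenceBracket_ofVector_ofVector hrank Ω α
  action := fun x _ b => T.divergenceBracket_ofVector_ofForm hrank Ω α x b

theorem isGenerator_divergence : IsGenerator (T.divergenceBracket hrank Ω α)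
    (T.divergence hrank Ω α) where
  bidegree _ _ f := T.exists_divergence_of_succ hrank Ω α f
  bidegree_zero _ f := T.divergence_of_zero hrank Ω α f
  generates _ _ _ _ f _ := PolyForms.bracketOf_of _ _ _ f _

end AlmostTwilled

/-! ### Brackets and generators are determined on generators of the algebra. -/

namespace PolyForms

variable {R A L₁ L₂ : Type*} [CommRing R] [CommRing A] [Algebra R A]
  [AddCommGroup L₁] [Module R L₁] [Module A L₁] [IsScalarTower R A L₁]
  [AddCommGroup L₂] [Module A L₂] [Module.Finite A L₁] [Module.Projective A L₁]

local notation "of₁₂" => BiForms.of (A := A) (L := L₂) (M := fun p => ⋀[A]^p L₁)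

/-- Graded antisymmetric bilinear maps which are graded derivations in each variable, and which
vanish on scalar forms. -/
structure IsBiderivation
    (B : PolyForms A L₁ L₂ →ₗ[R] PolyForms A L₁ L₂ →ₗ[R] PolyForms A L₁ L₂) : Prop where
  zero : ∀ (q r : ℕ) (f : L₂ [⋀^Fin q]→ₗ[A] ⋀[A]^0 L₁) (g : L₂ [⋀^Fin r]→ₗ[A] ⋀[A]^0 L₁),
    B (of₁₂ q 0 f) (of₁₂ r 0 g) = 0
  antisymm : ∀ (q p r s : ℕ) (f : L₂ [⋀^Fin q]→ₗ[A] ⋀[A]^p L₁) (g : L₂ [⋀^Fin r]→ₗ[A] ⋀[A]^s L₁),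
    B (of₁₂ q p f) (of₁₂ r s g) =
      -((-1 : ℤ) ^ ((q + p + 1) * (r + s + 1)) • B (of₁₂ r s g) (of₁₂ q p f))
  derivation : ∀ (q p r s : ℕ) (f : L₂ [⋀^Fin q]→ₗ[A] ⋀[A]^p L₁)
    (g : L₂ [⋀^Fin r]→ₗ[A] ⋀[A]^s L₁) (c : PolyForms A L₁ L₂),
    B (of₁₂ q p f) (PolyForms.mul (of₁₂ r s g) c) =
      PolyForms.mul (B (of₁₂ q p f) (of₁₂ r s g)) c +
      (-1 : ℤ) ^ ((q + p + 1) * (r + s)) • PolyForms.mul (of₁₂ r s g) (B (of₁₂ q p f) c)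

variable {B B' : PolyForms A L₁ L₂ →ₗ[R] PolyForms A L₁ L₂ →ₗ[R] PolyForms A L₁ L₂}

omit [Module.Finite A L₁] [Module.Projective A L₁] in
theorem _root_.IsGerstenhaberBracket.isBiderivation (h : IsGerstenhaberBracket B) :
    IsBiderivation B := ⟨h.bidegree_zero, h.antisymm, h.derivation⟩

/-- With the left argument fixed, the right arguments on which the two maps agree are closed under
products and sums. -/
theorem IsBiderivation.eq_of_eq (h : IsBiderivation B) (h' : IsBiderivation B') {q p : ℕ}
    (f : L₂ [⋀^Fin q]→ₗ[A] ⋀[A]^p L₁)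
    (hx : ∀ x, B (of₁₂ q p f) (ofVector L₂ x) = B' (of₁₂ q p f) (ofVector L₂ x))
    (hb : ∀ (r : ℕ) (b : L₂ [⋀^Fin r]→ₗ[A] A),
      B (of₁₂ q p f) (ofForm L₁ b) = B' (of₁₂ q p f) (ofForm L₁ b)) (r s : ℕ)
    (g : L₂ [⋀^Fin r]→ₗ[A] ⋀[A]^s L₁) :
    B (of₁₂ q p f) (of₁₂ r s g) = B' (of₁₂ q p f) (of₁₂ r s g) :=
  of_induction (motive := fun _ a => B (of₁₂ q p f) a = B' (of₁₂ q p f) a) hb hx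
    (fun _ _ _ _ g g' e e' => by rw [h.derivation, h'.derivation, e, e'])
    (fun _ a b e e' => by rw [map_add, map_add, e, e']) r s g

/-- A biderivation is determined by its values on the generators. -/
theorem IsBiderivation.ext (h : IsBiderivation B) (h' : IsBiderivation B')
    (hxy : ∀ x y, B (ofVector L₂ x) (ofVector L₂ y) = B' (ofVector L₂ x) (ofVector L₂ y))
    (hxb : ∀ x (r : ℕ) (b : L₂ [⋀^Fin r]→ₗ[A] A),
      B (ofVector L₂ x) (ofForm L₁ b) = B' (ofVector L₂ x) (ofForm L₁ b)) : B = B' := by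
  -- Antisymmetry moves a known generator to the other side, so the extension can be carried out in
  -- one argument and then in the other.
  have swap : ∀ {q p r s : ℕ} (f : L₂ [⋀^Fin q]→ₗ[A] ⋀[A]^p L₁) (g : L₂ [⋀^Fin r]→ₗ[A] ⋀[A]^s L₁),
      B (of₁₂ r s g) (of₁₂ q p f) = B' (of₁₂ r s g) (of₁₂ q p f) →
      B (of₁₂ q p f) (of₁₂ r s g) = B' (of₁₂ q p f) (of₁₂ r s g) := fun f g e => by
    rw [h.antisymm, h'.antisymm, e]
  have h1 : ∀ x (r s : ℕ) (g : L₂ [⋀^Fin r]→ₗ[A] ⋀[A]^s L₁),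
      B (ofVector L₂ x) (of₁₂ r s g) = B' (ofVector L₂ x) (of₁₂ r s g) := fun x =>
    h.eq_of_eq h' _ (hxy x) (hxb x)
  have h2 : ∀ (k : ℕ) (b : L₂ [⋀^Fin k]→ₗ[A] A) (r s : ℕ) (g : L₂ [⋀^Fin r]→ₗ[A] ⋀[A]^s L₁),
      B (ofForm L₁ b) (of₁₂ r s g) = B' (ofForm L₁ b) (of₁₂ r s g) := fun k b =>
    h.eq_of_eq h' _ (fun x => swap _ _ (hxb x k b))
      (fun r b' => (h.zero _ _ _ _).trans (h'.zero _ _ _ _).symm)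
  refine BiForms.addHom_ext fun q p f => ?_
  refine BiForms.addHom_ext fun r s g => ?_
  exact h.eq_of_eq h' f (fun x => swap _ _ (h1 x q p f)) (fun k b => swap _ _ (h2 k b q p f)) r s g

/-- A generator of a bracket is determined by its values on `L₁`. -/
theorem _root_.IsGenerator.ext {D D' : PolyForms A L₁ L₂ →ₗ[R] PolyForms A L₁ L₂}
    (h : IsGenerator B D) (h' : IsGenerator B D')
    (hx : ∀ x, D (ofVector L₂ x) = D' (ofVector L₂ x)) : D = D' := by
  refine BiForms.addHom_ext fun q p f => ?_
  refine of_induction (motive := fun _ a => D a = D' a)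
    (fun r b => (h.bidegree_zero _ _).trans (h'.bidegree_zero _ _).symm) hx ?_
    (fun _ a b e e' => by rw [map_add, map_add, e, e']) q p f
  intro q p r s f g e e'
  have e1 := (h.generates q p r s f g).symm.trans (h'.generates q p r s f g)
  -- Once the operators agree on both factors, the generating identity leaves their values on the
  -- product as the only unknown terms.
  rw [e, e'] at e1
  have e2 := congrArg (fun m => (-1 : ℤ) ^ (q + p) • m) e1
  simp only [neg_one_pow_smul_smul] at e2
  exact sub_left_injective (sub_left_injective e2)

omit [Module.Finite A L₁] [Module.Projective A L₁] in
theorem exists_smul_ιMulti_zero (u : ⋀[A]^0 L₁) : ∃ a : A, u = a • exteriorPower.ιMulti A 0 ![] := by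
  induction u using exteriorPower.induction with
  | ιMulti v => exact ⟨1, by rw [one_smul, Subsingleton.elim v ![]]⟩
  | add u w hu hw =>
    obtain ⟨a, rfl⟩ := hu
    obtain ⟨b, rfl⟩ := hw
    exact ⟨a + b, (add_smul a b _).symm⟩
  | smul c u hu =>
    obtain ⟨a, rfl⟩ := hu
    exact ⟨c * a, (mul_smul c a _).symm⟩

omit [Module.Finite A L₁] [Module.Projective A L₁] in
theorem exists_smul_one {a : PolyForms A L₁ L₂} (ha : a ∈ component A L₁ L₂ 0 0) :
    ∃ c : A, a = c • one := by
  obtain ⟨f, rfl⟩ := ha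
  obtain ⟨c, hc⟩ := exists_smul_ιMulti_zero (f ![])
  refine ⟨c, ?_⟩
  rw [one, ← map_smul]
  congr 1
  ext v : 1
  rw [Subsingleton.elim v ![], hc]
  rfl

omit [Module.Finite A L₁] [Module.Projective A L₁] in
theorem ofForm_const_mul (c : A) (m : PolyForms A L₁ L₂) :
    mul (ofForm L₁ (AlternatingMap.constOfIsEmpty A L₂ (Fin 0) c)) m = c • m := by
  have h : ofForm L₁ (AlternatingMap.constOfIsEmpty A L₂ (Fin 0) c) = c • one := by
    rw [one_eq_ofForm, ofForm, ofForm, ← map_smul]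
    congr 1
    ext v : 1
    simp
  rw [h, map_smul, LinearMap.smul_apply, one_mul']

omit [Module.Finite A L₁] [Module.Projective A L₁] in
theorem ofVector_add (x y : L₁) : ofVector (A := A) L₂ (x + y) = ofVector L₂ x + ofVector L₂ y := by
  rw [ofVector, ofVector, ofVector, ← map_add]
  congr 1
  ext v : 1
  refine Subtype.ext ?_
  simp [ExteriorAlgebra.ιMulti_succ_apply]

omit [Module.Finite A L₁] [Module.Projective A L₁] in
theorem ofVector_smul (c : A) (x : L₁) : ofVector (A := A) L₂ (c • x) = c • ofVector L₂ x := by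
  rw [ofVector, ofVector, ← map_smul]
  congr 1
  ext v : 1
  refine Subtype.ext ?_
  simp [ExteriorAlgebra.ιMulti_succ_apply]

omit [Module.Finite A L₁] [Module.Projective A L₁] in
theorem smul_one_injective {a b : A} (h : a • (one : PolyForms A L₁ L₂) = b • one) : a = b := by
  rw [one, ← map_smul, ← map_smul] at h
  have h1 := congrArg (fun f => ((f ![] : ⋀[A]^0 L₁) : ExteriorAlgebra A L₁))
    (BiForms.of_injective (M := fun p => ⋀[A]^p L₁) 0 0 h)
  have h2 : algebraMap A (ExteriorAlgebra A L₁) a = algebraMap A (ExteriorAlgebra A L₁) b := by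
    simpa [ExteriorAlgebra.ιMulti_zero_apply, Algebra.algebraMap_eq_smul_one] using h1
  exact ExteriorAlgebra.algebraMap_leftInverse L₁ |>.injective h2

end PolyForms

/-! ### Recovering the 1-form from its operator. -/

namespace MixedForms

variable (A L₁ L₂ : Type*) [CommRing A] [AddCommGroup L₁] [Module A L₁] [AddCommGroup L₂]
  [Module A L₂]

/-- The constant form `1`. -/
noncomputable def one : MixedForms A L₁ L₂ :=
  BiForms.of (A := A) (L := L₂) (M := fun k => L₁ [⋀^Fin k]→ₗ[A] A) 0 0
    (AlternatingMap.constOfIsEmpty A L₂ (Fin 0) (AlternatingMap.constOfIsEmpty A L₁ (Fin 0) 1))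

theorem one_apply :
    MixedForms.one A L₁ L₂ (0, 0) ![] ![] = 1 := by
  rw [MixedForms.one, MixedForms.of_apply_same]
  rfl

variable {L₁}

theorem ins_one (x : L₁) : MixedForms.ins x (MixedForms.one A L₁ L₂) = 0 :=
  MixedForms.ins_of_zero _ _ _

end MixedForms

namespace AlmostTwilled

section Unit

variable {R A L₁ L₂ : Type*} [CommRing R] [CommRing A] [Algebra R A]
  [LieRing L₁] [LieAlgebra R L₁] [Module A L₁] [LieRingModule L₁ A] [LieRinehartRing A L₁]
  [LieRinehartAlgebra R A L₁]
  [LieRing L₂] [LieAlgebra R L₂] [Module A L₂] [LieRingModule L₂ A] [LieRinehartRing A L₂]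
  [LieRinehartAlgebra R A L₂]

theorem _root_.LieRinehartRing.lie_one {A L : Type*} [CommRing A] [LieRing L] [Module A L]
    [LieRingModule L A] [LieRinehartRing A L] (x : L) : ⁅x, (1 : A)⁆ = 0 := by
  have h := LieRinehartRing.leibniz_mul_right x (1 : A) (1 : A)
  rw [mul_one, one_smul] at h
  simpa using h

variable (T : AlmostTwilled R A L₁ L₂)

theorem ins_dPrime (α : L₁ →ₗ[A] A) (x : L₁) (m : MixedForms A L₁ L₂) :
    MixedForms.ins x (T.dPrime α m) = T.opLie₁ α x m - T.dPrime α (MixedForms.ins x m) := by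
  change _ = T.dPrime α (MixedForms.ins x m) + MixedForms.ins x (T.dPrime α m) - _
  abel

theorem contr_dMixed (ξ : L₂) (m : MixedForms A L₁ L₂) :
    BiForms.contr ξ (T.dMixed m) = T.opLie₂ ξ m - T.dMixed (BiForms.contr ξ m) := by
  change _ = T.dMixed (BiForms.contr ξ m) + BiForms.contr ξ (T.dMixed m) - _
  abel

theorem ins_opLie₁ (α : L₁ →ₗ[A] A) (x y : L₁) (m : MixedForms A L₁ L₂) :
    MixedForms.ins y (T.opLie₁ α x m) =
      T.opLie₁ α x (MixedForms.ins y m) - MixedForms.ins ⁅x, y⁆ m :=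
  eq_sub_of_add_eq (LinearMap.congr_fun (T.opLie₁_mul_opIns α x y) m).symm

theorem ins_opLie₂ (ξ : L₂) (y : L₁) (m : MixedForms A L₁ L₂) :
    MixedForms.ins y (T.opLie₂ ξ m) =
      T.opLie₂ ξ (MixedForms.ins y m) - MixedForms.ins (T.act₂₁.toEnd ξ y) m :=
  eq_sub_of_add_eq (LinearMap.congr_fun (T.opLie₂_mul_opIns ξ y) m).symm

theorem contr_opLie₁ (α : L₁ →ₗ[A] A) (x : L₁) (η : L₂) (m : MixedForms A L₁ L₂) :
    BiForms.contr η (T.opLie₁ α x m) =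
      T.opLie₁ α x (BiForms.contr η m) - BiForms.contr (T.act₁₂.toEnd x η) m :=
  eq_sub_of_add_eq (LinearMap.congr_fun (T.opLie₁_mul_opContr α x η) m).symm

theorem ins_dPrime_one (α : L₁ →ₗ[A] A) (x : L₁) :
    MixedForms.ins x (T.dPrime α (MixedForms.one A L₁ L₂)) = T.opLie₁ α x (MixedForms.one A L₁ L₂) := by
  rw [ins_dPrime, MixedForms.ins_one, map_zero, sub_zero]

theorem contr_dMixed_one (ξ : L₂) : BiForms.contr ξ (T.dMixed (MixedForms.one A L₁ L₂)) =
    T.opLie₂ ξ (MixedForms.one A L₁ L₂) := by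
  rw [contr_dMixed, show BiForms.contr ξ (MixedForms.one A L₁ L₂) = 0 from
    MixedForms.contr_of_zero _ _ _, map_zero, sub_zero]

theorem opLie₁_one_apply (α : L₁ →ₗ[A] A) (x : L₁) :
    T.opLie₁ α x (MixedForms.one A L₁ L₂) (0, 0) ![] ![] = -α x := by
  rw [opLie₁_apply_zero, MixedForms.one_apply, LieRinehartRing.lie_one, mul_one, zero_sub]

theorem isClosedForm_zero : T.IsClosedForm 0 := by
  simp [IsClosedForm]

theorem isInvariantForm_zero : T.IsInvariantForm 0 := by
  simp [IsInvariantForm]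

/-- A 1-form is determined by its operator. -/
theorem eq_of_dPrime_eq {α β : L₁ →ₗ[A] A} (h : ∀ m, T.dPrime α m = T.dPrime β m) : α = β := by
  ext x
  have h1 : T.opLie₁ α x (MixedForms.one A L₁ L₂) = T.opLie₁ β x (MixedForms.one A L₁ L₂) := by
    rw [← ins_dPrime_one, ← ins_dPrime_one, h]
  have h2 := T.opLie₁_one_apply α x
  rw [h1, opLie₁_one_apply] at h2
  exact (neg_injective h2).symm

/-- Inserting `x` and `y` into `d'_α d'_α 1` gives the curvature of the connection on `A`, applied
to 1: the exterior derivative of α up to sign. -/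
theorem isClosedForm_of_dPrime_dPrime {α : L₁ →ₗ[A] A} (h : ∀ m, T.dPrime α (T.dPrime α m) = 0) :
    T.IsClosedForm α := by
  intro x y
  have h1 : MixedForms.ins y (MixedForms.ins x (T.dPrime α (T.dPrime α (MixedForms.one A L₁ L₂)))) =
      T.opLie₁ α x (T.opLie₁ α y (MixedForms.one A L₁ L₂)) -
        T.opLie₁ α ⁅x, y⁆ (MixedForms.one A L₁ L₂) -
        T.opLie₁ α y (T.opLie₁ α x (MixedForms.one A L₁ L₂)) := by
    rw [ins_dPrime, ins_dPrime_one, map_sub, ins_opLie₁, ins_dPrime_one, ins_dPrime_one, ins_dPrime,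
      ins_opLie₁, MixedForms.ins_one, MixedForms.ins_one, map_zero, sub_zero, map_zero, sub_zero]
  rw [h, map_zero, map_zero] at h1
  have h2 := congrArg (fun m : MixedForms A L₁ L₂ => m (0, 0) ![] ![]) h1
  have h3 : (0 : A) = T.opLie₁ α x (T.opLie₁ α y (MixedForms.one A L₁ L₂)) (0, 0) ![] ![] -
      T.opLie₁ α ⁅x, y⁆ (MixedForms.one A L₁ L₂) (0, 0) ![] ![] -
      T.opLie₁ α y (T.opLie₁ α x (MixedForms.one A L₁ L₂)) (0, 0) ![] ![] := h2
  rw [opLie₁_apply_zero, opLie₁_one_apply, opLie₁_one_apply, opLie₁_apply_zero, opLie₁_one_apply,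
    lie_neg, lie_neg] at h3
  linear_combination h3

/-- The anticommutator applied to 1 is evaluated on the pair `(ξ, x)`. All terms but two vanish
because vectors annihilate the constant 1; those left are `ξ (α x)` and `α (ξ · x)`, with opposite
signs. -/
theorem isInvariantForm_of_anticommute {α : L₁ →ₗ[A] A}
    (h : ∀ m, T.dMixed (T.dPrime α m) + T.dPrime α (T.dMixed m) = 0) : T.IsInvariantForm α := by
  intro ξ x
  have e₁ : MixedForms.ins x (T.dMixed (MixedForms.one A L₁ L₂)) = 0 := by
    rw [MixedForms.one, dMixed_of, map_zsmul, MixedForms.ins_of_zero, smul_zero]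
  have e₂ : BiForms.contr ξ (T.dPrime α (MixedForms.one A L₁ L₂)) = 0 := by
    rw [MixedForms.one, dPrime_of, map_zsmul, MixedForms.contr_of_zero, smul_zero]
  have hic : ∀ m : MixedForms A L₁ L₂,
      BiForms.contr ξ (MixedForms.ins x m) = -MixedForms.ins x (BiForms.contr ξ m) := fun m => by
    rw [MixedForms.ins_contr, neg_neg]
  have k₁ : BiForms.contr ξ (MixedForms.ins x (T.dMixed (T.dPrime α (MixedForms.one A L₁ L₂)))) =
      -(T.opLie₂ ξ (T.opLie₁ α x (MixedForms.one A L₁ L₂)) -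
        T.opLie₁ α (T.act₂₁.toEnd ξ x) (MixedForms.one A L₁ L₂)) := by
    rw [hic, contr_dMixed, e₂, map_zero, sub_zero, ins_opLie₂, ins_dPrime_one, ins_dPrime_one]
  have k₂ : BiForms.contr ξ (MixedForms.ins x (T.dPrime α (T.dMixed (MixedForms.one A L₁ L₂)))) =
      T.opLie₁ α x (T.opLie₂ ξ (MixedForms.one A L₁ L₂)) -
        T.opLie₂ (T.act₁₂.toEnd x ξ) (MixedForms.one A L₁ L₂) := by
    rw [ins_dPrime, e₁, map_zero, sub_zero, contr_opLie₁, contr_dMixed_one, contr_dMixed_one]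
  have h1 : BiForms.contr ξ (MixedForms.ins x (T.dMixed (T.dPrime α (MixedForms.one A L₁ L₂)) +
      T.dPrime α (T.dMixed (MixedForms.one A L₁ L₂)))) =
      -(T.opLie₂ ξ (T.opLie₁ α x (MixedForms.one A L₁ L₂)) -
        T.opLie₁ α (T.act₂₁.toEnd ξ x) (MixedForms.one A L₁ L₂)) +
      (T.opLie₁ α x (T.opLie₂ ξ (MixedForms.one A L₁ L₂)) -
        T.opLie₂ (T.act₁₂.toEnd x ξ) (MixedForms.one A L₁ L₂)) := by
    rw [map_add, map_add, k₁, k₂]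
  rw [h, map_zero, map_zero] at h1
  have h2 := congrArg (fun m : MixedForms A L₁ L₂ => m (0, 0) ![] ![]) h1
  have h3 : (0 : A) = -(T.opLie₂ ξ (T.opLie₁ α x (MixedForms.one A L₁ L₂)) (0, 0) ![] ![] -
        T.opLie₁ α (T.act₂₁.toEnd ξ x) (MixedForms.one A L₁ L₂) (0, 0) ![] ![]) +
      (T.opLie₁ α x (T.opLie₂ ξ (MixedForms.one A L₁ L₂)) (0, 0) ![] ![] -
        T.opLie₂ (T.act₁₂.toEnd x ξ) (MixedForms.one A L₁ L₂) (0, 0) ![] ![]) := h2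
  rw [opLie₂_apply_zero, opLie₁_one_apply, opLie₁_one_apply, opLie₁_apply_zero, opLie₂_apply_zero,
    opLie₂_apply_zero, MixedForms.one_apply, LieRinehartRing.lie_one, LieRinehartRing.lie_one,
    lie_zero, lie_neg, mul_zero] at h3
  linear_combination -h3

/-- The form α changes only the connection on `A`, by multiplication with `-α(x)`. -/
theorem opLie₁_eq (α : L₁ →ₗ[A] A) (x : L₁) (m : MixedForms A L₁ L₂) :
    T.opLie₁ α x m = T.opLie₁ 0 x m - α x • m := by
  induction m using BiForms.induction with
  | zero => rw [map_zero, map_zero, smul_zero, sub_zero]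
  | add m m' h h' => rw [map_add, map_add, h, h', smul_add]; abel
  | of q k f =>
    rw [opLie₁_of, opLie₁_of, ← map_smul, ← MixedForms.of_sub]
    congr 1
    rw [lieFlip_eq, lieFlip_eq]
    ext v w
    change (⁅x, f v w⁆ - α x * f v w - ∑ i, f v (update w i ⁅x, w i⁆)) - _ =
      (⁅x, f v w⁆ - 0 * f v w - ∑ i, f v (update w i ⁅x, w i⁆)) - _ - α x * f v w
    ring

end Unit

/-! ### Classification of the generators. -/

variable {R A L₁ L₂ : Type*} [CommRing R] [CommRing A] [Algebra R A]
  [LieRing L₁] [LieAlgebra R L₁] [Module A L₁] [LieRingModule L₁ A] [LieRinehartRing A L₁]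
  [LieRinehartAlgebra R A L₁]
  [LieRing L₂] [LieAlgebra R L₂] [Module A L₂] [LieRingModule L₂ A] [LieRinehartRing A L₂]
  [LieRinehartAlgebra R A L₂] [Module.Finite A L₁] [Module.Projective A L₁] {n : ℕ}
  (T : AlmostTwilled R A L₁ L₂)
  (hrank : ∀ P : PrimeSpectrum A, Module.rankAtStalk L₁ P = n) (Ω : ⋀[A]^n L₁ ≃ₗ[A] A)
  (α : L₁ →ₗ[A] A)

/-- As `divergence` kills 1, its value on `x` is its anticommutator with multiplication by `x`,
applied to 1. Under `flat` this is minus a Lie derivative of the image of 1, where α contributes by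
`opLie₁_eq`. -/
theorem divergence_ofVector :
    ∀ x : L₁, T.divergence hrank Ω α (PolyForms.ofVector L₂ x) =
      T.divergence hrank Ω 0 (PolyForms.ofVector L₂ x) + α x • PolyForms.one := by
  intro x
  have key : ∀ β : L₁ →ₗ[A] A, PolyForms.flat (Ω : ⋀[A]^n L₁ →ₗ[A] A)
      (T.divergence hrank Ω β (PolyForms.ofVector L₂ x)) =
      -T.opLie₁ β x (PolyForms.flat (Ω : ⋀[A]^n L₁ →ₗ[A] A) PolyForms.one) := by
    intro β
    have h0 : T.divergence hrank Ω β PolyForms.one = 0 := T.divergenceEnd_one hrank Ω β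
    have h := T.flat_divergence_ofVector_mul hrank Ω β x PolyForms.one
    rwa [h0, PolyForms.mul_one', PolyForms.mul_zero', smul_zero, sub_zero] at h
  apply PolyForms.flat_eq_imp_eq hrank Ω
  rw [map_add, key, key, map_smul, opLie₁_eq, neg_sub, sub_eq_add_neg, add_comm]

/-- On generators the bracket does not involve α, and biderivations are determined there. The Jacobi
identity is not needed, so the forms need be neither closed nor invariant. -/
theorem divergenceBracket_eq_of_form (β : L₁ →ₗ[A] A) :
    T.divergenceBracket hrank Ω α = T.divergenceBracket hrank Ω β := by
  have h : ∀ γ : L₁ →ₗ[A] A, PolyForms.IsBiderivation (T.divergenceBracket hrank Ω γ) := fun γ =>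
    ⟨fun _ _ f g => T.divergenceBracket_eq_zero hrank Ω γ f g,
      fun _ _ _ _ f g => T.divergenceBracket_antisymm hrank Ω γ f g,
      fun _ _ _ _ f g c => T.divergenceBracket_mul hrank Ω γ f g c⟩
  refine (h α).ext (h β) (fun x y => ?_) (fun x r b => ?_)
  · rw [divergenceBracket_ofVector_ofVector, divergenceBracket_ofVector_ofVector]
  · rw [divergenceBracket_ofVector_ofForm, divergenceBracket_ofVector_ofForm]

theorem IsCrossedProductBracket.unique
    {B B' : PolyForms A L₁ L₂ →ₗ[R] PolyForms A L₁ L₂ →ₗ[R] PolyForms A L₁ L₂}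
    (h : T.IsCrossedProductBracket B) (h' : T.IsCrossedProductBracket B') : B = B' :=
  h.gerstenhaber.isBiderivation.ext h'.gerstenhaber.isBiderivation
    (fun x y => (h.lie x y).trans (h'.lie x y).symm)
    (fun x r b => (h.action x r b).trans (h'.action x r b).symm)

/-- Every generator of the crossed product bracket is a divergence operator. -/
theorem exists_eq_divergence {D : PolyForms A L₁ L₂ →ₗ[R] PolyForms A L₁ L₂}
    (hD : IsGenerator (T.divergenceBracket hrank Ω 0) D) :
    ∃ α : L₁ →ₗ[A] A, D = T.divergence hrank Ω α := by
  have h₀ := T.isGenerator_divergence hrank Ω 0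
  -- Both operators send a vector to bidegree `(0, 0)`, which consists of the multiples of 1.
  have hc : ∀ x : L₁, ∃ c : A, D (PolyForms.ofVector L₂ x) -
      T.divergence hrank Ω 0 (PolyForms.ofVector L₂ x) = c • PolyForms.one := by
    intro x
    obtain ⟨f, hf⟩ := hD.bidegree 0 0 (AlternatingMap.constOfIsEmpty A L₂ (Fin 0)
      (exteriorPower.ιMulti A 1 ![x]))
    obtain ⟨g, hg⟩ := h₀.bidegree 0 0 (AlternatingMap.constOfIsEmpty A L₂ (Fin 0)
      (exteriorPower.ιMulti A 1 ![x]))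
    refine PolyForms.exists_smul_one (sub_mem ?_ ?_)
    · exact ⟨f, hf.symm⟩
    · exact ⟨g, hg.symm⟩
  choose c hc using hc
  -- The failure of a generator to be `A`-linear on `L₁` is a value of the bracket, the same for all
  -- generators; hence the difference of two generators is `A`-linear there.
  have hsmul : ∀ {D : PolyForms A L₁ L₂ →ₗ[R] PolyForms A L₁ L₂},
      IsGenerator (T.divergenceBracket hrank Ω 0) D → ∀ (a : A) (x : L₁),
      D (PolyForms.ofVector L₂ (a • x)) = T.divergenceBracket hrank Ω 0
        (PolyForms.ofForm L₁ (AlternatingMap.constOfIsEmpty A L₂ (Fin 0) a))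
        (PolyForms.ofVector L₂ x) + a • D (PolyForms.ofVector L₂ x) := by
    intro D hD a x
    have h : T.divergenceBracket hrank Ω 0
        (PolyForms.ofForm L₁ (AlternatingMap.constOfIsEmpty A L₂ (Fin 0) a))
        (PolyForms.ofVector L₂ x) = (-1 : ℤ) ^ (0 + 0) • (D (PolyForms.mul
          (PolyForms.ofForm L₁ (AlternatingMap.constOfIsEmpty A L₂ (Fin 0) a))
          (PolyForms.ofVector L₂ x)) - PolyForms.mul (D (PolyForms.ofForm L₁
            (AlternatingMap.constOfIsEmpty A L₂ (Fin 0) a))) (PolyForms.ofVector L₂ x) -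
          (-1 : ℤ) ^ (0 + 0) • PolyForms.mul
          (PolyForms.ofForm L₁ (AlternatingMap.constOfIsEmpty A L₂ (Fin 0) a))
          (D (PolyForms.ofVector L₂ x))) := hD.generates 0 0 0 1 _ _
    have h' : D (PolyForms.ofForm L₁ (AlternatingMap.constOfIsEmpty A L₂ (Fin 0) a)) = 0 :=
      hD.bidegree_zero 0 _
    rw [h', PolyForms.zero_mul', PolyForms.ofForm_const_mul, PolyForms.ofForm_const_mul,
      add_zero, pow_zero, one_smul, one_smul, sub_zero] at h
    rw [PolyForms.ofVector_smul, h, sub_add_cancel]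
  let α : L₁ →ₗ[A] A :=
    { toFun := c
      map_add' := fun x y => by
        refine PolyForms.smul_one_injective (L₁ := L₁) (L₂ := L₂) ?_
        rw [add_smul, ← hc, ← hc, ← hc, PolyForms.ofVector_add, map_add, map_add]
        abel
      map_smul' := fun a x => by
        refine PolyForms.smul_one_injective (L₁ := L₁) (L₂ := L₂) ?_
        rw [RingHom.id_apply, smul_eq_mul, mul_smul, ← hc, ← hc, hsmul hD, hsmul h₀, smul_sub]
        abel }
  have hgen : IsGenerator (T.divergenceBracket hrank Ω 0) (T.divergence hrank Ω α) := by
    rw [T.divergenceBracket_eq_of_form hrank Ω 0 α]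
    exact T.isGenerator_divergence hrank Ω α
  -- Both operators generate the same bracket, so agreement on `L₁` is enough.
  refine ⟨α, hD.ext hgen fun x => ?_⟩
  rw [divergence_ofVector]
  exact eq_add_of_sub_eq' (hc x)

variable {α}

theorem divergence_divergence (hT : T.IsTwilled) (hα : T.IsClosedForm α)
    (hα' : T.IsInvariantForm α) (m : PolyForms A L₁ L₂) :
    T.divergence hrank Ω α (T.divergence hrank Ω α m) = 0 := by
  apply PolyForms.flat_eq_imp_eq hrank Ω
  rw [flat_divergence, flat_divergence, map_zero]
  exact (T.dPrime_dPrime_and_dMixed_dPrime hT hα hα' _).1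

theorem dPoly_divergence (hΩ : ∀ (ξ : L₂) (u : ⋀[A]^n L₁), Ω ((T.act₂₁.ext n).toEnd ξ u) = ⁅ξ, Ω u⁆)
    (m : PolyForms A L₁ L₂) : PolyForms.flat (Ω : ⋀[A]^n L₁ →ₗ[A] A)
      (T.dPoly (T.divergence hrank Ω α m) + T.divergence hrank Ω α (T.dPoly m)) =
      T.dMixed (T.dPrime α (PolyForms.flat (Ω : ⋀[A]^n L₁ →ₗ[A] A) m)) +
        T.dPrime α (T.dMixed (PolyForms.flat (Ω : ⋀[A]^n L₁ →ₗ[A] A) m)) := by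
  rw [map_add, T.flat_dPoly (Ω : ⋀[A]^n L₁ →ₗ[A] A) hΩ, flat_divergence, flat_divergence,
    T.flat_dPoly (Ω : ⋀[A]^n L₁ →ₗ[A] A) hΩ]

end AlmostTwilled

/-! ### Assembling the theorem. -/

namespace AlmostTwilled

variable {R A L₁ L₂ : Type*} [CommRing R] [CommRing A] [Algebra R A]
  [LieRing L₁] [LieAlgebra R L₁] [Module A L₁] [LieRingModule L₁ A] [LieRinehartRing A L₁]
  [LieRinehartAlgebra R A L₁]
  [LieRing L₂] [LieAlgebra R L₂] [Module A L₂] [LieRingModule L₂ A] [LieRinehartRing A L₂]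
  [LieRinehartAlgebra R A L₂] [Module.Finite A L₁] [Module.Projective A L₁] {n : ℕ}
  (T : AlmostTwilled R A L₁ L₂)
  (hrank : ∀ P : PrimeSpectrum A, Module.rankAtStalk L₁ P = n) (Ω : ⋀[A]^n L₁ ≃ₗ[A] A)

theorem eq_divergence {α : L₁ →ₗ[A] A} {D : PolyForms A L₁ L₂ →ₗ[R] PolyForms A L₁ L₂}
    (h : ∀ m, PolyForms.flat (Ω : ⋀[A]^n L₁ →ₗ[A] A) (D m) =
      T.dPrime α (PolyForms.flat (Ω : ⋀[A]^n L₁ →ₗ[A] A) m)) : D = T.divergence hrank Ω α :=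
  LinearMap.ext fun m => PolyForms.flat_eq_imp_eq hrank Ω <| by rw [h, flat_divergence]

theorem isExactGenerator_divergence (hT : T.IsTwilled) {α : L₁ →ₗ[A] A} (hα : T.IsClosedForm α)
    (hα' : T.IsInvariantForm α) (β : L₁ →ₗ[A] A) :
    IsExactGenerator (T.divergenceBracket hrank Ω β) (T.divergence hrank Ω α) := by
  rw [T.divergenceBracket_eq_of_form hrank Ω β α]
  exact ⟨T.isGenerator_divergence hrank Ω α, T.divergence_divergence hrank Ω hT hα hα'⟩

theorem dPoly_divergence_eq_zero (hT : T.IsTwilled)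
    (hΩ : ∀ (ξ : L₂) (u : ⋀[A]^n L₁), Ω ((T.act₂₁.ext n).toEnd ξ u) = ⁅ξ, Ω u⁆)
    {α : L₁ →ₗ[A] A} (hα : T.IsClosedForm α) (hα' : T.IsInvariantForm α)
    (m : PolyForms A L₁ L₂) :
    T.dPoly (T.divergence hrank Ω α m) + T.divergence hrank Ω α (T.dPoly m) = 0 := by
  apply PolyForms.flat_eq_imp_eq hrank Ω
  rw [T.dPoly_divergence hrank Ω hΩ, map_zero]
  exact (T.dPrime_dPrime_and_dMixed_dPrime hT hα hα' _).2

theorem isClosedForm_of_divergence_divergence {α : L₁ →ₗ[A] A}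
    (h : ∀ m, T.divergence hrank Ω α (T.divergence hrank Ω α m) = 0) : T.IsClosedForm α := by
  refine T.isClosedForm_of_dPrime_dPrime fun w => ?_
  obtain ⟨m, rfl⟩ := (PolyForms.flat_bijective (L₂ := L₂) hrank Ω).2 w
  rw [← T.flat_divergence hrank, ← T.flat_divergence hrank, h, map_zero]

theorem isInvariantForm_of_dPoly_divergence
    (hΩ : ∀ (ξ : L₂) (u : ⋀[A]^n L₁), Ω ((T.act₂₁.ext n).toEnd ξ u) = ⁅ξ, Ω u⁆)
    {α : L₁ →ₗ[A] A}
    (h : ∀ m, T.dPoly (T.divergence hrank Ω α m) + T.divergence hrank Ω α (T.dPoly m) = 0) :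
    T.IsInvariantForm α := by
  refine T.isInvariantForm_of_anticommute fun w => ?_
  obtain ⟨m, rfl⟩ := (PolyForms.flat_bijective (L₂ := L₂) hrank Ω).2 w
  rw [← T.dPoly_divergence hrank Ω hΩ, h, map_zero]

theorem eq_of_flat_divergence {α β : L₁ →ₗ[A] A}
    (h : ∀ m, PolyForms.flat (Ω : ⋀[A]^n L₁ →ₗ[A] A) (T.divergence hrank Ω α m) =
      T.dPrime β (PolyForms.flat (Ω : ⋀[A]^n L₁ →ₗ[A] A) m)) : β = α := by
  refine T.eq_of_dPrime_eq fun w => ?_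
  obtain ⟨m, rfl⟩ := (PolyForms.flat_bijective (L₂ := L₂) hrank Ω).2 w
  rw [← h, flat_divergence]

end AlmostTwilled

theorem theorem5p4p7 {R A L₁ L₂ : Type*} [CommRing R] [CommRing A] [Algebra R A]
    [LieRing L₁] [LieAlgebra R L₁] [Module A L₁] [LieRingModule L₁ A] [LieRinehartRing A L₁]
    [LieRinehartAlgebra R A L₁]
    [LieRing L₂] [LieAlgebra R L₂] [Module A L₂] [LieRingModule L₂ A] [LieRinehartRing A L₂]
    [LieRinehartAlgebra R A L₂]
    (T : AlmostTwilled R A L₁ L₂) (hT : T.IsTwilled)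
    (hfin : Module.Finite A L₁) (hproj : Module.Projective A L₁)
    (n : ℕ) (hrank : ∀ P : PrimeSpectrum A, Module.rankAtStalk L₁ P = n)
    (Ω : ⋀[A]^n L₁ ≃ₗ[A] A)
    (hΩ : ∀ (ξ : L₂) (u : ⋀[A]^n L₁), Ω ((T.act₂₁.ext n).toEnd ξ u) = ⁅ξ, Ω u⁆) :
    -- `Ω` induces an isomorphism of differential graded `Alt(L₂, A)`-modules
    Function.Bijective (PolyForms.flat (L₂ := L₂) (Ω : ⋀[A]^n L₁ →ₗ[A] A)) ∧
    (∀ m : PolyForms A L₁ L₂,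
      PolyForms.flat (Ω : ⋀[A]^n L₁ →ₗ[A] A) (T.dPoly m) =
        T.dMixed (PolyForms.flat (Ω : ⋀[A]^n L₁ →ₗ[A] A) m)) ∧
    (∀ (a : DirectSum ℕ fun q => L₂ [⋀^Fin q]→ₗ[A] A) (m : PolyForms A L₁ L₂),
      PolyForms.flat (Ω : ⋀[A]^n L₁ →ₗ[A] A) (BiForms.act a m) =
        BiForms.act a (PolyForms.flat (Ω : ⋀[A]^n L₁ →ₗ[A] A) m)) ∧
    -- the crossed product Gerstenhaber bracket
    ∃ B : PolyForms A L₁ L₂ →ₗ[R] PolyForms A L₁ L₂ →ₗ[R] PolyForms A L₁ L₂,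
      T.IsCrossedProductBracket B ∧ (∀ B', T.IsCrossedProductBracket B' → B' = B) ∧
      -- the exact generator corresponding to `d'`
      (∃ D : PolyForms A L₁ L₂ →ₗ[R] PolyForms A L₁ L₂,
        (∀ m, PolyForms.flat (Ω : ⋀[A]^n L₁ →ₗ[A] A) (D m) =
          T.dPrime 0 (PolyForms.flat (Ω : ⋀[A]^n L₁ →ₗ[A] A) m)) ∧
        (∀ D' : PolyForms A L₁ L₂ →ₗ[R] PolyForms A L₁ L₂,
          (∀ m, PolyForms.flat (Ω : ⋀[A]^n L₁ →ₗ[A] A) (D' m) =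
            T.dPrime 0 (PolyForms.flat (Ω : ⋀[A]^n L₁ →ₗ[A] A) m)) → D' = D) ∧
        IsExactGenerator B D ∧ ∀ m, T.dPoly (D m) + D (T.dPoly m) = 0) ∧
      -- the exact generators corresponding to closed invariant 1-forms
      (∀ α : L₁ →ₗ[A] A, T.IsClosedForm α → T.IsInvariantForm α →
        ∃ D : PolyForms A L₁ L₂ →ₗ[R] PolyForms A L₁ L₂,
          (∀ m, PolyForms.flat (Ω : ⋀[A]^n L₁ →ₗ[A] A) (D m) =
            T.dPrime α (PolyForms.flat (Ω : ⋀[A]^n L₁ →ₗ[A] A) m)) ∧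
          (∀ D' : PolyForms A L₁ L₂ →ₗ[R] PolyForms A L₁ L₂,
            (∀ m, PolyForms.flat (Ω : ⋀[A]^n L₁ →ₗ[A] A) (D' m) =
              T.dPrime α (PolyForms.flat (Ω : ⋀[A]^n L₁ →ₗ[A] A) m)) → D' = D) ∧
          IsExactGenerator B D ∧ ∀ m, T.dPoly (D m) + D (T.dPoly m) = 0) ∧
      -- every exact generator arises in this way
      (∀ D : PolyForms A L₁ L₂ →ₗ[R] PolyForms A L₁ L₂, IsExactGenerator B D →
        ∃! α : L₁ →ₗ[A] A, T.IsClosedForm α ∧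
          (T.IsInvariantForm α ↔ ∀ m, T.dPoly (D m) + D (T.dPoly m) = 0) ∧
          ∀ m, PolyForms.flat (Ω : ⋀[A]^n L₁ →ₗ[A] A) (D m) =
            T.dPrime α (PolyForms.flat (Ω : ⋀[A]^n L₁ →ₗ[A] A) m)) := by
  have h0 := T.isClosedForm_zero
  have h0' := T.isInvariantForm_zero
  refine ⟨PolyForms.flat_bijective hrank Ω, T.flat_dPoly _ hΩ, PolyForms.flat_act _,
    -- The bracket is taken from the form zero, which is closed and invariant; the Jacobi identity
    -- needs the square of the generator to vanish.
    T.divergenceBracket hrank Ω 0, ?_, ?_, ?_, ?_, ?_⟩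
  · exact T.isCrossedProductBracket_divergenceBracket hrank Ω 0
      (T.divergence_divergence hrank Ω hT h0 h0')
  · exact fun B' hB' => AlmostTwilled.IsCrossedProductBracket.unique T hB'
      (T.isCrossedProductBracket_divergenceBracket hrank Ω 0
        (T.divergence_divergence hrank Ω hT h0 h0'))
  · exact ⟨T.divergence hrank Ω 0, T.flat_divergence hrank Ω 0,
      fun D' h => T.eq_divergence hrank Ω h, T.isExactGenerator_divergence hrank Ω hT h0 h0' 0,
      T.dPoly_divergence_eq_zero hrank Ω hT hΩ h0 h0'⟩
  · exact fun α hα hα' => ⟨T.divergence hrank Ω α, T.flat_divergence hrank Ω α,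
      fun D' h => T.eq_divergence hrank Ω h, T.isExactGenerator_divergence hrank Ω hT hα hα' 0,
      T.dPoly_divergence_eq_zero hrank Ω hT hΩ hα hα'⟩
  · rintro D ⟨hD, hDD⟩
    -- The generating identity alone produces α; that the generator has square zero is used only
    -- afterwards, to see that α is closed.
    obtain ⟨α, rfl⟩ := T.exists_eq_divergence hrank Ω hD
    have hα := T.isClosedForm_of_divergence_divergence hrank Ω hDD
    exact ⟨α, ⟨hα, ⟨fun hα' => T.dPoly_divergence_eq_zero hrank Ω hT hΩ hα hα',
      T.isInvariantForm_of_dPoly_divergence hrank Ω hΩ⟩, T.flat_divergence hrank Ω α⟩,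
      fun β hβ => T.eq_of_flat_divergence hrank Ω hβ.2.2⟩
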